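/- **Setting.** Let $\nu$ be a probability measure on $\mathbb R$ with finite second moment, $Y\sim\nu$, let $b:\mathbb R\to[0,\infty)$ be Borel with $\mathbb E[b(Y)]<\infty$, and let $L\ge 0$. Let $P$ be a Poisson random measure on $\mathbb R_+\times\mathbb R_+\times\mathbb R$ with intensity $ds\,d\theta\,\nu(dy)$, and let $\mathcal F_t$ be generated by the counts $P(A)$ of Borel sets $A\subset(0,t]\times\mathbb R_+\times\mathbb R$. Let $T>0$, let $h$ be a Borel kernel with $h\in L^1([0,T])$, and let $\psi:\mathbb R\to[0,\infty)$ be bounded and $L$-Lipschitz. The Hawkes risk $R$ with $\mathcal F$-predictable intensity $\lambda$ solves, almost surely for all $t\in[0,T]$, $$R_t=\int_{(0,t]\times\mathbb R_+\times\mathbb R}y\,\mathbf 1_{\theta\le\lambda_s}\,P(ds,d\theta,dy),\qquad \lambda_t=\psi\Big(\int_{[0,t)\times\mathbb R_+\times\mathbb R}h(t-s)\,b(y)\,\mathbf 1_{\theta\le\lambda_s}\,P(ds,d\theta,dy)\Big).$$ For $M\in\mathbb N^*$ and $\Delta=T/M$, the discrete-time risk built from the same $P$ is $$R^\Delta_t=\sum_{k=1}^{\lfloor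 t/\Delta\rfloor}\int_{((k-1)\Delta,k\Delta]\times\mathbb R_+\times\mathbb R}y\,\mathbf 1_{\theta\le l_k}\,P(ds,d\theta,dy),$$ $$l_n=\psi\Big(\sum_{k=1}^{n-1}h((n-k)\Delta)X_k\Big),\qquad X_k=\int_{((k-1)\Delta,k\Delta]\times\mathbb R_+\times\mathbb R}b(y)\,\mathbf 1_{\theta\le l_k}\,P(ds,d\theta,dy).$$ The Skorokhod distance is $d_S(f,g)=\inf_\tau\max\big(\sup_{t\in[0,T]}|t-\tau(t)|,\ \sup_{t\in[0,T]}|f(t)-g(\tau(t))|\big)$, over strictly increasing continuous $\tau:[0,T]\to[0,T]$ with $\tau(0)=0$, $\tau(T)=T$. Write $(y)_\Delta=\lfloor y/\Delta\rfloor\Delta$, let $\|\psi\|_\infty$ be the supremum of $\psi$ over $\mathbb R$, let $\|h\|_\infty$ and $\|h\|_{p\text{-var}}$ be the supremum norm and the $p$-variation of $h$ on $[0,T]$, and put $$\rho_h=L\,\mathbb E[b(Y)]\int_0^T|h(t)|\,dt,\quad \rho_{h,\Delta}=L\,\mathbb E[b(Y)]\sum_{k=1}^M|h(k\Delta)|\Delta,\quad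 \delta(h,\Delta)=\int_0^{T-\Delta}|h(y)-h((y)_\Delta+\Delta)|\,dy,$$ $$C_R(h,\Delta)=\int_0^\Delta|h(y)|\,dy+\sup_{\epsilon\in[0,\Delta]}\int_0^{T-\Delta}|h(y+\epsilon)-h(y)|\,dy+\delta(h,\Delta).$$ Consider the two bounds $$\mathbb E\,d_S(R,R^\Delta)\le K\Big(\Delta(1+T)(1+\|\psi\|_\infty)+\sqrt{T\,C_R(h,\Delta)}+T\,C_R(h,\Delta)\Big),\tag{1}$$ $$\mathbb E\,d_S(R,R^\Delta)\le K\Big(\Delta(1+T)(1+\|\psi\|_\infty+\|h\|_\infty)+\sqrt{\|h\|_{p\text{-var}}T^{\frac{2p-1}p}\Delta^{\frac1p}+T\Delta\|h\|_\infty}+\|h\|_{p\text{-var}}T^{\frac{2p-1}p}\Delta^{\frac1p}\Big).\tag{2}$$ **Theorem.** Let $\rho<1$. (A) For every $a$ there is $K>0$, depending only on $\nu,b,L,\rho,a$ (so not on $T$, $\Delta$, $h$ or $\|\psi\|_\infty$), such that for all $T>0$ and all $h$ with $\rho_h\le\rho$: 1. For every $M\ge1$ with $\rho_{h,\Delta}\le\rho$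 and every $\psi$ as above with $\psi(0)\le a$, (1) holds; and (2) holds for every real $p\ge1$ for which $h$ has finite $p$-variation on $[0,T]$. 2. If $\delta(h,T/M)\to0$ as $M\to\infty$, there is $\Delta_0>0$, not depending on $\psi$, such that (1) holds for all $M$ with $\Delta\le\Delta_0$ and all $\psi$ as above with $\psi(0)\le a$. 3. If $h$ has finite $p$-variation on $[0,T]$ for a real $p\ge1$, then $\delta(h,\Delta)\to0$ as $\Delta\downarrow0$, and there is $\Delta_0>0$, not depending on $\psi$, such that (2) holds for all $M$ with $\Delta\le\Delta_0$ and all $\psi$ as above with $\psi(0)\le a$. (B) For every $B$ there is $K>0$, depending only on $\nu,b,L,\rho,B$, such that for all $T>0$, all $h$ with $\rho_h\le\rho$, all $\psi$ as above with $\psi\le B$, and every $M\ge1$: (1) holds if $\delta(h,T/N)\to0$ as $N\to\infty$, and (2) holds for every real $p\ge1$ for which $h$ has finite $p$-variation on $[0,T]$. -/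

import Mathlib

open MeasureTheory ProbabilityTheory Set Filter Topology
open scoped NNReal ENNReal

universe u

noncomputable section

/-! ### Poisson random measures -/

/-- The space of points `(s, θ, y)`: time, thinning level, mark. -/
abbrev MarkSpace : Type := ℝ × ℝ × ℝ

/-- The intensity `ds × dθ × ν(dy)` on `(0, ∞) × (0, ∞) × ℝ`, seen as a measure on `ℝ × ℝ × ℝ`. -/
def poissonIntensity (ν : Measure ℝ) : Measure MarkSpace :=
  (volume.restrict (Ioi 0)).prod ((volume.restrict (Ioi 0)).prod ν)

/-- A random measure `P` (a kernel `ω ↦ P ω`) is a Poisson random measure with intensity `m`: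
counts of sets of finite intensity are Poisson distributed, and counts of pairwise disjoint sets
are independent. -/
structure IsPoissonRandomMeasure {Ω E : Type*} [MeasurableSpace Ω] [MeasurableSpace E]
    (μ : Measure Ω) (P : Kernel Ω E) (m : Measure E) : Prop where
  law : ∀ A : Set E, MeasurableSet A → m A ≠ ∞ →
    μ.map (fun ω => P ω A) =
      (poissonMeasure (m A).toNNReal).map (fun n : ℕ => (n : ℝ≥0∞))
  indep : ∀ (n : ℕ) (A : Fin n → Set E), (∀ i, MeasurableSet (A i)) →
    Pairwise (fun i j => Disjoint (A i) (A j)) →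
    iIndepFun (fun (i : Fin n) (ω : Ω) => P ω (A i)) μ

/-- The filtration of a random measure: `𝓕 t` is generated by the counts `P(A)`, with `A` a Borel
subset of `(0, t] × ℝ × ℝ`. -/
def randomMeasureFiltration {Ω : Type*} [mΩ : MeasurableSpace Ω] (P : Kernel Ω MarkSpace) :
    Filtration ℝ≥0 mΩ where
  seq t := ⨆ (A : Set MarkSpace) (_ : MeasurableSet A ∧ A ⊆ Ioc 0 (t : ℝ) ×ˢ univ),
    MeasurableSpace.comap (fun ω => P ω A) inferInstance
  mono' s t hst := by
    refine iSup₂_le fun A hA => ?_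
    refine le_iSup₂_of_le A ⟨hA.1, hA.2.trans ?_⟩ le_rfl
    exact prod_mono (Ioc_subset_Ioc_right (NNReal.coe_le_coe.2 hst)) le_rfl
  le' t := by
    refine iSup₂_le fun A hA => ?_
    exact (P.measurable_coe hA.1).comap_le

/-! ### The continuous-time and discrete-time Hawkes risks -/

/-- `∫_{I × ℝ₊ × ℝ} 1_{θ ≤ lam s} g(s, θ, y) p(ds, dθ, dy)`. -/
def thinnedIntegral (p : Measure MarkSpace) (I : Set ℝ) (lam : ℝ → ℝ) (g : MarkSpace → ℝ) : ℝ :=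
  ∫ x in I ×ˢ (Ici (0 : ℝ) ×ˢ (univ : Set ℝ)),
    {x : MarkSpace | x.2.1 ≤ lam x.1}.indicator g x ∂p

/-- `(R, lam)` is a marked Hawkes risk on `[0, T]` with its intensity, driven by `P`, with kernel
`h`, jump rate `ψ` and marks modulation function `b`: `lam` is predictable for the filtration of
`P`, and almost surely both equations of the thinning system hold at all times of `[0, T]`. -/
structure IsHawkesRisk {Ω : Type*} [MeasurableSpace Ω] (μ : Measure Ω) (P : Kernel Ω MarkSpace)
    (T : ℝ) (h ψ b : ℝ → ℝ) (lam : ℝ≥0 → Ω → ℝ) (R : ℝ → Ω → ℝ) : Prop where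
  predictable : IsStronglyPredictable (randomMeasureFiltration P) lam
  intensity_eq : ∀ᵐ ω ∂μ, ∀ t : ℝ≥0, (t : ℝ) ≤ T →
    lam t ω = ψ (thinnedIntegral (P ω) (Ico 0 (t : ℝ)) (fun s => lam s.toNNReal ω)
      (fun x => h (t - x.1) * b x.2.2))
  risk_eq : ∀ᵐ ω ∂μ, ∀ t ∈ Icc 0 T,
    R t ω = thinnedIntegral (P ω) (Ioc 0 t) (fun s => lam s.toNNReal ω) (fun x => x.2.2)

/-- The discrete intensities `l n = ψ (∑_{k=1}^{n-1} h((n-k)Δ) X k)` computed from a point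
configuration `p`, where `X k = ∫_{((k-1)Δ, kΔ] × ℝ₊ × ℝ} b(y) 1_{θ ≤ l k} p(ds, dθ, dy)`.
In particular `l 0 = l 1 = ψ 0`. -/
def discreteIntensity (p : Measure MarkSpace) (h ψ b : ℝ → ℝ) (Δ : ℝ) (n : ℕ) : ℝ :=
  ψ (∑ k ∈ (Finset.Ico 1 n).attach, h (((n : ℝ) - (k.1 : ℝ)) * Δ) *
    thinnedIntegral p (Ioc (((k.1 : ℝ) - 1) * Δ) ((k.1 : ℝ) * Δ))
      (fun _ => discreteIntensity p h ψ b Δ k.1) (fun x => b x.2.2))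
termination_by n
decreasing_by exact (Finset.mem_Ico.1 k.2).2

/-- The discrete-time Hawkes risk `R^Δ_t`, constant on the cells `[kΔ, (k+1)Δ)`. -/
def discreteRisk (p : Measure MarkSpace) (h ψ b : ℝ → ℝ) (Δ t : ℝ) : ℝ :=
  ∑ k ∈ Finset.Icc 1 ⌊t / Δ⌋₊,
    thinnedIntegral p (Ioc (((k : ℝ) - 1) * Δ) ((k : ℝ) * Δ))
      (fun _ => discreteIntensity p h ψ b Δ k) (fun x => x.2.2)

/-! ### The Skorokhod distance -/

/-- The strictly increasing continuous maps of `[0, T]` onto itself fixing both endpoints. -/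
def timeChanges (T : ℝ) : Set (ℝ → ℝ) :=
  {τ | StrictMonoOn τ (Icc 0 T) ∧ ContinuousOn τ (Icc 0 T) ∧ τ 0 = 0 ∧ τ T = T}

/-- The Skorokhod distance `inf_τ max (sup_t |t - τ t|) (sup_t |f t - g (τ t)|)` on `[0, T]`, as an
extended nonnegative number (it is finite as soon as `f` and `g` are bounded). -/
def skorokhodDist (T : ℝ) (f g : ℝ → ℝ) : ℝ≥0∞ :=
  ⨅ τ ∈ timeChanges T,
    (⨆ t ∈ Icc 0 T, edist t (τ t)) ⊔ (⨆ t ∈ Icc 0 T, edist (f t) (g (τ t)))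

/-- `𝔼 d_S(R, R^Δ) ≤ r` with `Δ = T / M`, for every Poisson random measure `P` of intensity
`ds dθ ν(dy)` and every Hawkes risk `R` driven by `P`, where `R^Δ` is the discrete-time risk built
from the same `P`. -/
def ExpectedSkorokhodLE (ν : Measure ℝ) (b : ℝ → ℝ) (T : ℝ) (M : ℕ) (h ψ : ℝ → ℝ) (r : ℝ) :
    Prop :=
  ∀ (Ω : Type u) [MeasurableSpace Ω] (μ : Measure Ω) [IsProbabilityMeasure μ]
    (P : Kernel Ω MarkSpace) (lam : ℝ≥0 → Ω → ℝ) (R : ℝ → Ω → ℝ),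
    IsPoissonRandomMeasure μ P (poissonIntensity ν) → IsHawkesRisk μ P T h ψ b lam R →
    ∫⁻ ω, skorokhodDist T (fun t => R t ω) (fun t => discreteRisk (P ω) h ψ b (T / M) t) ∂μ
      ≤ ENNReal.ofReal r

/-! ### Assumptions on the kernel and the jump rate -/

/-- `ρ_h = L ‖h‖_{L¹([0,T])} 𝔼[b(Y)]`, with `Y` of law `ν`. -/
def stabilityRatio (ν : Measure ℝ) (b : ℝ → ℝ) (L : ℝ≥0) (h : ℝ → ℝ) (T : ℝ) : ℝ :=
  L * (∫ t in (0 : ℝ)..T, |h t|) * ∫ y, b y ∂ν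

/-- `ρ_{h,Δ} = L ∑_{k=1}^M |h(kΔ)| Δ 𝔼[b(Y)]`, with `Δ = T / M`. -/
def discreteStabilityRatio (ν : Measure ℝ) (b : ℝ → ℝ) (L : ℝ≥0) (h : ℝ → ℝ) (T : ℝ) (M : ℕ) : ℝ :=
  L * (∑ k ∈ Finset.Icc 1 M, |h (k * (T / M))| * (T / M)) * ∫ y, b y ∂ν

/-- A Borel kernel, integrable on `[0, T]`, with stability ratio at most `ρ`. -/
structure IsStableKernel (ν : Measure ℝ) (b : ℝ → ℝ) (L : ℝ≥0) (ρ : ℝ) (h : ℝ → ℝ) (T : ℝ) :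
    Prop where
  measurable : Measurable h
  integrableOn : IntegrableOn h (Icc 0 T)
  ratio_le : stabilityRatio ν b L h T ≤ ρ

/-- A bounded nonnegative `L`-Lipschitz jump rate. -/
structure IsBoundedJumpRate (L : ℝ≥0) (ψ : ℝ → ℝ) : Prop where
  nonneg : ∀ x, 0 ≤ ψ x
  lipschitz : LipschitzWith L ψ
  bddAbove : BddAbove (range ψ)

/-- `∫_0^{T-Δ} |h(y) - h((y)_Δ + Δ)| dy`, with `(y)_Δ = ⌊y/Δ⌋ Δ`. -/
def gridDefect (h : ℝ → ℝ) (T Δ : ℝ) : ℝ :=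
  ∫ y in (0 : ℝ)..(T - Δ), |h y - h (⌊y / Δ⌋ * Δ + Δ)|

/-- The regularity constant `C_R(h, Δ)` of the kernel on `[0, T]`. -/
def kernelReg (h : ℝ → ℝ) (T Δ : ℝ) : ℝ :=
  (∫ y in (0 : ℝ)..Δ, |h y|)
    + sSup ((fun ε : ℝ => ∫ y in (0 : ℝ)..(T - Δ), |h (y + ε) - h y|) '' Icc 0 Δ)
    + gridDefect h T Δ

/-- The `p`-variation of `f` on `[0, T]`, as an extended nonnegative number. -/
def pVariation (p : ℝ) (f : ℝ → ℝ) (T : ℝ) : ℝ≥0∞ :=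
  (⨆ q : ℕ × {u : ℕ → ℝ // Monotone u ∧ ∀ i, u i ∈ Icc 0 T},
    ∑ i ∈ Finset.range q.1, edist (f (q.2.1 (i + 1))) (f (q.2.1 i)) ^ p) ^ (1 / p)

/-! ### The two error bounds -/

/-- `Δ (1 + T) (1 + ‖ψ‖_∞) + √(T C_R(h, Δ)) + T C_R(h, Δ)`. -/
def regBound (h ψ : ℝ → ℝ) (T Δ : ℝ) : ℝ :=
  Δ * (1 + T) * (1 + ⨆ x, |ψ x|) + √(T * kernelReg h T Δ) + T * kernelReg h T Δ

/-- `Δ (1 + T) (1 + ‖ψ‖_∞ + ‖h‖_∞) + √(V T^{(2p-1)/p} Δ^{1/p} + T Δ ‖h‖_∞) + V T^{(2p-1)/p} Δ^{1/p}`,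
with `V` the `p`-variation of `h` and `‖h‖_∞` its supremum norm, both on `[0, T]`. -/
def pVarBound (p : ℝ) (h ψ : ℝ → ℝ) (T Δ : ℝ) : ℝ :=
  Δ * (1 + T) * (1 + (⨆ x, |ψ x|) + ⨆ t : Icc 0 T, |h t|)
    + √((pVariation p h T).toReal * T ^ ((2 * p - 1) / p) * Δ ^ (1 / p)
        + T * Δ * ⨆ t : Icc 0 T, |h t|)
    + (pVariation p h T).toReal * T ^ ((2 * p - 1) / p) * Δ ^ (1 / p)

end

/-! Both risks read the same points of `P`, so only the points that they treat differently matter.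
`R^Δ` pays the jumps of a cell at its right end. To undo this delay, let `s k`, for `1 ≤ k < M`, be
the first point of the `k`-th cell accepted by the continuous intensity (the right end if there is
none), put `s 0 = 0` and `s M = T`, and take for `τ` the piecewise linear map with `τ (s k) = k Δ`.
It moves time by at most `2 Δ`. After it, a point contributes to the difference only if its level
lies between the two intensities, or it follows another accepted point of its cell, or it is in the
last cell, where the node is forced to be `T` (`skorokhodDist_le_markGap`).

These three conditions are predictable in time up to null sets, so the compensation formula
(`lintegral_predictable`, `lintegral_thinning_le`) turns the expected sums of `|y|` into `E|Y|`
times integrals of intensities. If `A` bounds the mean intensity, an earlier accepted point in the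
cell has probability at most `Δ A`, so the second condition costs `T Δ A ‖ψ‖_∞`; the third costs `Δ
A`; the first costs `∫ E|λ_s - l_s| ds`, where `l_s` is the discrete intensity of the cell of `s`
(`lintegral_skorokhodDist_le`).

The Lipschitz bound started from `ψ 0` gives `sup E λ ≤ ψ(0) + ρ sup E λ`, hence `A = ψ(0) / (1 -
ρ)`, in which `‖ψ‖_∞` is absent (`meanIntensity_le`). For the gap, `|λ_s - l_k|` with `s` in the
`k`-th cell is split into the error of the kernel on the points accepted by `λ`, of mean at most `L
E[b(Y)] C_R A`, and the discretized kernel on the points where the acceptances differ, whose mean is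
a discrete convolution of earlier gaps (`meanGap_le`). Summing over the cells, the convolution is
absorbed as soon as the discrete stability ratio is below one, and the total gap is of order `T C_R`
(`sum_meanGap_le`). The error is therefore linear in `T C_R`; the square roots of the two bounds are
not needed.

Discrete stability is either assumed or deduced: a Riemann sum of `|h|` exceeds its integral by at
most `δ`, so the discrete ratio is at most `(1 + ρ) / 2` once `δ` is below a threshold `η`. If `δ >
η`, then `C_R > η`, and the trivial bound `B T` on the total gap is at most `B T C_R / η`; this is
why part (B) covers all step sizes. Finally, an increment of `h` over a length at most `Δ` has
integral at most `V Δ^(1/p) T^(1-1/p)`, by averaging sums of increments over the offset of a grid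
and by Hölder (`setLIntegral_edist_le`), so (2) follows from the same estimate as (1). -/

namespace Hawkes

variable {Ω : Type*} [mΩ : MeasurableSpace Ω]

/-! ### Generalities on kernels -/

/-- Cutting according to the integer part of the total mass gives pieces that are uniformly bounded,
although the kernel is only finite at each point. -/
lemma isSFiniteKernel_of_lt_top {α β : Type*} [MeasurableSpace α] [MeasurableSpace β]
    (κ : Kernel α β) (hfin : ∀ a, κ a univ < ∞) : IsSFiniteKernel κ := by
  classical
  let N : α → ℕ := fun a => ⌊(κ a univ).toReal⌋₊
  have hN : Measurable N := Nat.measurable_floor.comp (κ.measurable_coe MeasurableSet.univ).ennreal_toReal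
  let κn : ℕ → Kernel α β := fun n => ⟨fun a => if N a = n then κ a else 0,
    Measurable.ite (hN (measurableSet_singleton n)) κ.measurable measurable_const⟩
  have hκn : ∀ n, IsFiniteKernel (κn n) := fun n => by
    refine ⟨(n + 1 : ℕ), by simp, fun a => ?_⟩
    change (if N a = n then κ a else 0) univ ≤ _
    split_ifs with h
    · rw [← ENNReal.toReal_le_toReal (hfin a).ne (by simp), ENNReal.toReal_natCast, ← h]
      push_cast
      exact (Nat.lt_floor_add_one _).le
    · simp
  refine ⟨κn, hκn, ?_⟩
  ext a A hA
  rw [Kernel.sum_apply' _ _ hA, tsum_eq_single (N a)]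
  · change _ = (if N a = N a then κ a else 0) A
    rw [if_pos rfl]
  · intro n hn
    change (if N a = n then κ a else 0) A = 0
    rw [if_neg hn.symm]
    simp

lemma measurable_lintegral_of_finite {α β : Type*} [MeasurableSpace α] [MeasurableSpace β]
    {κ : α → Measure β} (hκ : Measurable κ) (hfin : ∀ a, κ a univ < ∞)
    {f : α × β → ℝ≥0∞} (hf : Measurable f) : Measurable fun a => ∫⁻ b, f (a, b) ∂κ a :=
  have := isSFiniteKernel_of_lt_top ⟨κ, hκ⟩ hfin
  hf.lintegral_kernel_prod_right' (κ := ⟨κ, hκ⟩)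

/-- Meant for `m` a σ-algebra of the filtration of `P`, which is not completed. Setting the measures
of infinite mass to zero gives a version measurable for `m` itself rather than for its completion.
-/
lemma exists_measurable_ae_eq_lintegral {α β : Type*} {m m0 : MeasurableSpace α}
    [MeasurableSpace β] {μ : @Measure α m0}
    {κ : α → Measure β} (hκ : Measurable[m] κ) (hfin : ∀ᵐ a ∂μ, κ a univ < ∞)
    {f : α × β → ℝ≥0∞} (hf : Measurable[m.prod inferInstance] f) :
    ∃ g : α → ℝ≥0∞, Measurable[m] g ∧ g =ᵐ[μ] fun a => ∫⁻ b, f (a, b) ∂κ a := by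
  classical
  have hu : Measurable[m] fun a => κ a univ := (Measure.measurable_coe MeasurableSet.univ).comp hκ
  have hs : MeasurableSet[m] {a | κ a univ < ∞} := hu measurableSet_Iio
  have hκ' : Measurable[m] fun a => if κ a univ < ∞ then κ a else 0 :=
    Measurable.ite hs hκ (@measurable_const _ _ _ m _)
  refine ⟨_, @measurable_lintegral_of_finite α β m _ _ hκ' (fun a => ?_) f hf, ?_⟩
  · split_ifs with h
    · exact h
    · simp
  · filter_upwards [hfin] with a ha
    simp [ha]

/-! ### First moments of a Poisson random measure -/

lemma lintegral_natCast_poissonMeasure (r : ℝ≥0) :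
    ∫⁻ n : ℕ, (n : ℝ≥0∞) ∂poissonMeasure r = r := by
  have hs : HasSum (fun n : ℕ => Real.exp (-r) * r ^ n / (n.factorial : ℝ) * n) r := by
    have h := (hasSum_one_poissonMeasure r).mul_left (r : ℝ)
    rw [mul_one] at h
    rw [← hasSum_nat_add_iff' 1]
    simp only [Finset.range_one, Finset.sum_singleton, Nat.cast_zero, mul_zero, sub_zero]
    have he : (fun n : ℕ => Real.exp (-r) * (r : ℝ) ^ (n + 1) / ((n + 1).factorial : ℝ)
        * ((n + 1 : ℕ) : ℝ)) = fun n : ℕ => (r : ℝ) * (Real.exp (-r) * r ^ n / n.factorial) := by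
      ext n
      rw [Nat.factorial_succ]
      push_cast
      field_simp
      ring
    rw [he]
    exact h
  rw [poissonMeasure, lintegral_sum_measure]
  simp only [lintegral_smul_measure, lintegral_dirac, smul_eq_mul]
  have : ∀ n : ℕ, ENNReal.ofReal (Real.exp (-r) * r ^ n / (n.factorial : ℝ)) * (n : ℝ≥0∞)
      = ENNReal.ofReal (Real.exp (-r) * r ^ n / (n.factorial : ℝ) * n) := fun n => by
    rw [ENNReal.ofReal_mul (by positivity), ENNReal.ofReal_natCast]
  simp_rw [this]
  rw [← ENNReal.ofReal_tsum_of_nonneg (fun n => by positivity) hs.summable, hs.tsum_eq]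
  simp

variable {μ : Measure Ω} {E : Type*} [MeasurableSpace E] {P : Kernel Ω E} {m : Measure E}

lemma lintegral_count (hP : IsPoissonRandomMeasure μ P m) {A : Set E} (hA : MeasurableSet A)
    (hm : m A ≠ ∞) : ∫⁻ ω, P ω A ∂μ = m A := by
  have h1 : ∫⁻ ω, P ω A ∂μ = ∫⁻ x, x ∂(μ.map fun ω => P ω A) :=
    (lintegral_map measurable_id (P.measurable_coe hA)).symm
  rw [h1, hP.law A hA hm, lintegral_map (f := fun x => x) measurable_id (measurable_of_countable _),
    lintegral_natCast_poissonMeasure, ENNReal.coe_toNNReal hm]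

/-- The law is prescribed on sets of finite intensity only; exhaustion by spanning sets and monotone
convergence reach the others. -/
lemma bind_eq_intensity (hP : IsPoissonRandomMeasure μ P m) [SigmaFinite m] : μ.bind P = m := by
  ext A hA
  rw [Measure.bind_apply hA P.measurable.aemeasurable]
  have hmono : Monotone fun n => A ∩ spanningSets m n := fun i j hij =>
    inter_subset_inter_right _ (monotone_spanningSets m hij)
  have hU : ⋃ n, A ∩ spanningSets m n = A := by
    rw [← inter_iUnion, iUnion_spanningSets, inter_univ]
  have hAn : ∀ n, MeasurableSet (A ∩ spanningSets m n) := fun n =>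
    hA.inter (measurableSet_spanningSets m n)
  conv_lhs => rw [← hU]
  conv_rhs => rw [← hU]
  simp_rw [hmono.measure_iUnion]
  rw [lintegral_iSup (fun n => P.measurable_coe (hAn n)) (fun i j hij ω => measure_mono (hmono hij))]
  congr with n
  exact lintegral_count hP (hAn n) ((measure_mono inter_subset_right).trans_lt
    (measure_spanningSets_lt_top m n)).ne

lemma lintegral_lintegral_eq (hP : IsPoissonRandomMeasure μ P m) [SigmaFinite m]
    {f : E → ℝ≥0∞} (hf : Measurable f) : ∫⁻ ω, ∫⁻ x, f x ∂P ω ∂μ = ∫⁻ x, f x ∂m := by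
  rw [← Measure.lintegral_bind P.measurable.aemeasurable hf.aemeasurable, bind_eq_intensity hP]

/-! ### Integer values -/

lemma exists_nat_tsum {n : ℕ → ℕ} (h : ∑' i, (n i : ℝ≥0∞) ≠ ∞) :
    ∃ N : ℕ, ∑' i, (n i : ℝ≥0∞) = N := by
  have hz : {i | n i ≠ 0}.Finite := by
    refine (ENNReal.finite_const_le_of_tsum_ne_top h one_ne_zero).subset fun i hi => ?_
    have : 1 ≤ n i := Nat.one_le_iff_ne_zero.2 hi
    change (1 : ℝ≥0∞) ≤ n i
    exact_mod_cast this
  refine ⟨∑ i ∈ hz.toFinset, n i, ?_⟩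
  rw [tsum_eq_sum (s := hz.toFinset), Nat.cast_sum]
  intro i hi
  simpa using hi

/-- Sets of integer mass form a Dynkin class, because a convergent series of integers has finitely
many non-zero terms. -/
lemma exists_nat_of_isPiSystem {p : Measure E} [IsFiniteMeasure p] {C : Set (Set E)}
    (hgen : ‹MeasurableSpace E› = MeasurableSpace.generateFrom C) (hC : IsPiSystem C)
    (h : ∀ A ∈ C, ∃ n : ℕ, p A = n) (huniv : ∃ n : ℕ, p univ = n) {A : Set E}
    (hA : MeasurableSet A) : ∃ n : ℕ, p A = n := by
  induction A, hA using MeasurableSpace.induction_on_inter hgen hC with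
  | empty => exact ⟨0, by simp⟩
  | basic t ht => exact h t ht
  | compl t htm ih =>
    obtain ⟨n, hn⟩ := ih
    obtain ⟨k, hk⟩ := huniv
    exact ⟨k - n, by rw [measure_compl htm (measure_ne_top _ _), hn, hk]; simp⟩
  | iUnion f hd hfm ih =>
    choose n hn using ih
    have hsum : p (⋃ i, f i) = ∑' i, (n i : ℝ≥0∞) := by
      rw [measure_iUnion hd hfm]
      exact tsum_congr hn
    obtain ⟨N, hN⟩ := exists_nat_tsum (n := n) (hsum ▸ measure_ne_top p (⋃ i, f i))
    exact ⟨N, hsum.trans hN⟩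

lemma ae_exists_nat_count (hP : IsPoissonRandomMeasure μ P m) {A : Set E}
    (hA : MeasurableSet A) (hm : m A ≠ ∞) : ∀ᵐ ω ∂μ, ∃ n : ℕ, P ω A = n := by
  have hms : MeasurableSet (range fun n : ℕ => (n : ℝ≥0∞)) := (countable_range _).measurableSet
  have h : ∀ᵐ x ∂(μ.map fun ω => P ω A), x ∈ range fun n : ℕ => (n : ℝ≥0∞) := by
    rw [hP.law A hA hm]
    refine (ae_map_iff (measurable_of_countable _).aemeasurable hms).2 ?_
    exact Eventually.of_forall fun n => ⟨n, rfl⟩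
  filter_upwards [(ae_map_iff (P.measurable_coe hA).aemeasurable hms).1 h] with ω ⟨n, hn⟩
  exact ⟨n, hn.symm⟩

/-- Almost surely, a Poisson random measure takes integer values on all measurable subsets of a
set of finite intensity. -/
lemma ae_forall_exists_nat [MeasurableSpace.CountablyGenerated E]
    (hP : IsPoissonRandomMeasure μ P m) {D : Set E}
    (hD : MeasurableSet D) (hm : m D ≠ ∞) :
    ∀ᵐ ω ∂μ, ∀ A, MeasurableSet A → ∃ n : ℕ, P ω (A ∩ D) = n := by
  -- The null set excluded by the law depends on the set that is counted. A countable generating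
  -- algebra leaves countably many of them; the Dynkin argument, at fixed `ω`, then reaches all
  -- measurable sets.
  have hc := MeasurableSpace.countable_countableGeneratingSet (α := E)
  set C := generateSetAlgebra (MeasurableSpace.countableGeneratingSet E) with hCdef
  have hgen : ‹MeasurableSpace E› = MeasurableSpace.generateFrom C := by
    rw [hCdef, generateFrom_generateSetAlgebra_eq, MeasurableSpace.generateFrom_countableGeneratingSet]
  have hCc : C.Countable := countable_generateSetAlgebra hc
  have hCm : ∀ A ∈ C, MeasurableSet A := fun A hA => by
    rw [hgen]; exact MeasurableSpace.measurableSet_generateFrom hA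
  have h1 : ∀ᵐ ω ∂μ, ∀ A ∈ C, ∃ n : ℕ, P ω (A ∩ D) = n := by
    rw [ae_ball_iff hCc]
    intro A hA
    exact ae_exists_nat_count hP ((hCm A hA).inter hD)
      ((measure_mono inter_subset_right).trans_lt hm.lt_top).ne
  filter_upwards [h1, ae_exists_nat_count hP hD hm] with ω hω hωD A hA
  have hfin : IsFiniteMeasure ((P ω).restrict D) := ⟨by
    obtain ⟨n, hn⟩ := hωD
    rw [Measure.restrict_apply_univ, hn]; exact ENNReal.natCast_lt_top n⟩
  obtain ⟨n, hn⟩ := exists_nat_of_isPiSystem (p := (P ω).restrict D) hgen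
    (fun s hs t ht _ => isSetAlgebra_generateSetAlgebra.inter_mem hs ht) (fun A hA => by
      rw [Measure.restrict_apply (hCm A hA)]; exact hω A hA)
    (by rw [Measure.restrict_apply_univ]; exact hωD) hA
  exact ⟨n, by rw [← hn, Measure.restrict_apply hA]⟩

end Hawkes

namespace Hawkes

variable {Ω : Type*} [mΩ : MeasurableSpace Ω]

/-! ### Independence of disjoint regions -/

section Indep

variable {μ : Measure Ω} {E : Type*} [MeasurableSpace E] {P : Kernel Ω E}
  {m : Measure E}

/-- The σ-algebra generated by the counts of finitely many sets. -/
lemma indep_counts_finset (hP : IsPoissonRandomMeasure μ P m) {ι : Type*} (S : Finset ι)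
    (A : ι → Set E) (hA : ∀ i, MeasurableSet (A i)) {B : Set E} (hB : MeasurableSet B)
    (hd : ∀ i, Disjoint (A i) B) :
    Indep (⨆ i ∈ S, MeasurableSpace.comap (fun ω => P ω (A i)) inferInstance)
      (MeasurableSpace.comap (fun ω => P ω B) inferInstance) μ := by
  classical
  -- Independence is given for disjoint sets, whereas the `A i` may overlap, so they are cut into
  -- atoms. The intersection with the union discards the points outside every `A i`, which could lie
  -- in `B`.
  let atom : (S → Bool) → Set E := fun J => (⋃ i : S, A i) ∩ ⋂ i : S, if J i then A i else (A i)ᶜ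
  have hatom : ∀ J, MeasurableSet (atom J) := fun J =>
    (MeasurableSet.iUnion fun i => hA _).inter (MeasurableSet.iInter fun i => by
      split_ifs
      · exact hA _
      · exact (hA _).compl)
  have hatom_disj : Pairwise fun J K => Disjoint (atom J) (atom K) := by
    intro J K hJK
    obtain ⟨i, hi⟩ := Function.ne_iff.1 hJK
    refine Set.disjoint_left.2 fun x hx hx' => ?_
    have h1 := mem_iInter.1 hx.2 i
    have h2 := mem_iInter.1 hx'.2 i
    cases hJ : J i <;> cases hK : K i <;> simp_all
  let f : Option (S → Bool) → Set E := fun o => o.elim B atom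
  have hf : ∀ o, MeasurableSet (f o) := fun o => by
    cases o
    · exact hB
    · exact hatom _
  have hBa : ∀ J, Disjoint (atom J) B := fun J => by
    refine Disjoint.mono_left inter_subset_left ?_
    exact disjoint_iUnion_left.2 fun i => hd _
  have hfd : Pairwise fun o o' => Disjoint (f o) (f o') := by
    rintro (_ | J) (_ | K) h
    · exact absurd rfl h
    · exact (hBa K).symm
    · exact hBa J
    · exact hatom_disj (fun h' => h (by rw [h']))
  have hind : iIndepFun (fun o ω => P ω (f o)) μ := by
    let e := Fintype.equivFin (Option (S → Bool))
    have h := hP.indep _ (fun n => f (e.symm n)) (fun n => hf _)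
      (fun a b hab => hfd (fun h => hab (e.symm.injective h)))
    have h' := h.precomp (g := e) e.injective
    simpa [Function.comp_def] using h'
  have hind2 := hind.indepFun_finset (Finset.univ.image some) {none} (by simp)
    (fun o => P.measurable_coe (hf o))
  have h1 : Indep (MeasurableSpace.comap
      (fun ω (o : (Finset.univ.image some : Finset (Option (S → Bool)))) => P ω (f o)) inferInstance)
      (MeasurableSpace.comap (fun ω (o : ({none} : Finset (Option (S → Bool)))) => P ω (f o))
        inferInstance) μ := hind2
  refine indep_of_indep_of_le_left (indep_of_indep_of_le_right h1 ?_) ?_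
  · rw [← measurable_iff_comap_le]
    exact (measurable_pi_apply (X := fun _ : ({none} : Finset (Option (S → Bool))) => ℝ≥0∞)
      ⟨none, by simp⟩).comp (comap_measurable
        (fun ω (o : ({none} : Finset (Option (S → Bool)))) => P ω (f o)))
  · refine iSup₂_le fun i hi => ?_
    rw [← measurable_iff_comap_le]
    have hAi : ∀ ω, P ω (A i) = ∑ J ∈ Finset.univ.filter (fun J : S → Bool => J ⟨i, hi⟩ = true),
        P ω (atom J) := by
      intro ω
      rw [← measure_biUnion_finset (fun J _ K _ h => hatom_disj h) (fun J _ => hatom J)]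
      congr 1
      ext x
      simp only [mem_iUnion, Finset.mem_filter, Finset.mem_univ, true_and]
      constructor
      · intro hx
        refine ⟨fun j => decide (x ∈ A j), by simpa using hx, mem_iUnion.2 ⟨⟨i, hi⟩, hx⟩, ?_⟩
        refine mem_iInter.2 fun j => ?_
        by_cases h : x ∈ A j <;> simp [h]
      · rintro ⟨J, hJ, hx⟩
        have := mem_iInter.1 hx.2 ⟨i, hi⟩
        simpa [hJ] using this
    simp_rw [hAi]
    refine Finset.measurable_sum _ fun J _ => ?_
    exact (measurable_pi_apply
      (X := fun _ : (Finset.univ.image some : Finset (Option (S → Bool))) => ℝ≥0∞)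
      ⟨some J, by simp⟩).comp (comap_measurable
        (fun ω (o : (Finset.univ.image some : Finset (Option (S → Bool)))) => P ω (f o)))

end Indep

section Filtration

variable {μ : Measure Ω} [IsProbabilityMeasure μ] {P : Kernel Ω MarkSpace}
  {m : Measure MarkSpace}

/-- `𝓕 t` is the directed supremum of the σ-algebras generated by finitely many counts, and the sets
of these counts end at time `t`, before `B` starts. -/
lemma indep_filtration (hP : IsPoissonRandomMeasure μ P m) (t : ℝ≥0) {B : Set MarkSpace}
    (hB : MeasurableSet B) (hBt : B ⊆ Ioi (t : ℝ) ×ˢ univ) :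
    Indep (randomMeasureFiltration P t) (MeasurableSpace.comap (fun ω => P ω B) inferInstance) μ := by
  classical
  let ι := {A : Set MarkSpace // MeasurableSet A ∧ A ⊆ Ioc 0 (t : ℝ) ×ˢ univ}
  let ms : Finset ι → MeasurableSpace Ω := fun S =>
    ⨆ A ∈ S, MeasurableSpace.comap (fun ω => P ω A.1) inferInstance
  have hle : (randomMeasureFiltration P t : MeasurableSpace Ω) ≤ ⨆ S, ms S := by
    refine iSup₂_le fun A hA => ?_
    refine le_iSup_of_le ({⟨A, hA⟩} : Finset ι) ?_
    exact le_iSup₂_of_le (⟨A, hA⟩ : ι) (Finset.mem_singleton_self _) le_rfl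
  refine indep_of_indep_of_le_left ?_ hle
  refine indep_iSup_of_directed_le (fun S => ?_) (fun S => ?_) (P.measurable_coe hB).comap_le ?_
  · refine indep_counts_finset hP S (fun A : ι => A.1) (fun A => A.2.1) hB fun A => ?_
    refine Set.disjoint_left.2 fun x hx hx' => ?_
    have h1 := (A.2.2 hx).1.2
    have h2 := (hBt hx').1
    exact absurd h1 (not_le.2 h2)
  · exact iSup₂_le fun A _ => (P.measurable_coe A.2.1).comap_le
  · refine Monotone.directed_le fun S S' h => ?_
    exact biSup_mono fun A hA => h hA

/-- The compensation formula in its elementary case, an event of the past and a set of future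
points. -/
lemma setLIntegral_count (hP : IsPoissonRandomMeasure μ P m) (t : ℝ≥0) {B : Set MarkSpace}
    (hB : MeasurableSet B) (hBt : B ⊆ Ioi (t : ℝ) ×ˢ univ) (hm : m B ≠ ∞) {F : Set Ω}
    (hF : MeasurableSet[randomMeasureFiltration P t] F) :
    ∫⁻ ω in F, P ω B ∂μ = μ F * m B := by
  have hF' := (randomMeasureFiltration P).le t F hF
  have h := lintegral_mul_eq_lintegral_mul_lintegral_of_independent_measurableSpace
    (μ := μ) ((randomMeasureFiltration P).le t) (P.measurable_coe hB).comap_le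
    (indep_filtration hP t hB hBt) (f := F.indicator 1) (g := fun ω => P ω B)
    ((@measurable_const _ _ _ (randomMeasureFiltration P t) 1).indicator hF) (comap_measurable _)
  rw [← lintegral_indicator hF']
  have h2 : ∀ ω, F.indicator (fun ω => P ω B) ω = F.indicator 1 ω * P ω B := fun ω => by
    by_cases h : ω ∈ F <;> simp [h]
  simp_rw [h2]
  rw [h, lintegral_count hP hB hm]
  simp [lintegral_indicator_one hF']

end Filtration

end Hawkes

namespace Hawkes

variable {Ω : Type*} [mΩ : MeasurableSpace Ω]

/-! ### The compensation formula -/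

/-- Points with time in `(u, v]` and thinning level in `(0, c]`. -/
def box (u v c : ℝ) : Set MarkSpace := Ioc u v ×ˢ (Ioc 0 c ×ˢ univ)

lemma measurableSet_box (u v c : ℝ) : MeasurableSet (box u v c) :=
  measurableSet_Ioc.prod (measurableSet_Ioc.prod MeasurableSet.univ)

instance (ν : Measure ℝ) [IsProbabilityMeasure ν] : SigmaFinite (poissonIntensity ν) := by
  unfold poissonIntensity; infer_instance

variable {ν : Measure ℝ} [IsProbabilityMeasure ν]

lemma restrict_box {u : ℝ} (hu : 0 ≤ u) (v c : ℝ) :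
    (poissonIntensity ν).restrict (box u v c)
      = (volume.restrict (Ioc u v)).prod ((volume.restrict (Ioc 0 c)).prod ν) := by
  have h1 : Ioc u v ∩ Ioi 0 = Ioc u v := inter_eq_left.2 fun x hx => hu.trans_lt hx.1
  have h2 : Ioc 0 c ∩ Ioi 0 = Ioc 0 c := inter_eq_left.2 fun x hx => hx.1
  rw [poissonIntensity, box, ← Measure.prod_restrict, ← Measure.prod_restrict,
    Measure.restrict_restrict measurableSet_Ioc, Measure.restrict_restrict measurableSet_Ioc,
    Measure.restrict_univ, h1, h2]

lemma intensity_box {u : ℝ} (hu : 0 ≤ u) (v c : ℝ) :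
    poissonIntensity ν (box u v c) = ENNReal.ofReal (v - u) * ENNReal.ofReal c := by
  rw [← Measure.restrict_apply_univ, restrict_box hu, ← univ_prod_univ, Measure.prod_prod,
    ← univ_prod_univ, Measure.prod_prod]
  simp

lemma intensity_box_ne_top {u : ℝ} (hu : 0 ≤ u) (v c : ℝ) :
    poissonIntensity ν (box u v c) ≠ ∞ := by
  rw [intensity_box hu]; finiteness

lemma lintegral_map_eq_of_generateFrom {X Z : Type*} [MeasurableSpace X] {mZ : MeasurableSpace Z}
    {C : Set (Set Z)} (hgen : mZ = MeasurableSpace.generateFrom C) (hpi : IsPiSystem C)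
    {Q₁ Q₂ : Measure X} [IsFiniteMeasure Q₁] {Φ : X → Z} (hΦ : Measurable Φ)
    (h : ∀ s ∈ C, Q₁ (Φ ⁻¹' s) = Q₂ (Φ ⁻¹' s)) (huniv : Q₁ univ = Q₂ univ)
    {f : Z → ℝ≥0∞} (hf : Measurable f) : ∫⁻ x, f (Φ x) ∂Q₁ = ∫⁻ x, f (Φ x) ∂Q₂ := by
  have hm : ∀ s ∈ C, MeasurableSet s := fun s hs => by
    rw [hgen]; exact MeasurableSpace.measurableSet_generateFrom hs
  have : Q₁.map Φ = Q₂.map Φ := by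
    refine ext_of_generate_finite C hgen hpi (fun s hs => ?_) ?_
    · rw [Measure.map_apply hΦ (hm s hs), Measure.map_apply hΦ (hm s hs), h s hs]
    · rw [Measure.map_apply hΦ MeasurableSet.univ, Measure.map_apply hΦ MeasurableSet.univ]
      exact huniv
  rw [← lintegral_map hf hΦ, this, lintegral_map hf hΦ]

/-- The generator of the predictable σ-algebra. -/
def predictableRects (𝓕 : Filtration ℝ≥0 mΩ) : Set (Set (ℝ≥0 × Ω)) :=
  {s | ∃ A, MeasurableSet[𝓕 ⊥] A ∧ s = {⊥} ×ˢ A} ∪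
    {s | ∃ i A, MeasurableSet[𝓕 i] A ∧ s = Set.Ioi i ×ˢ A}

lemma isPiSystem_predictableRects (𝓕 : Filtration ℝ≥0 mΩ) : IsPiSystem (predictableRects 𝓕) := by
  rintro _ (⟨A, hA, rfl⟩ | ⟨i, A, hA, rfl⟩) _ (⟨B, hB, rfl⟩ | ⟨j, B, hB, rfl⟩) hne
  · exact Or.inl ⟨A ∩ B, hA.inter hB, by rw [prod_inter_prod, inter_self]⟩
  · obtain ⟨x, hx, hx'⟩ := hne
    have h1 : x.1 = ⊥ := hx.1
    have h2 : j < x.1 := hx'.1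
    rw [h1] at h2
    exact absurd h2 not_lt_bot
  · obtain ⟨x, hx, hx'⟩ := hne
    have h1 : x.1 = ⊥ := hx'.1
    have h2 : i < x.1 := hx.1
    rw [h1] at h2
    exact absurd h2 not_lt_bot
  · exact Or.inr ⟨i ⊔ j, A ∩ B, (𝓕.mono le_sup_left _ hA).inter (𝓕.mono le_sup_right _ hB), by
      rw [prod_inter_prod, Ioi_inter_Ioi]⟩

lemma isCountablySpanning_predictableRects (𝓕 : Filtration ℝ≥0 mΩ) :
    IsCountablySpanning (predictableRects 𝓕) := by
  refine ⟨fun n => if n = 0 then {⊥} ×ˢ univ else Ioi ⊥ ×ˢ univ, fun n => ?_, ?_⟩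
  · dsimp only
    split_ifs
    · exact Or.inl ⟨univ, MeasurableSet.univ, rfl⟩
    · exact Or.inr ⟨⊥, univ, MeasurableSet.univ, rfl⟩
  · refine eq_univ_of_forall fun x => mem_iUnion.2 ?_
    rcases eq_or_ne x.1 ⊥ with h | h
    · exact ⟨0, by simp [h]⟩
    · exact ⟨1, by simpa using bot_lt_iff_ne_bot.2 h⟩

lemma predictable_le (𝓕 : Filtration ℝ≥0 mΩ) :
    𝓕.predictable ≤ (inferInstance : MeasurableSpace (ℝ≥0 × Ω)) :=
  measurableSpace_le_predictable_of_measurableSet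
    (fun _ hA => (measurableSet_singleton _).prod (𝓕.le _ _ hA))
    (fun _ _ hA => measurableSet_Ioi.prod (𝓕.le _ _ hA))

/-- Pairs of a predictable coordinate and a mark coordinate. -/
abbrev predictableMark (P : Kernel Ω MarkSpace) : MeasurableSpace ((ℝ≥0 × Ω) × (ℝ × ℝ)) :=
  (randomMeasureFiltration P).predictable.prod inferInstance

lemma predictableMark_le (P : Kernel Ω MarkSpace) :
    predictableMark P ≤ (inferInstance : MeasurableSpace ((ℝ≥0 × Ω) × (ℝ × ℝ))) :=
  sup_le_sup_right (MeasurableSpace.comap_mono (predictable_le _)) _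

variable {μ : Measure Ω} {P : Kernel Ω MarkSpace}

lemma ae_count_box_lt_top (hP : IsPoissonRandomMeasure μ P (poissonIntensity ν)) {u : ℝ}
    (hu : 0 ≤ u) (v c : ℝ) : ∀ᵐ ω ∂μ, P ω (box u v c) < ∞ := by
  filter_upwards [ae_exists_nat_count hP (measurableSet_box u v c) (intensity_box_ne_top hu v c)]
    with ω ⟨n, hn⟩
  rw [hn]; exact ENNReal.natCast_lt_top n

variable [IsProbabilityMeasure μ]

/-- Both sides integrate `f` against measures that the box makes finite, so agreement on a
generating π-system suffices. On `(i, ∞) × A × B` it is the independence of the past up to `i` from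
later points; on `{0} × A × B` both sides vanish, since the times of the box are positive. -/
theorem lintegral_predictable (hP : IsPoissonRandomMeasure μ P (poissonIntensity ν)) (T c : ℝ)
    {f : (ℝ≥0 × Ω) × (ℝ × ℝ) → ℝ≥0∞} (hf : Measurable[predictableMark P] f) :
    ∫⁻ ω, ∫⁻ x in box 0 T c, f ((x.1.toNNReal, ω), x.2) ∂P ω ∂μ =
      ∫⁻ ω, ∫⁻ x in box 0 T c, f ((x.1.toNNReal, ω), x.2) ∂poissonIntensity ν ∂μ := by
  classical
  set D := box 0 T c with hDdef
  have hD : MeasurableSet D := measurableSet_box 0 T c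
  have hDtop : poissonIntensity ν D ≠ ∞ := intensity_box_ne_top le_rfl T c
  have hS : MeasurableSet {ω | P ω D < ∞} := P.measurable_coe hD measurableSet_Iio
  -- Disintegration along `μ` needs an s-finite kernel, hence the value zero on the null event where
  -- the box has infinite mass.
  let κ : Kernel Ω MarkSpace := Kernel.piecewise hS (P.restrict hD) 0
  have hκ : ∀ᵐ ω ∂μ, κ ω = (P ω).restrict D := by
    filter_upwards [ae_count_box_lt_top hP le_rfl T c] with ω hω
    change (Kernel.piecewise hS (P.restrict hD) 0) ω = _
    rw [Kernel.piecewise_apply, if_pos (show ω ∈ {ω | P ω D < ∞} from hω), Kernel.restrict_apply]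
  have hκs : IsSFiniteKernel κ := isSFiniteKernel_of_lt_top κ fun ω => by
    change (Kernel.piecewise hS (P.restrict hD) 0) ω univ < ∞
    rw [Kernel.piecewise_apply]
    split_ifs with h
    · rw [Kernel.restrict_apply, Measure.restrict_apply_univ]; exact h
    · simp
  let Φ : Ω × MarkSpace → (ℝ≥0 × Ω) × (ℝ × ℝ) := fun z => ((z.2.1.toNNReal, z.1), z.2.2)
  have hΦ0 : Measurable Φ := by fun_prop
  have hΦ : Measurable[_, predictableMark P] Φ := hΦ0.mono le_rfl (predictableMark_le P)
  let C := image2 (· ×ˢ ·) (predictableRects (randomMeasureFiltration P))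
    {s : Set (ℝ × ℝ) | MeasurableSet s}
  have hgen : predictableMark P = MeasurableSpace.generateFrom C :=
    (@generateFrom_eq_prod _ _ (randomMeasureFiltration P).predictable _ _ _ rfl
      MeasurableSpace.generateFrom_measurableSet
      (isCountablySpanning_predictableRects _) isCountablySpanning_measurableSet).symm
  have hpi : IsPiSystem C := (isPiSystem_predictableRects _).prod MeasurableSpace.isPiSystem_measurableSet
  have huniv : (μ ⊗ₘ κ) univ = (μ.prod ((poissonIntensity ν).restrict D)) univ := by
    rw [Measure.compProd_apply MeasurableSet.univ, ← univ_prod_univ (α := Ω), Measure.prod_prod,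
      Measure.restrict_apply_univ, measure_univ, one_mul, ← lintegral_count hP hD hDtop]
    refine lintegral_congr_ae ?_
    filter_upwards [hκ] with ω hω
    rw [hω]; simp
  have hfin : IsFiniteMeasure (μ ⊗ₘ κ) := ⟨by
    rw [huniv, ← univ_prod_univ (α := Ω), Measure.prod_prod, Measure.restrict_apply_univ,
      measure_univ, one_mul]
    exact hDtop.lt_top⟩
  have key : ∀ s ∈ C, (μ ⊗ₘ κ) (Φ ⁻¹' s) = (μ.prod ((poissonIntensity ν).restrict D)) (Φ ⁻¹' s) := by
    rintro _ ⟨r, hr, B, hB, rfl⟩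
    rcases hr with ⟨A, hA, rfl⟩ | ⟨i, A, hA, rfl⟩
    · have hA' := (randomMeasureFiltration P).le _ _ hA
      have hpre : Φ ⁻¹' (({⊥} ×ˢ A) ×ˢ B) = A ×ˢ {x | x.1.toNNReal = ⊥ ∧ x.2 ∈ B} := by
        ext z; simp only [Φ, mem_preimage, mem_prod, mem_singleton_iff, mem_ofPred_eq]; tauto
      have hms : MeasurableSet {x : MarkSpace | x.1.toNNReal = ⊥ ∧ x.2 ∈ B} :=
        ((measurable_fst.real_toNNReal) (measurableSet_singleton _)).inter (measurable_snd hB)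
      have hempty : {x : MarkSpace | x.1.toNNReal = ⊥ ∧ x.2 ∈ B} ∩ D = ∅ := by
        refine eq_empty_of_forall_notMem fun x hx => ?_
        have h1 : x.1.toNNReal = 0 := hx.1.1
        have h2 : 0 < x.1 := hx.2.1.1
        exact absurd (Real.toNNReal_eq_zero.1 h1) (not_le.2 h2)
      rw [hpre, Measure.compProd_apply_prod hA' hms, Measure.prod_prod,
        Measure.restrict_apply hms, hempty, measure_empty, mul_zero]
      rw [lintegral_eq_zero_iff (κ.measurable_coe hms)]
      filter_upwards [ae_restrict_of_ae hκ] with ω hω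
      rw [hω, Measure.restrict_apply hms, hempty, measure_empty]; rfl
    · have hA' := (randomMeasureFiltration P).le _ _ hA
      have hpre : Φ ⁻¹' ((Ioi i ×ˢ A) ×ˢ B) = A ×ˢ {x | i < x.1.toNNReal ∧ x.2 ∈ B} := by
        ext z; simp only [Φ, mem_preimage, mem_prod, mem_Ioi, mem_ofPred_eq]; tauto
      have hms : MeasurableSet {x : MarkSpace | i < x.1.toNNReal ∧ x.2 ∈ B} :=
        ((measurable_fst.real_toNNReal) measurableSet_Ioi).inter (measurable_snd hB)
      rw [hpre, Measure.compProd_apply_prod hA' hms, Measure.prod_prod,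
        Measure.restrict_apply hms]
      have h1 : ∫⁻ ω in A, κ ω {x | i < x.1.toNNReal ∧ x.2 ∈ B} ∂μ
          = ∫⁻ ω in A, P ω ({x | i < x.1.toNNReal ∧ x.2 ∈ B} ∩ D) ∂μ := by
        refine lintegral_congr_ae ?_
        filter_upwards [ae_restrict_of_ae hκ] with ω hω
        rw [hω, Measure.restrict_apply hms]
      rw [h1]
      refine setLIntegral_count hP i (hms.inter hD) ?_
        ((measure_mono inter_subset_right).trans_lt hDtop.lt_top).ne hA
      rintro x ⟨⟨hx, -⟩, -⟩
      exact ⟨Real.lt_toNNReal_iff_coe_lt.1 hx, mem_univ _⟩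
  have hmain := lintegral_map_eq_of_generateFrom hgen hpi hΦ key huniv hf
  have hfΦ : Measurable fun z => f (Φ z) := hf.comp hΦ
  rw [Measure.lintegral_compProd hfΦ, lintegral_prod _ hfΦ.aemeasurable] at hmain
  rw [← hmain]
  refine lintegral_congr_ae ?_
  filter_upwards [hκ] with ω hω
  rw [hω]

lemma measurable_thinning {X : Type*} [MeasurableSpace X] {G : X → ℝ≥0∞} (hG : Measurable G)
    {w : ℝ → ℝ≥0∞} (hw : Measurable w) {α β : X → ℝ} (hα : Measurable α) (hβ : Measurable β) :
    Measurable fun p : X × (ℝ × ℝ) =>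
      G p.1 * w p.2.2 * (Ioc (α p.1) (β p.1)).indicator 1 p.2.1 := by
  refine ((hG.comp measurable_fst).mul (hw.comp (measurable_snd.comp measurable_snd))).mul ?_
  have hs : MeasurableSet {p : X × (ℝ × ℝ) | α p.1 < p.2.1 ∧ p.2.1 ≤ β p.1} :=
    (measurableSet_lt (hα.comp measurable_fst) (measurable_fst.comp measurable_snd)).inter
      (measurableSet_le (measurable_fst.comp measurable_snd) (hβ.comp measurable_fst))
  exact (measurable_const (a := (1 : ℝ≥0∞))).indicator hs

/-- Upper bound for the expected sum, over the points of a Poisson random measure thinned between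
two predictable levels. -/
theorem lintegral_thinning_le (hP : IsPoissonRandomMeasure μ P (poissonIntensity ν)) (T c : ℝ)
    {G : ℝ≥0 × Ω → ℝ≥0∞} (hG : Measurable[(randomMeasureFiltration P).predictable] G)
    {w : ℝ → ℝ≥0∞} (hw : Measurable w) {α β : ℝ≥0 × Ω → ℝ}
    (hα : Measurable[(randomMeasureFiltration P).predictable] α)
    (hβ : Measurable[(randomMeasureFiltration P).predictable] β) :
    ∫⁻ ω, ∫⁻ x in box 0 T c, G (x.1.toNNReal, ω) * w x.2.2 *
        (Ioc (α (x.1.toNNReal, ω)) (β (x.1.toNNReal, ω))).indicator 1 x.2.1 ∂P ω ∂μ ≤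
      (∫⁻ y, w y ∂ν) * ∫⁻ s in Ioc 0 T, ∫⁻ ω, G (s.toNNReal, ω) *
        ENNReal.ofReal (β (s.toNNReal, ω) - α (s.toNNReal, ω)) ∂μ := by
  have hle := predictable_le (randomMeasureFiltration P)
  have hf := @measurable_thinning _ (randomMeasureFiltration P).predictable _ hG _ hw _ _ hα hβ
  rw [lintegral_predictable hP T c hf, restrict_box le_rfl]
  have hG0 : Measurable G := hG.mono hle le_rfl
  have hα0 : Measurable α := hα.mono hle le_rfl
  have hβ0 : Measurable β := hβ.mono hle le_rfl
  have hf0 := measurable_thinning hG0 hw hα0 hβ0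
  have hm1 : Measurable fun z : Ω × ℝ => (z.2.toNNReal, z.1) := by fun_prop
  have hinner : ∀ (p : ℝ≥0 × Ω), ∫⁻ z, G p * w z.2 * (Ioc (α p) (β p)).indicator 1 z.1
      ∂((volume.restrict (Ioc 0 c)).prod ν) ≤ (∫⁻ y, w y ∂ν) * (G p * ENNReal.ofReal (β p - α p)) := by
    intro p
    have hmi : Measurable fun θ => (Ioc (α p) (β p)).indicator (1 : ℝ → ℝ≥0∞) θ :=
      measurable_one.indicator measurableSet_Ioc
    have : ∀ z : ℝ × ℝ, G p * w z.2 * (Ioc (α p) (β p)).indicator 1 z.1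
        = G p * ((Ioc (α p) (β p)).indicator 1 z.1 * w z.2) := fun z => by ring
    simp_rw [this]
    have hmw : Measurable fun z : ℝ × ℝ => (Ioc (α p) (β p)).indicator (1 : ℝ → ℝ≥0∞) z.1 * w z.2 :=
      (hmi.comp measurable_fst).mul (hw.comp measurable_snd)
    rw [lintegral_const_mul _ hmw,
      lintegral_prod_mul hmi.aemeasurable hw.aemeasurable, lintegral_indicator_one measurableSet_Ioc]
    -- Only an inequality: levels outside `(0, c]` are not counted.
    have hv : (volume.restrict (Ioc 0 c)) (Ioc (α p) (β p)) ≤ ENNReal.ofReal (β p - α p) := by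
      refine (Measure.restrict_apply_le _ _).trans ?_
      rw [Real.volume_Ioc]
    calc _ ≤ G p * (ENNReal.ofReal (β p - α p) * ∫⁻ y, w y ∂ν) := by gcongr
      _ = _ := by ring
  calc _ = ∫⁻ ω, ∫⁻ s in Ioc 0 T, ∫⁻ z, G (s.toNNReal, ω) * w z.2 *
        (Ioc (α (s.toNNReal, ω)) (β (s.toNNReal, ω))).indicator 1 z.1
          ∂((volume.restrict (Ioc 0 c)).prod ν) ∂volume ∂μ := by
        refine lintegral_congr fun ω => ?_
        rw [lintegral_prod _ (Measurable.aemeasurable ?_)]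
        exact hf0.comp (by fun_prop : Measurable fun x : ℝ × (ℝ × ℝ) => ((x.1.toNNReal, ω), x.2))
    _ ≤ ∫⁻ ω, ∫⁻ s in Ioc 0 T, (∫⁻ y, w y ∂ν) * (G (s.toNNReal, ω) *
        ENNReal.ofReal (β (s.toNNReal, ω) - α (s.toNNReal, ω))) ∂volume ∂μ := by
        gcongr with ω s
        exact hinner _
    _ = _ := by
        have hm : Measurable fun z : Ω × ℝ => G (z.2.toNNReal, z.1) *
            ENNReal.ofReal (β (z.2.toNNReal, z.1) - α (z.2.toNNReal, z.1)) :=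
          (hG0.comp hm1).mul ((hβ0.comp hm1).sub (hα0.comp hm1)).ennreal_ofReal
        rw [lintegral_lintegral_swap (hm.const_mul _).aemeasurable, ← lintegral_const_mul _ hm.lintegral_prod_left']
        refine lintegral_congr fun s => ?_
        exact lintegral_const_mul _ (hm.comp measurable_prodMk_right)

end Hawkes

namespace Hawkes

/-! ### Time changes aligned with a grid -/

section TimeChange

/-- The function with slope `Δ / (s (j + 1) - s j)` on `[s j, s (j + 1)]`, for `j < M`. -/
noncomputable def gridChange (Δ : ℝ) (M : ℕ) (s : ℕ → ℝ) (t : ℝ) : ℝ :=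
  ∑ j ∈ Finset.range M, Δ * max 0 (min 1 ((t - s j) / (s (j + 1) - s j)))

lemma exists_mem_Ico_of_lt {s : ℕ → ℝ} {t : ℝ} (h0 : s 0 ≤ t) :
    ∀ n : ℕ, t < s n → ∃ k < n, t ∈ Ico (s k) (s (k + 1)) := by
  intro n
  induction n with
  | zero => intro h; exact absurd h (not_lt.2 h0)
  | succ n ih =>
    intro h
    by_cases hn : t < s n
    · obtain ⟨k, hk, hk'⟩ := ih hn
      exact ⟨k, hk.trans (Nat.lt_succ_self n), hk'⟩
    · exact ⟨n, Nat.lt_succ_self n, not_lt.1 hn, h⟩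

variable {Δ : ℝ} {M : ℕ} {s : ℕ → ℝ}

/-- On this interval the first `k` ramps are saturated at `Δ` and those after the `k`-th have not
started. -/
lemma gridChange_eq (hs : ∀ i j, i < j → j ≤ M → s i < s j) {k : ℕ}
    (hk : k < M) {t : ℝ} (ht : t ∈ Icc (s k) (s (k + 1))) :
    gridChange Δ M s t = k * Δ + Δ * ((t - s k) / (s (k + 1) - s k)) := by
  have hle : ∀ i j, i ≤ j → j ≤ M → s i ≤ s j := fun i j h hj => by
    rcases h.eq_or_lt with rfl | h
    · exact le_rfl
    · exact (hs i j h hj).le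
  have h1 : ∀ j ∈ Finset.range k, Δ * max 0 (min 1 ((t - s j) / (s (j + 1) - s j))) = Δ := by
    intro j hj
    have hj' := Finset.mem_range.1 hj
    have hd : 0 < s (j + 1) - s j := sub_pos.2 (hs _ _ (Nat.lt_succ_self j) (by omega))
    have : 1 ≤ (t - s j) / (s (j + 1) - s j) := by
      rw [one_le_div hd]
      linarith [hle (j + 1) k hj' hk.le, ht.1]
    rw [min_eq_left this, max_eq_right zero_le_one, mul_one]
  have h2 : ∀ j ∈ Finset.Ico (k + 1) M,
      Δ * max 0 (min 1 ((t - s j) / (s (j + 1) - s j))) = 0 := by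
    intro j hj
    have hj' := Finset.mem_Ico.1 hj
    have hd : 0 < s (j + 1) - s j := sub_pos.2 (hs _ _ (Nat.lt_succ_self j) (by omega))
    have : (t - s j) / (s (j + 1) - s j) ≤ 0 :=
      div_nonpos_of_nonpos_of_nonneg (by linarith [hle (k + 1) j hj'.1 hj'.2.le, ht.2]) hd.le
    rw [min_eq_right (this.trans zero_le_one), max_eq_left this, mul_zero]
  have hd : 0 < s (k + 1) - s k := sub_pos.2 (hs _ _ (Nat.lt_succ_self k) (by omega))
  have h3 : max 0 (min 1 ((t - s k) / (s (k + 1) - s k))) = (t - s k) / (s (k + 1) - s k) := by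
    have ha : 0 ≤ (t - s k) / (s (k + 1) - s k) := div_nonneg (by linarith [ht.1]) hd.le
    have hb : (t - s k) / (s (k + 1) - s k) ≤ 1 := (div_le_one hd).2 (by linarith [ht.2])
    rw [min_eq_right hb, max_eq_right ha]
  rw [gridChange, ← Finset.sum_range_add_sum_Ico _ (Nat.succ_le_of_lt hk), Finset.sum_range_succ,
    Finset.sum_congr rfl h1, Finset.sum_congr rfl h2, h3]
  simp

/-- `gridChange` carries `[s k, s (k + 1))` into `[k Δ, (k + 1) Δ)`, and both lie in `[(k - 1) Δ, (k
+ 1) Δ]`, whence `2 Δ`. The time `T` is treated apart because no half-open interval contains it. -/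
lemma skorokhodDist_le_of_grid {T : ℝ} (hΔ : 0 < Δ) (hM : 1 ≤ M) (hT : T = M * Δ)
    (hs0 : s 0 = 0) (hsM : s M = T)
    (hs : ∀ k, 1 ≤ k → k ≤ M → s k ∈ Ioc (((k : ℝ) - 1) * Δ) (k * Δ))
    {f g : ℝ → ℝ} {e : ℝ≥0∞}
    (he : ∀ k < M, ∀ t ∈ Ico (s k) (s (k + 1)), ∀ t' ∈ Ico ((k : ℝ) * Δ) ((k + 1 : ℝ) * Δ),
      edist (f t) (g t') ≤ e)
    (heT : edist (f T) (g T) ≤ e) : skorokhodDist T f g ≤ ENNReal.ofReal (2 * Δ) + e := by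
  have hs_le : ∀ i, i ≤ M → s i ≤ i * Δ := fun i hi => by
    rcases Nat.eq_zero_or_pos i with rfl | h
    · simp [hs0]
    · exact (hs i h hi).2
  have hs_ge : ∀ i, i ≤ M → (i - 1 : ℝ) * Δ ≤ s i := fun i hi => by
    rcases Nat.eq_zero_or_pos i with rfl | h
    · simp [hs0, hΔ.le]
    · exact (hs i h hi).1.le
  have hlt : ∀ i j, i < j → j ≤ M → s i < s j := fun i j hij hj => by
    refine (hs_le i (by omega)).trans_lt (lt_of_le_of_lt ?_ (hs j (by omega) hj).1)
    have : (i : ℝ) + 1 ≤ j := by exact_mod_cast hij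
    exact mul_le_mul_of_nonneg_right (by linarith) hΔ.le
  have hMT : s M = M * Δ := hsM.trans hT
  have h0T : 0 < T := by
    rw [← hsM, ← hs0]; exact hlt 0 M hM le_rfl
  have hcell : ∀ t ∈ Ico 0 T, ∃ k < M, t ∈ Ico (s k) (s (k + 1)) := fun t ht =>
    exists_mem_Ico_of_lt (hs0.le.trans ht.1) M (hsM ▸ ht.2)
  set τ := gridChange Δ M s with hτ
  have hτmem : ∀ k < M, ∀ t ∈ Ico (s k) (s (k + 1)),
      τ t ∈ Ico ((k : ℝ) * Δ) ((k + 1 : ℝ) * Δ) := by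
    intro k hk t ht
    have hd : 0 < s (k + 1) - s k := sub_pos.2 (hlt _ _ (Nat.lt_succ_self k) (by omega))
    rw [hτ, gridChange_eq hlt hk ⟨ht.1, ht.2.le⟩]
    have ha : 0 ≤ (t - s k) / (s (k + 1) - s k) := div_nonneg (by linarith [ht.1]) hd.le
    have hb : (t - s k) / (s (k + 1) - s k) < 1 := (div_lt_one hd).2 (by linarith [ht.2])
    constructor <;> nlinarith
  have hτT : τ T = T := by
    obtain ⟨n, rfl⟩ : ∃ n, M = n + 1 := ⟨M - 1, by omega⟩
    have hd : 0 < s (n + 1) - s n := sub_pos.2 (hlt _ _ (Nat.lt_succ_self n) le_rfl)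
    rw [hτ, gridChange_eq hlt (Nat.lt_succ_self n) (t := T) ⟨hsM ▸ (by linarith), hsM.ge⟩, ← hsM,
      div_self hd.ne', hMT]
    push_cast; ring
  have hτ0 : τ 0 = 0 := by
    rw [hτ, gridChange_eq hlt (Nat.lt_of_lt_of_le Nat.zero_lt_one hM) (t := 0)
      ⟨hs0.le, hs0 ▸ (hlt 0 1 one_pos hM).le⟩]
    simp [hs0]
  have hcont : Continuous τ := by
    rw [hτ]; unfold gridChange
    refine continuous_finsetSum _ fun j _ => ?_
    exact continuous_const.mul (continuous_const.max (continuous_const.min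
      ((continuous_id.sub continuous_const).div_const _)))
  have hmono : StrictMonoOn τ (Icc 0 T) := by
    intro x hx y hy hxy
    obtain ⟨k, hk, hxk⟩ := hcell x ⟨hx.1, hxy.trans_le hy.2⟩
    have hd : ∀ j < M, 0 < s (j + 1) - s j := fun j hj =>
      sub_pos.2 (hlt _ _ (Nat.lt_succ_self j) (by omega))
    refine Finset.sum_lt_sum (fun j hj => ?_) ⟨k, Finset.mem_range.2 hk, ?_⟩
    · have := hd j (Finset.mem_range.1 hj)
      gcongr
    · have hdk := hd k hk
      have hb : (x - s k) / (s (k + 1) - s k) < 1 := (div_lt_one hdk).2 (by linarith [hxk.2])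
      have ha : 0 ≤ (x - s k) / (s (k + 1) - s k) := div_nonneg (by linarith [hxk.1]) hdk.le
      have hab : (x - s k) / (s (k + 1) - s k) < (y - s k) / (s (k + 1) - s k) := by gcongr
      rw [min_eq_right hb.le, max_eq_right ha]
      refine mul_lt_mul_of_pos_left ?_ hΔ
      exact lt_max_of_lt_right (lt_min hb hab)
  have hτT' : ∀ t ∈ Icc 0 T, t = T ∨ t ∈ Ico 0 T := fun t ht => by
    rcases ht.2.eq_or_lt with h | h
    · exact Or.inl h
    · exact Or.inr ⟨ht.1, h⟩
  refine (iInf₂_le τ ⟨hmono, hcont.continuousOn, hτ0, hτT⟩).trans (sup_le ?_ ?_)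
  · refine le_add_right (iSup₂_le fun t ht => ?_)
    rcases hτT' t ht with rfl | ht
    · simp [hτT]
    · obtain ⟨k, hk, htk⟩ := hcell t ht
      have h1 := hτmem k hk t htk
      have h2 := hs_ge k hk.le
      have h3 := hs_le (k + 1) hk
      rw [edist_dist, Real.dist_eq]
      refine ENNReal.ofReal_le_ofReal (abs_le.2 ?_)
      push_cast at h3
      have h4 := htk.1
      have h5 := htk.2
      have h6 := h1.1
      have h7 := h1.2
      constructor <;> linarith
  · refine le_add_left (iSup₂_le fun t ht => ?_)
    rcases hτT' t ht with rfl | ht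
    · rw [hτT]; exact heT
    · obtain ⟨k, hk, htk⟩ := hcell t ht
      exact he k hk t htk _ (hτmem k hk t htk)

end TimeChange

end Hawkes

namespace Hawkes

/-! ### Integrals of increments and `p`-variation -/

lemma setLIntegral_shift (F : ℝ → ℝ≥0∞) (c d : ℝ) :
    ∫⁻ y in Ico c (c + d), F y = ∫⁻ r in Ico 0 d, F (r + c) := by
  have h := (measurePreserving_add_right volume c).setLIntegral_comp_preimage_emb
    (MeasurableEquiv.addRight c).measurableEmbedding F (Ico c (c + d))
  rw [← h]
  congr 2
  simp [preimage_add_const_Ico]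

lemma setLIntegral_reflect (F : ℝ → ℝ≥0∞) (a b c : ℝ) :
    ∫⁻ u in Ioc a b, F u = ∫⁻ v in Ico (c - b) (c - a), F (c - v) := by
  have h := (Measure.measurePreserving_sub_left volume c).setLIntegral_comp_preimage_emb
    (MeasurableEquiv.subLeft c).measurableEmbedding F (Ioc a b)
  rw [← h]
  congr 2
  simp [preimage_const_sub_Ioc]

lemma sum_setLIntegral_cells {Δ : ℝ} (hΔ : 0 ≤ Δ) (F : ℝ → ℝ≥0∞) (n : ℕ) :
    ∑ j ∈ Finset.range n, ∫⁻ y in Ico (j * Δ) ((j + 1) * Δ), F y = ∫⁻ y in Ico 0 (n * Δ), F y := by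
  induction n with
  | zero => simp
  | succ n ih =>
    rw [Finset.sum_range_succ, ih, ← lintegral_union measurableSet_Ico]
    · congr 2
      push_cast
      exact Ico_union_Ico_eq_Ico (by positivity) (by nlinarith)
    · exact Ico_disjoint_Ico.2 (by simp)

section PVariation

variable {p : ℝ} {f : ℝ → ℝ} {T : ℝ}

/-- The intervals `[a i, b i]` do not overlap, so their endpoints form one monotone sequence `a 0, b
0, a 1, b 1, …`, continued by `T`; only every second increment is kept. -/
lemma sum_edist_rpow_le_pVariation (hp : 0 < p) {n : ℕ} {a b : ℕ → ℝ}
    (hab : ∀ i < n, 0 ≤ a i ∧ a i ≤ b i ∧ b i ≤ T) (hba : ∀ i, i + 1 < n → b i ≤ a (i + 1)) :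
    ∑ i ∈ Finset.range n, edist (f (b i)) (f (a i)) ^ p ≤ pVariation p f T ^ p := by
  rcases Nat.eq_zero_or_pos n with rfl | hn
  · simp
  have hT : 0 ≤ T := by obtain ⟨h1, h2, h3⟩ := hab 0 hn; linarith
  let u : ℕ → ℝ := fun m => if m < 2 * n then (if m % 2 = 0 then a (m / 2) else b (m / 2)) else T
  have hu : Monotone u := by
    refine monotone_nat_of_le_succ fun m => ?_
    change (if m < 2 * n then _ else _) ≤ (if m + 1 < 2 * n then _ else _)
    by_cases h1 : m + 1 < 2 * n
    · rw [if_pos h1, if_pos (by omega)]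
      by_cases h2 : m % 2 = 0
      · rw [if_pos h2, if_neg (by omega), show (m + 1) / 2 = m / 2 by omega]
        exact (hab _ (by omega)).2.1
      · rw [if_neg h2, if_pos (by omega), show (m + 1) / 2 = m / 2 + 1 by omega]
        exact hba _ (by omega)
    · rw [if_neg h1]
      split_ifs with h2 h3
      · obtain ⟨_, h4, h5⟩ := hab (m / 2) (by omega); linarith
      · exact (hab (m / 2) (by omega)).2.2
      · exact le_rfl
  have hu' : ∀ i, u i ∈ Icc 0 T := fun m => by
    change (if m < 2 * n then _ else _) ∈ _
    split_ifs with h2 h3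
    · obtain ⟨h3, h4, h5⟩ := hab (m / 2) (by omega); exact ⟨h3, h4.trans h5⟩
    · obtain ⟨h3, h4, h5⟩ := hab (m / 2) (by omega); exact ⟨h3.trans h4, h5⟩
    · exact ⟨hT, le_rfl⟩
  rw [pVariation, ← ENNReal.rpow_mul, one_div, inv_mul_cancel₀ hp.ne', ENNReal.rpow_one]
  refine le_trans ?_ (le_iSup _ ((2 * n, ⟨u, hu, hu'⟩) :
    ℕ × {u : ℕ → ℝ // Monotone u ∧ ∀ i, u i ∈ Icc 0 T}))
  dsimp only
  calc _ = ∑ i ∈ (Finset.range n).image (fun i => 2 * i), edist (f (u (i + 1))) (f (u i)) ^ p := by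
        rw [Finset.sum_image (fun i _ j _ h => by simpa using h)]
        refine Finset.sum_congr rfl fun i hi => ?_
        have hi' := Finset.mem_range.1 hi
        have h1 : u (2 * i) = a i := by
          change (if 2 * i < 2 * n then _ else _) = _
          rw [if_pos (by omega), if_pos (by omega), show 2 * i / 2 = i by omega]
        have h2 : u (2 * i + 1) = b i := by
          change (if 2 * i + 1 < 2 * n then _ else _) = _
          rw [if_pos (by omega), if_neg (by omega), show (2 * i + 1) / 2 = i by omega]
        rw [h1, h2]
    _ ≤ _ := by
        refine Finset.sum_le_sum_of_subset fun i hi => ?_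
        obtain ⟨j, hj, rfl⟩ := Finset.mem_image.1 hi
        have := Finset.mem_range.1 hj
        exact Finset.mem_range.2 (by omega)

lemma edist_le_pVariation (hp : 0 < p) {x y : ℝ} (hx : 0 ≤ x) (hxy : x ≤ y) (hy : y ≤ T) :
    edist (f y) (f x) ≤ pVariation p f T := by
  have h := sum_edist_rpow_le_pVariation (f := f) hp (n := 1) (a := fun _ => x) (b := fun _ => y)
    (T := T) (fun i _ => ⟨hx, hxy, hy⟩) (fun i hi => by omega)
  simp only [Finset.range_one, Finset.sum_singleton] at h
  exact (ENNReal.rpow_le_rpow_iff hp).1 h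

/-- Fubini over the offset modulo `d`: for a fixed `r` the intervals from `r + j d` to `σ (r + j d)`
do not overlap, so the increments over them sum to at most the `p`-th power of the variation, and
`r` ranges over a length `d`. The bound on `σ` is needed only when another interval follows. -/
lemma setLIntegral_edist_rpow_le (hf : Measurable f) (hp : 0 < p) {σ : ℝ → ℝ}
    (hσ : Measurable σ) {c d : ℝ} (hd : 0 < d)
    (h1 : ∀ y ∈ Ico 0 c, y ≤ σ y ∧ σ y ≤ T) (h2 : ∀ y ∈ Ico 0 c, y + d < c → σ y ≤ y + d) :
    ∫⁻ y in Ico 0 c, edist (f (σ y)) (f y) ^ p ≤ pVariation p f T ^ p * ENNReal.ofReal d := by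
  let G : ℝ → ℝ≥0∞ := (Ico 0 c).indicator fun y => edist (f (σ y)) (f y) ^ p
  have hG : Measurable G :=
    (((hf.comp hσ).edist hf).pow_const p).indicator measurableSet_Ico
  have hGm : ∀ y ∈ Ico 0 c, G y = edist (f (σ y)) (f y) ^ p := fun y hy => indicator_of_mem hy _
  have hGn : ∀ y, y ∉ Ico 0 c → G y = 0 := fun y hy => indicator_of_notMem hy _
  obtain ⟨N, hN⟩ := exists_nat_ge (c / d)
  rw [div_le_iff₀ hd] at hN
  calc _ = ∫⁻ y in Ico 0 c, G y := by
        exact setLIntegral_congr_fun measurableSet_Ico fun y hy => (hGm y hy).symm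
    _ ≤ ∫⁻ y in Ico 0 (N * d), G y := lintegral_mono_set (Ico_subset_Ico_right hN)
    _ = ∑ j ∈ Finset.range N, ∫⁻ y in Ico (j * d) ((j + 1) * d), G y :=
        (sum_setLIntegral_cells hd.le G N).symm
    _ = ∑ j ∈ Finset.range N, ∫⁻ r in Ico 0 d, G (r + j * d) := by
        refine Finset.sum_congr rfl fun j _ => ?_
        rw [← setLIntegral_shift]
        congr 3; ring
    _ = ∫⁻ r in Ico 0 d, ∑ j ∈ Finset.range N, G (r + j * d) :=
        (lintegral_finsetSum _ fun j _ => hG.comp (measurable_id.add_const _)).symm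
    _ ≤ ∫⁻ r in Ico 0 d, pVariation p f T ^ p := by
        refine setLIntegral_mono' measurableSet_Ico fun r hr => ?_
        -- The number of points `r + j d` below `c`.
        set n := ⌈(c - r) / d⌉₊ with hn
        have hmem : ∀ j : ℕ, r + j * d < c ↔ j < n := fun j => by
          rw [hn, Nat.lt_ceil, lt_div_iff₀ hd]
          constructor <;> intro h <;> linarith
        have hnn : ∀ j : ℕ, 0 ≤ r + j * d := fun j => add_nonneg hr.1 (by positivity)
        calc _ = ∑ j ∈ (Finset.range N).filter (· < n), G (r + j * d) := by
              refine (Finset.sum_filter_of_ne fun j _ hj => ?_).symm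
              by_contra hjn
              exact hj (hGn _ fun h => hjn ((hmem j).1 h.2))
          _ ≤ ∑ j ∈ Finset.range n, G (r + j * d) :=
              Finset.sum_le_sum_of_subset fun j hj =>
                Finset.mem_range.2 (Finset.mem_filter.1 hj).2
          _ = ∑ j ∈ Finset.range n, edist (f (σ (r + j * d))) (f (r + j * d)) ^ p :=
              Finset.sum_congr rfl fun j hj =>
                hGm _ ⟨hnn j, (hmem j).2 (Finset.mem_range.1 hj)⟩
          _ ≤ _ := by
              refine sum_edist_rpow_le_pVariation hp (a := fun j => r + j * d)
                (b := fun j => σ (r + j * d)) (fun j hj => ?_) (fun j hj => ?_)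
              · exact ⟨hnn j, h1 _ ⟨hnn j, (hmem j).2 hj⟩⟩
              · have hj' := (hmem (j + 1)).2 hj
                have := h2 (r + j * d) ⟨hnn j, (hmem j).2 (by omega)⟩
                push_cast at hj' ⊢
                rw [add_one_mul, ← add_assoc] at *
                exact this hj'
    _ = _ := by simp [mul_comm]

/-- Hölder from exponent `p` to exponent `1` on a set of length at most `T`, the source of the
factor `T ^ (1 - 1 / p)`. -/
lemma setLIntegral_edist_le (hf : Measurable f) (hp : 1 ≤ p) {σ : ℝ → ℝ}
    (hσ : Measurable σ) {c d : ℝ} (hd : 0 < d) (hc : c ≤ T)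
    (h1 : ∀ y ∈ Ico 0 c, y ≤ σ y ∧ σ y ≤ T) (h2 : ∀ y ∈ Ico 0 c, y + d < c → σ y ≤ y + d) :
    ∫⁻ y in Ico 0 c, edist (f (σ y)) (f y) ≤
      pVariation p f T * ENNReal.ofReal d ^ (1 / p) * ENNReal.ofReal T ^ (1 - 1 / p) := by
  have hp0 : 0 < p := zero_lt_one.trans_le hp
  have hm : Measurable fun y => edist (f (σ y)) (f y) := (hf.comp hσ).edist hf
  have h := eLpNorm'_le_eLpNorm'_mul_rpow_measure_univ (μ := volume.restrict (Ico 0 c))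
    zero_lt_one hp hm.aestronglyMeasurable
  have hp1 : 0 ≤ 1 - 1 / p := by
    rw [sub_nonneg, div_le_one hp0]; exact hp
  have hp1' : 0 ≤ 1 / p := by positivity
  simp only [eLpNorm', enorm_eq_self, ENNReal.rpow_one, div_one, Measure.restrict_apply_univ,
    Real.volume_Ico, sub_zero] at h
  refine h.trans ?_
  have h3 := setLIntegral_edist_rpow_le hf hp0 hσ hd h1 h2
  calc _ ≤ (pVariation p f T ^ p * ENNReal.ofReal d) ^ (1 / p) * ENNReal.ofReal T ^ (1 - 1 / p) := by
        gcongr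
    _ = _ := by
        rw [ENNReal.mul_rpow_of_nonneg _ _ hp1', ← ENNReal.rpow_mul, mul_one_div_cancel hp0.ne',
          ENNReal.rpow_one]

end PVariation

end Hawkes

namespace Hawkes

/-! ### The regularity constant of a kernel -/

section KernelReg

lemma ofReal_intervalIntegral_abs_le {c : ℝ} (hc : 0 ≤ c) (g : ℝ → ℝ) :
    ENNReal.ofReal (∫ y in (0 : ℝ)..c, |g y|) ≤ ∫⁻ y in Ico 0 c, ‖g y‖ₑ := by
  rw [intervalIntegral.integral_of_le hc, restrict_Ico_eq_restrict_Ioc]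
  refine (Real.ofReal_le_enorm _).trans ((enorm_integral_le_lintegral_enorm _).trans_eq ?_)
  simp

lemma ofReal_intervalIntegral_abs {c : ℝ} (hc : 0 ≤ c) {g : ℝ → ℝ} (hg : IntegrableOn g (Ico 0 c)) :
    ENNReal.ofReal (∫ y in (0 : ℝ)..c, |g y|) = ∫⁻ y in Ico 0 c, ‖g y‖ₑ := by
  rw [intervalIntegral.integral_of_le hc, ← restrict_Ico_eq_restrict_Ioc]
  exact ofReal_integral_norm_eq_lintegral_enorm hg

/-- The first point of the grid of mesh `Δ` after `y`. -/
noncomputable def nextGrid (Δ y : ℝ) : ℝ := ⌊y / Δ⌋ * Δ + Δ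

lemma measurable_nextGrid (Δ : ℝ) : Measurable (nextGrid Δ) := by
  unfold nextGrid
  have h : Measurable fun y : ℝ => ((⌊y / Δ⌋ : ℤ) : ℝ) :=
    (measurable_of_countable _).comp ((measurable_id.div_const Δ).floor)
  exact (h.mul_const _).add_const _

variable {h : ℝ → ℝ} {T Δ : ℝ} {M : ℕ}

lemma le_nextGrid (hΔ : 0 < Δ) (y : ℝ) : y ≤ nextGrid Δ y := by
  have := Int.lt_floor_add_one (y / Δ)
  rw [div_lt_iff₀ hΔ] at this
  unfold nextGrid; linarith

lemma nextGrid_le (hΔ : 0 < Δ) (y : ℝ) : nextGrid Δ y ≤ y + Δ := by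
  have := Int.floor_le (y / Δ)
  rw [le_div_iff₀ hΔ] at this
  unfold nextGrid; linarith

lemma nextGrid_eq (hΔ : 0 < Δ) {j : ℕ} {y : ℝ} (hy : y ∈ Ico ((j : ℝ) * Δ) ((j + 1 : ℝ) * Δ)) :
    nextGrid Δ y = (j + 1 : ℝ) * Δ := by
  have : ⌊y / Δ⌋ = (j : ℤ) := by
    rw [Int.floor_eq_iff]
    constructor
    · rw [le_div_iff₀ hΔ]; exact_mod_cast hy.1
    · rw [div_lt_iff₀ hΔ]; exact_mod_cast hy.2
  rw [nextGrid, this]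
  push_cast; ring

lemma gridDefect_eq (h : ℝ → ℝ) (T Δ : ℝ) :
    gridDefect h T Δ = ∫ y in (0 : ℝ)..(T - Δ), |h y - h (nextGrid Δ y)| := rfl

lemma gridDefect_nonneg (hΔT : Δ ≤ T) : 0 ≤ gridDefect h T Δ :=
  intervalIntegral.integral_nonneg (sub_nonneg.2 hΔT) fun _ _ => abs_nonneg _

lemma gridDefect_le_kernelReg (hΔ : 0 ≤ Δ) (hΔT : Δ ≤ T) : gridDefect h T Δ ≤ kernelReg h T Δ := by
  have h1 : 0 ≤ ∫ y in (0 : ℝ)..Δ, |h y| :=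
    intervalIntegral.integral_nonneg hΔ fun _ _ => abs_nonneg _
  have h2 : 0 ≤ sSup ((fun ε : ℝ => ∫ y in (0 : ℝ)..(T - Δ), |h (y + ε) - h y|) '' Icc 0 Δ) := by
    refine Real.sSup_nonneg ?_
    rintro _ ⟨ε, -, rfl⟩
    exact intervalIntegral.integral_nonneg (sub_nonneg.2 hΔT) fun _ _ => abs_nonneg _
  unfold kernelReg; linarith

lemma kernelReg_nonneg (hΔ : 0 ≤ Δ) (hΔT : Δ ≤ T) : 0 ≤ kernelReg h T Δ :=
  (gridDefect_nonneg hΔT).trans (gridDefect_le_kernelReg hΔ hΔT)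

lemma integrableOn_shift (hi : IntegrableOn h (Icc 0 T)) {ε : ℝ} (hε : ε ∈ Icc 0 Δ) :
    IntegrableOn (fun y => h (y + ε)) (Ico 0 (T - Δ)) := by
  have h1 : IntegrableOn (fun y => h (y + ε)) ((fun y => y + ε) ⁻¹' Icc 0 T) :=
    ((measurePreserving_add_right volume ε).integrableOn_comp_preimage
      (MeasurableEquiv.addRight ε).measurableEmbedding).2 hi
  refine h1.mono_set fun y hy => ?_
  exact ⟨by linarith [hy.1, hε.1], by linarith [hy.2, hε.2]⟩

/-- Writes a Riemann sum as an integral, so that it can be compared with the integral of the kernel.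
-/
lemma setLIntegral_nextGrid (hΔ : 0 < Δ) (F : ℝ → ℝ≥0∞) (n : ℕ) :
    ∫⁻ y in Ico 0 (n * Δ), F (nextGrid Δ y)
      = ∑ j ∈ Finset.range n, F ((j + 1 : ℝ) * Δ) * ENNReal.ofReal Δ := by
  rw [← sum_setLIntegral_cells hΔ.le]
  refine Finset.sum_congr rfl fun j _ => ?_
  rw [setLIntegral_congr_fun measurableSet_Ico (g := fun _ => F ((j + 1 : ℝ) * Δ))
    (fun y hy => by rw [nextGrid_eq hΔ hy]), setLIntegral_const, Real.volume_Ico]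
  congr 2; ring

lemma integrableOn_nextGrid (hh : Measurable h) (hΔ : 0 < Δ) (n : ℕ) :
    IntegrableOn (fun y => h (nextGrid Δ y)) (Ico 0 (n * Δ)) := by
  refine ⟨(hh.comp (measurable_nextGrid Δ)).aestronglyMeasurable, ?_⟩
  rw [hasFiniteIntegral_iff_enorm, setLIntegral_nextGrid hΔ (fun y => ‖h y‖ₑ)]
  exact ENNReal.sum_lt_top.2 fun j _ => by finiteness

lemma sub_eq_pred_mul (hT : T = M * Δ) (hM : 1 ≤ M) : T - Δ = (M - 1 : ℕ) * Δ := by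
  rw [hT, Nat.cast_sub hM]; push_cast; ring

/-- The form in which `C_R` is used. Here `ε` is the position of the current time in its cell, and
the first integral accounts for the current cell, which the discrete intensity ignores. The second
is split by inserting `h y`. -/
lemma lintegral_kernelReg_le (hh : Measurable h) (hi : IntegrableOn h (Icc 0 T)) (hΔ : 0 < Δ)
    (hM : 1 ≤ M) (hT : T = M * Δ) {ε : ℝ} (hε : ε ∈ Icc 0 Δ) :
    (∫⁻ y in Ico 0 Δ, ‖h y‖ₑ) + ∫⁻ y in Ico 0 (T - Δ), ‖h (y + ε) - h (nextGrid Δ y)‖ₑ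
      ≤ ENNReal.ofReal (kernelReg h T Δ) := by
  have hΔT : Δ ≤ T := by
    rw [hT]; exact le_mul_of_one_le_left hΔ.le (by exact_mod_cast hM)
  have hTΔ : 0 ≤ T - Δ := sub_nonneg.2 hΔT
  have hi0 : IntegrableOn h (Ico 0 (T - Δ)) :=
    hi.mono_set fun y hy => ⟨hy.1, by linarith [hy.2]⟩
  have hi1 : IntegrableOn h (Ico 0 Δ) := hi.mono_set fun y hy => ⟨hy.1, by linarith [hy.2]⟩
  have hi2 : IntegrableOn (fun y => h (nextGrid Δ y)) (Ico 0 (T - Δ)) := by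
    rw [sub_eq_pred_mul hT hM]; exact integrableOn_nextGrid hh hΔ _
  have hi3 := fun ε' (hε' : ε' ∈ Icc 0 Δ) => integrableOn_shift (T := T) hi hε'
  -- The supremum of an unbounded set of reals is `0` by convention, so boundedness is needed before
  -- comparing it with the term at `ε`.
  have hbdd : BddAbove ((fun ε : ℝ => ∫ y in (0 : ℝ)..(T - Δ), |h (y + ε) - h y|) '' Icc 0 Δ) := by
    refine ⟨(∫ y in (0 : ℝ)..T, |h y|) + ∫ y in (0 : ℝ)..T, |h y|, ?_⟩
    rintro _ ⟨ε', hε', rfl⟩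
    have hnn : 0 ≤ ∫ y in (0 : ℝ)..T, |h y| :=
      intervalIntegral.integral_nonneg (by linarith) fun _ _ => abs_nonneg _
    refine (ENNReal.ofReal_le_ofReal_iff (by positivity)).1 ?_
    rw [ENNReal.ofReal_add hnn hnn,
      ofReal_intervalIntegral_abs (g := fun y => h (y + ε') - h y) hTΔ ((hi3 ε' hε').sub hi0),
      ofReal_intervalIntegral_abs (g := h) (by linarith) (hi.mono_set Ico_subset_Icc_self)]
    calc _ ≤ ∫⁻ y in Ico 0 (T - Δ), (‖h (y + ε')‖ₑ + ‖h y‖ₑ) :=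
          lintegral_mono fun y => enorm_sub_le
      _ = (∫⁻ y in Ico 0 (T - Δ), ‖h (y + ε')‖ₑ) + ∫⁻ y in Ico 0 (T - Δ), ‖h y‖ₑ :=
          lintegral_add_right _ hh.enorm
      _ ≤ _ := by
          gcongr ?_ + ?_
          · have h1 := (measurePreserving_add_right volume ε').setLIntegral_comp_preimage_emb
              (MeasurableEquiv.addRight ε').measurableEmbedding (fun y => ‖h y‖ₑ) (Ico 0 T)
            rw [← h1]
            refine lintegral_mono_set fun y hy => ?_
            exact ⟨by linarith [hy.1, hε'.1], by linarith [hy.2, hε'.2]⟩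
          · exact lintegral_mono_set (Ico_subset_Ico_right (by linarith))
  have hsup : ∫ y in (0 : ℝ)..(T - Δ), |h (y + ε) - h y| ≤
      sSup ((fun ε : ℝ => ∫ y in (0 : ℝ)..(T - Δ), |h (y + ε) - h y|) '' Icc 0 Δ) :=
    le_csSup hbdd ⟨ε, hε, rfl⟩
  have hn1 : 0 ≤ ∫ y in (0 : ℝ)..Δ, |h y| :=
    intervalIntegral.integral_nonneg hΔ.le fun _ _ => abs_nonneg _
  have hn2 : 0 ≤ ∫ y in (0 : ℝ)..(T - Δ), |h (y + ε) - h y| :=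
    intervalIntegral.integral_nonneg hTΔ fun _ _ => abs_nonneg _
  calc _ ≤ (∫⁻ y in Ico 0 Δ, ‖h y‖ₑ) + ((∫⁻ y in Ico 0 (T - Δ), ‖h (y + ε) - h y‖ₑ)
        + ∫⁻ y in Ico 0 (T - Δ), ‖h y - h (nextGrid Δ y)‖ₑ) := by
        have hmd : Measurable fun y => ‖h y - h (nextGrid Δ y)‖ₑ :=
          (hh.sub (hh.comp (measurable_nextGrid Δ))).enorm
        rw [← lintegral_add_right _ hmd]
        gcongr with y
        rw [← sub_add_sub_cancel (h (y + ε)) (h y)]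
        exact enorm_add_le _ _
    _ = ENNReal.ofReal ((∫ y in (0 : ℝ)..Δ, |h y|) + ((∫ y in (0 : ℝ)..(T - Δ), |h (y + ε) - h y|)
          + gridDefect h T Δ)) := by
        rw [ENNReal.ofReal_add hn1 (add_nonneg hn2 (gridDefect_nonneg hΔT)),
          ENNReal.ofReal_add hn2 (gridDefect_nonneg hΔT), ofReal_intervalIntegral_abs hΔ.le hi1,
          ofReal_intervalIntegral_abs (g := fun y => h (y + ε) - h y) hTΔ ((hi3 ε hε).sub hi0),
          gridDefect_eq, ofReal_intervalIntegral_abs (g := fun y => h y - h (nextGrid Δ y)) hTΔ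
            (hi0.sub hi2)]
    _ ≤ _ := by
        refine ENNReal.ofReal_le_ofReal ?_
        unfold kernelReg; linarith

/-- The grid defect is the `L¹` distance between the kernel and its step version. The lags stop at
`(M - 1) Δ`, the largest distance between two cells. -/
lemma sum_abs_grid_le (hh : Measurable h) (hi : IntegrableOn h (Icc 0 T)) (hΔ : 0 < Δ)
    (hM : 1 ≤ M) (hT : T = M * Δ) :
    ∑ j ∈ Finset.range (M - 1), |h ((j + 1 : ℝ) * Δ)| * Δ
      ≤ (∫ y in (0 : ℝ)..T, |h y|) + gridDefect h T Δ := by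
  have hΔT : Δ ≤ T := by
    rw [hT]; exact le_mul_of_one_le_left hΔ.le (by exact_mod_cast hM)
  have hTΔ : 0 ≤ T - Δ := sub_nonneg.2 hΔT
  have hi0 : IntegrableOn h (Ico 0 (T - Δ)) :=
    hi.mono_set fun y hy => ⟨hy.1, by linarith [hy.2]⟩
  have hi2 : IntegrableOn (fun y => h (nextGrid Δ y)) (Ico 0 (T - Δ)) := by
    rw [sub_eq_pred_mul hT hM]; exact integrableOn_nextGrid hh hΔ _
  have hnn : 0 ≤ ∫ y in (0 : ℝ)..T, |h y| :=
    intervalIntegral.integral_nonneg (by linarith) fun _ _ => abs_nonneg _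
  refine (ENNReal.ofReal_le_ofReal_iff (add_nonneg hnn (gridDefect_nonneg hΔT))).1 ?_
  rw [ENNReal.ofReal_add hnn (gridDefect_nonneg hΔT),
    ENNReal.ofReal_sum_of_nonneg (fun j _ => by positivity),
    ofReal_intervalIntegral_abs (by linarith) (hi.mono_set Ico_subset_Icc_self),
    gridDefect_eq, ofReal_intervalIntegral_abs (g := fun y => h y - h (nextGrid Δ y)) hTΔ
            (hi0.sub hi2)]
  simp_rw [ENNReal.ofReal_mul (abs_nonneg _), ← Real.enorm_eq_ofReal_abs]
  rw [← setLIntegral_nextGrid hΔ (fun y => ‖h y‖ₑ), ← sub_eq_pred_mul hT hM]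
  calc _ ≤ ∫⁻ y in Ico 0 (T - Δ), (‖h y‖ₑ + ‖h y - h (nextGrid Δ y)‖ₑ) := by
        refine lintegral_mono fun y => ?_
        have : h (nextGrid Δ y) = h y - (h y - h (nextGrid Δ y)) := by ring
        calc ‖h (nextGrid Δ y)‖ₑ = ‖h y - (h y - h (nextGrid Δ y))‖ₑ := by rw [← this]
          _ ≤ _ := enorm_sub_le
    _ = (∫⁻ y in Ico 0 (T - Δ), ‖h y‖ₑ) + ∫⁻ y in Ico 0 (T - Δ), ‖h y - h (nextGrid Δ y)‖ₑ :=
        lintegral_add_left hh.enorm _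
    _ ≤ _ := by
        gcongr
        linarith

/-- Comparison of the kernel and its discretization along the past cells of a time in the `k`-th
cell. -/
lemma sum_lintegral_cells_le (hΔ : 0 < Δ) (hT : T = M * Δ) {k : ℕ} (hk : 1 ≤ k)
    (hkM : k ≤ M) (ε : ℝ) :
    ∑ j ∈ Finset.Ico 1 k, ∫⁻ u in Ioc (((j : ℝ) - 1) * Δ) (j * Δ),
        ‖h (((k : ℝ) - 1) * Δ + ε - u) - h (((k : ℝ) - j) * Δ)‖ₑ
      ≤ ∫⁻ v in Ico 0 (T - Δ), ‖h (v + ε) - h (nextGrid Δ v)‖ₑ := by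
  have hM : 1 ≤ M := hk.trans hkM
  calc _ = ∑ i ∈ Finset.range (k - 1), ∫⁻ v in Ico ((i : ℝ) * Δ) ((i + 1 : ℝ) * Δ),
        ‖h (v + ε) - h (nextGrid Δ v)‖ₑ := by
        -- The reflection `v = (k - 1) Δ - u` sends the cell `j` to the interval of lags number `k -
        -- 1 - j`, on which `nextGrid` equals `(k - j) Δ`.
        refine Finset.sum_nbij' (fun j => k - 1 - j) (fun i => k - 1 - i) ?_ ?_ ?_ ?_ ?_
        · intro j hj; have := Finset.mem_Ico.1 hj; exact Finset.mem_range.2 (by omega)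
        · intro j hj; have := Finset.mem_range.1 hj; exact Finset.mem_Ico.2 (by omega)
        · intro j hj; have := Finset.mem_Ico.1 hj; omega
        · intro j hj; have := Finset.mem_range.1 hj; omega
        · intro j hj
          have hj' := Finset.mem_Ico.1 hj
          have hc : ((k - 1 - j : ℕ) : ℝ) = (k : ℝ) - 1 - j := by
            rw [Nat.cast_sub (by omega), Nat.cast_sub hk]; simp
          rw [setLIntegral_reflect _ _ _ (((k : ℝ) - 1) * Δ), hc]
          have e1 : ((k : ℝ) - 1) * Δ - j * Δ = ((k : ℝ) - 1 - j) * Δ := by ring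
          have e2 : ((k : ℝ) - 1) * Δ - ((j : ℝ) - 1) * Δ = ((k : ℝ) - 1 - j + 1) * Δ := by ring
          rw [e1, e2]
          refine setLIntegral_congr_fun measurableSet_Ico fun v hv => ?_
          have hv' : v ∈ Ico (((k - 1 - j : ℕ) : ℝ) * Δ) ((((k - 1 - j : ℕ) : ℝ) + 1) * Δ) := by
            rw [hc]; exact hv
          rw [nextGrid_eq hΔ hv', hc]
          congr 3 <;> ring
    _ = ∫⁻ v in Ico 0 ((k - 1 : ℕ) * Δ), ‖h (v + ε) - h (nextGrid Δ v)‖ₑ :=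
        sum_setLIntegral_cells hΔ.le _ _
    _ ≤ _ := by
        refine lintegral_mono_set (Ico_subset_Ico_right ?_)
        rw [sub_eq_pred_mul hT hM]
        gcongr

/-! ### Kernels of finite `p`-variation -/

variable {p : ℝ}

lemma toReal_bound {V : ℝ≥0∞} (hV : V ≠ ∞) (hp : 1 ≤ p) (hΔ : 0 ≤ Δ) (hT : 0 ≤ T) {x : ℝ}
    (hx : ENNReal.ofReal x ≤ V * ENNReal.ofReal Δ ^ (1 / p) * ENNReal.ofReal T ^ (1 - 1 / p)) :
    x ≤ V.toReal * Δ ^ (1 / p) * T ^ (1 - 1 / p) := by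
  have hp0 : 0 < p := zero_lt_one.trans_le hp
  have hp1 : 0 ≤ 1 - 1 / p := by
    rw [sub_nonneg, div_le_one hp0]; exact hp
  have hp1' : 0 ≤ 1 / p := by positivity
  rw [ENNReal.ofReal_rpow_of_nonneg hΔ hp1', ENNReal.ofReal_rpow_of_nonneg hT hp1] at hx
  have hle := (ENNReal.ofReal_le_iff_le_toReal (by finiteness)).1 hx
  rwa [ENNReal.toReal_mul, ENNReal.toReal_mul, ENNReal.toReal_ofReal (by positivity),
    ENNReal.toReal_ofReal (by positivity)] at hle

lemma gridDefect_le_pVariation (hh : Measurable h) (hp : 1 ≤ p) (hV : pVariation p h T ≠ ∞)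
    (hΔ : 0 < Δ) (hΔT : Δ ≤ T) :
    gridDefect h T Δ ≤ (pVariation p h T).toReal * Δ ^ (1 / p) * T ^ (1 - 1 / p) := by
  refine toReal_bound hV hp hΔ.le (hΔ.le.trans hΔT) ?_
  rw [gridDefect_eq]
  refine (ofReal_intervalIntegral_abs_le (sub_nonneg.2 hΔT) _).trans ?_
  simp_rw [← edist_eq_enorm_sub, edist_comm (h _) (h (nextGrid Δ _))]
  refine setLIntegral_edist_le hh hp (measurable_nextGrid Δ) hΔ (by linarith) (fun y hy => ?_)
    (fun y _ _ => nextGrid_le hΔ y)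
  exact ⟨le_nextGrid hΔ y, (nextGrid_le hΔ y).trans (by linarith [hy.2])⟩

lemma integral_shift_le_pVariation (hh : Measurable h) (hp : 1 ≤ p) (hV : pVariation p h T ≠ ∞)
    (hΔ : 0 < Δ) (hΔT : Δ ≤ T) {ε : ℝ} (hε : ε ∈ Icc 0 Δ) :
    ∫ y in (0 : ℝ)..(T - Δ), |h (y + ε) - h y|
      ≤ (pVariation p h T).toReal * Δ ^ (1 / p) * T ^ (1 - 1 / p) := by
  have hT : 0 ≤ T := hΔ.le.trans hΔT
  -- The variation estimate is applied with mesh `ε`, which must be positive.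
  rcases hε.1.eq_or_lt with rfl | hε0
  · simp only [add_zero, sub_self, abs_zero, intervalIntegral.integral_zero]
    positivity
  have hle : ε ^ (1 / p) ≤ Δ ^ (1 / p) :=
    Real.rpow_le_rpow hε.1 hε.2 (by have := zero_lt_one.trans_le hp; positivity)
  refine le_trans (toReal_bound hV hp hε.1 hT ?_) (by gcongr)
  refine (ofReal_intervalIntegral_abs_le (sub_nonneg.2 hΔT) _).trans ?_
  simp_rw [← edist_eq_enorm_sub]
  refine setLIntegral_edist_le hh hp (measurable_id.add_const ε) hε0 (by linarith) (fun y hy => ?_)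
    (fun y _ _ => le_rfl)
  exact ⟨by simpa using hε.1, by simp only [id]; linarith [hy.2, hε.2]⟩

/-- Ensures that `⨆ t : Icc 0 T, |h t|` is a true supremum and not the default value `0`. -/
lemma bddAbove_range_abs_of_pVariation (hp : 1 ≤ p) (hV : pVariation p h T ≠ ∞) :
    BddAbove (range fun t : Icc 0 T => |h t|) := by
  refine ⟨|h 0| + (pVariation p h T).toReal, ?_⟩
  rintro _ ⟨⟨t, ht⟩, rfl⟩
  have h1 := edist_le_pVariation (f := h) (zero_lt_one.trans_le hp) le_rfl ht.1 ht.2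
  rw [edist_dist, ENNReal.ofReal_le_iff_le_toReal hV, Real.dist_eq] at h1
  have := abs_sub_abs_le_abs_sub (h t) (h 0)
  dsimp only
  linarith

/-- The first term of `C_R` is controlled by the supremum norm; the other two are increments over
lengths at most `Δ`, whence the factor `2`. -/
lemma kernelReg_le_pVariation (hh : Measurable h) (hp : 1 ≤ p) (hV : pVariation p h T ≠ ∞)
    (hΔ : 0 < Δ) (hΔT : Δ ≤ T) :
    kernelReg h T Δ ≤ Δ * (⨆ t : Icc 0 T, |h t|)
      + 2 * ((pVariation p h T).toReal * Δ ^ (1 / p) * T ^ (1 - 1 / p)) := by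
  have h1 : ∫ y in (0 : ℝ)..Δ, |h y| ≤ Δ * (⨆ t : Icc 0 T, |h t|) := by
    have := intervalIntegral.norm_integral_le_of_norm_le_const (a := 0) (b := Δ)
      (f := fun y => |h y|) (C := ⨆ t : Icc 0 T, |h t|) (fun y hy => ?_)
    · rw [sub_zero, abs_of_pos hΔ, mul_comm] at this
      exact (Real.le_norm_self _).trans this
    · rw [uIoc_of_le hΔ.le] at hy
      rw [Real.norm_eq_abs, abs_abs]
      exact le_ciSup (bddAbove_range_abs_of_pVariation hp hV)
        (⟨y, hy.1.le, hy.2.trans hΔT⟩ : Icc 0 T)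
  have h2 : sSup ((fun ε : ℝ => ∫ y in (0 : ℝ)..(T - Δ), |h (y + ε) - h y|) '' Icc 0 Δ)
      ≤ (pVariation p h T).toReal * Δ ^ (1 / p) * T ^ (1 - 1 / p) := by
    refine csSup_le ((nonempty_Icc.2 hΔ.le).image _) ?_
    rintro _ ⟨ε, hε, rfl⟩
    exact integral_shift_le_pVariation hh hp hV hΔ hΔT hε
  have h3 := gridDefect_le_pVariation hh hp hV hΔ hΔT
  unfold kernelReg
  linarith

lemma mul_kernelReg_le_pVariation (hh : Measurable h) (hp : 1 ≤ p) (hV : pVariation p h T ≠ ∞)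
    (hΔ : 0 < Δ) (hΔT : Δ ≤ T) :
    T * kernelReg h T Δ ≤ Δ * T * (⨆ t : Icc 0 T, |h t|)
      + 2 * ((pVariation p h T).toReal * T ^ ((2 * p - 1) / p) * Δ ^ (1 / p)) := by
  have hT : 0 < T := hΔ.trans_le hΔT
  have hp0 : 0 < p := zero_lt_one.trans_le hp
  have h1 := mul_le_mul_of_nonneg_left (kernelReg_le_pVariation hh hp hV hΔ hΔT) hT.le
  have h2 : T ^ ((2 * p - 1) / p) = T * T ^ (1 - 1 / p) := by
    rw [← Real.rpow_one_add' hT.le]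
    · congr 1; field_simp; ring
    · have : 0 ≤ 1 - 1 / p := by rw [sub_nonneg, div_le_one hp0]; exact hp
      positivity
  rw [h2]
  refine h1.trans_eq ?_
  ring

lemma tendsto_gridDefect (hh : Measurable h) (hT : 0 < T) (hp : 1 ≤ p)
    (hV : pVariation p h T ≠ ∞) : Tendsto (fun Δ => gridDefect h T Δ) (𝓝[>] 0) (𝓝 0) := by
  have hp0 : 0 < p := zero_lt_one.trans_le hp
  have hev : ∀ᶠ Δ in 𝓝[>] (0 : ℝ), 0 < Δ ∧ Δ ≤ T :=
    Filter.Eventually.and self_mem_nhdsWithin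
      (mem_nhdsWithin_of_mem_nhds (Iic_mem_nhds hT))
  have hlim : Tendsto (fun Δ : ℝ => (pVariation p h T).toReal * Δ ^ (1 / p) * T ^ (1 - 1 / p))
      (𝓝[>] 0) (𝓝 0) := by
    have h1 : Tendsto (fun Δ : ℝ => Δ ^ (1 / p)) (𝓝[>] 0) (𝓝 0) := by
      have := (Real.continuousAt_rpow_const 0 (1 / p) (Or.inr (by positivity))).tendsto
      rw [Real.zero_rpow (by positivity)] at this
      exact this.mono_left nhdsWithin_le_nhds
    simpa using (h1.const_mul (pVariation p h T).toReal).mul_const (T ^ (1 - 1 / p))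
  refine tendsto_of_tendsto_of_tendsto_of_le_of_le' tendsto_const_nhds hlim ?_ ?_
  · filter_upwards [hev] with Δ hΔ using gridDefect_nonneg hΔ.2
  · filter_upwards [hev] with Δ hΔ using gridDefect_le_pVariation hh hp hV hΔ.1 hΔ.2

end KernelReg

end Hawkes

namespace Hawkes

variable {Ω : Type*} [mΩ : MeasurableSpace Ω]

/-! ### Adaptedness of thinned integrals -/

section Adapted

variable {ν : Measure ℝ} [IsProbabilityMeasure ν] {μ : Measure Ω} {P : Kernel Ω MarkSpace}

/-- Makes the conventions at time `0` and at level `0` irrelevant. -/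
lemma ae_ae_pos (hP : IsPoissonRandomMeasure μ P (poissonIntensity ν)) :
    ∀ᵐ ω ∂μ, ∀ᵐ x ∂(P ω), 0 < x.1 ∧ 0 < x.2.1 := by
  have h1 : ∀ᵐ x ∂(poissonIntensity ν), 0 < x.1 ∧ 0 < x.2.1 := by
    have he : poissonIntensity ν = (volume.prod (volume.prod ν)).restrict
        (Ioi 0 ×ˢ (Ioi 0 ×ˢ univ)) := by
      rw [poissonIntensity, ← Measure.prod_restrict, ← Measure.prod_restrict, Measure.restrict_univ]
    rw [he]
    filter_upwards [ae_restrict_mem (measurableSet_Ioi.prod (measurableSet_Ioi.prod .univ))]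
      with x hx using ⟨hx.1, hx.2.1⟩
  rw [← bind_eq_intensity hP] at h1
  exact Measure.ae_ae_of_ae_bind P.measurable.aemeasurable h1

/-- Brings the integrals of the model to a common box of finite intensity. The level `l'` needs to
agree with `l` only at positive times of `I`, which leaves room for a bounded predictable version.
-/
lemma thinnedIntegral_eq {p : Measure MarkSpace} (hp : ∀ᵐ x ∂p, 0 < x.1 ∧ 0 < x.2.1) {T c : ℝ}
    {I : Set ℝ} (hI : MeasurableSet I) (hIT : I ⊆ Iic T) {l l' : ℝ → ℝ}
    (hl : ∀ s ∈ I, 0 < s → l s = l' s ∧ l' s ≤ c) (g : MarkSpace → ℝ) :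
    thinnedIntegral p I l g =
      ∫ x in box 0 T c, I.indicator 1 x.1 * g x * (Ioc 0 (l' x.1)).indicator 1 x.2.1 ∂p := by
  rw [thinnedIntegral, ← integral_indicator (hI.prod (measurableSet_Ici.prod .univ)),
    ← integral_indicator (measurableSet_box 0 T c)]
  refine integral_congr_ae ?_
  filter_upwards [hp] with x hx
  by_cases hxI : x.1 ∈ I
  · obtain ⟨h1, h2⟩ := hl _ hxI hx.1
    have h3 : x ∈ I ×ˢ (Ici (0 : ℝ) ×ˢ (univ : Set ℝ)) := ⟨hxI, hx.2.le, mem_univ _⟩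
    rw [indicator_of_mem h3]
    by_cases h4 : x.2.1 ≤ l x.1
    · have h5 : x ∈ box 0 T c := ⟨⟨hx.1, hIT hxI⟩, ⟨hx.2, by linarith⟩, mem_univ _⟩
      rw [indicator_of_mem (show x ∈ {x : MarkSpace | x.2.1 ≤ l x.1} from h4),
        indicator_of_mem h5, indicator_of_mem hxI,
        indicator_of_mem (show x.2.1 ∈ Ioc 0 (l' x.1) from ⟨hx.2, h1 ▸ h4⟩)]
      simp
    · rw [indicator_of_notMem (show x ∉ {x : MarkSpace | x.2.1 ≤ l x.1} from h4)]
      have h6 : x.2.1 ∉ Ioc 0 (l' x.1) := fun h => h4 (h1 ▸ h.2)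
      have h7 : I.indicator (1 : ℝ → ℝ) x.1 * g x * (Ioc 0 (l' x.1)).indicator 1 x.2.1 = 0 := by
        rw [indicator_of_notMem h6, mul_zero]
      by_cases h5 : x ∈ box 0 T c
      · rw [indicator_of_mem h5, h7]
      · rw [indicator_of_notMem h5]
  · have h3 : x ∉ I ×ˢ (Ici (0 : ℝ) ×ˢ (univ : Set ℝ)) := fun h => hxI h.1
    rw [indicator_of_notMem h3]
    have h7 : I.indicator (1 : ℝ → ℝ) x.1 * g x * (Ioc 0 (l' x.1)).indicator 1 x.2.1 = 0 := by
      rw [indicator_of_notMem hxI, zero_mul, zero_mul]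
    by_cases h5 : x ∈ box 0 T c
    · rw [indicator_of_mem h5, h7]
    · rw [indicator_of_notMem h5]

lemma measurable_thinned {X : Type*} [MeasurableSpace X] {φ : MarkSpace → ℝ≥0∞} (hφ : Measurable φ)
    {l : X × ℝ → ℝ} (hl : Measurable l) : Measurable fun p : X × MarkSpace =>
      φ p.2 * (Ioc 0 (l (p.1, p.2.1))).indicator 1 p.2.2.1 := by
  refine (hφ.comp measurable_snd).mul ?_
  have h1 : Measurable fun p : X × MarkSpace => p.2.2.1 := by fun_prop
  have h2 : Measurable fun p : X × MarkSpace => l (p.1, p.2.1) := hl.comp (by fun_prop)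
  have hs : MeasurableSet {p : X × MarkSpace | 0 < p.2.2.1 ∧ p.2.2.1 ≤ l (p.1, p.2.1)} :=
    (measurableSet_lt measurable_const h1).inter (measurableSet_le h1 h2)
  exact (measurable_const (a := (1 : ℝ≥0∞))).indicator hs

lemma measurable_restrict_box (P : Kernel Ω MarkSpace) (r : ℝ≥0) (c : ℝ) :
    Measurable[randomMeasureFiltration P r] fun ω => (P ω).restrict (box 0 r c) := by
  refine @Measure.measurable_of_measurable_coe _ _ _ (randomMeasureFiltration P r) _ fun A hA => ?_
  have h1 : ∀ ω, (P ω).restrict (box 0 r c) A = P ω (A ∩ box 0 r c) := fun ω =>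
    Measure.restrict_apply hA
  simp_rw [h1]
  have h2 : MeasurableSpace.comap (fun ω => P ω (A ∩ box 0 r c)) inferInstance
      ≤ randomMeasureFiltration P r :=
    le_iSup₂_of_le (A ∩ box 0 r c) ⟨hA.inter (measurableSet_box _ _ _), fun x hx =>
      ⟨hx.2.1, mem_univ _⟩⟩ le_rfl
  exact (comap_measurable _).mono h2 le_rfl

lemma exists_adapted_lintegral (hP : IsPoissonRandomMeasure μ P (poissonIntensity ν)) (r : ℝ≥0)
    (c : ℝ) {φ : MarkSpace → ℝ≥0∞} (hφ : Measurable φ) {l : Ω × ℝ → ℝ}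
    (hl : Measurable[(randomMeasureFiltration P r).prod inferInstance] l) :
    ∃ g : Ω → ℝ≥0∞, Measurable[randomMeasureFiltration P r] g ∧ g =ᵐ[μ] fun ω =>
      ∫⁻ x in box 0 r c, φ x * (Ioc 0 (l (ω, x.1))).indicator 1 x.2.1 ∂P ω := by
  refine exists_measurable_ae_eq_lintegral (m := randomMeasureFiltration P r)
    (measurable_restrict_box P r c) ?_
    (@measurable_thinned _ (randomMeasureFiltration P r) _ hφ _ hl)
  filter_upwards [ae_count_box_lt_top hP le_rfl r c] with ω hω
  rwa [Measure.restrict_apply_univ]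

/-- Stopping at `r` makes the process depend on the past of `r` alone, without changing it on `[0,
r]`. -/
lemma measurable_stopped {f : ℝ≥0 × Ω → ℝ}
    (hf : Measurable[(randomMeasureFiltration P).predictable] f) (r : ℝ≥0) :
    Measurable[(randomMeasureFiltration P r).prod inferInstance]
      fun p : Ω × ℝ => f (min p.2.toNNReal r, p.1) := by
  have h0 := hf.comp (measurable_inclusion_predictable (𝓕 := randomMeasureFiltration P) (i := r))
  let m1 : MeasurableSpace Ω := randomMeasureFiltration P r
  have h1 : @Measurable (Ω × ℝ) (Set.Iic r × Ω) (m1.prod inferInstance)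
      (Subtype.instMeasurableSpace.prod m1)
      fun p => (⟨min p.2.toNNReal r, mem_Iic.2 (min_le_right _ _)⟩, p.1) := by
    refine Measurable.prodMk ?_ measurable_fst
    exact Measurable.subtype_mk (measurable_snd.real_toNNReal.min measurable_const)
  exact h0.comp h1

lemma discreteIntensity_eq (p : Measure MarkSpace) (h ψ b : ℝ → ℝ) (Δ : ℝ) (n : ℕ) :
    discreteIntensity p h ψ b Δ n = ψ (∑ k ∈ Finset.Ico 1 n, h (((n : ℝ) - k) * Δ) *
      thinnedIntegral p (Ioc (((k : ℝ) - 1) * Δ) (k * Δ))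
        (fun _ => discreteIntensity p h ψ b Δ k) (fun x => b x.2.2)) := by
  conv_lhs => rw [discreteIntensity]
  congr 1
  exact Finset.sum_attach (Finset.Ico 1 n) fun k => h (((n : ℝ) - k) * Δ) *
      thinnedIntegral p (Ioc (((k : ℝ) - 1) * Δ) (k * Δ))
        (fun _ => discreteIntensity p h ψ b Δ k) (fun x => b x.2.2)

lemma integral_thinned_eq_toReal {p : Measure MarkSpace} {b : ℝ → ℝ} (hb : Measurable b)
    (hb0 : ∀ y, 0 ≤ b y) {I : Set ℝ} (hI : MeasurableSet I) {l : ℝ → ℝ} (hl : Measurable l)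
    (D : Set MarkSpace) :
    ∫ x in D, I.indicator 1 x.1 * b x.2.2 * (Ioc 0 (l x.1)).indicator 1 x.2.1 ∂p
      = (∫⁻ x in D, I.indicator 1 x.1 * ENNReal.ofReal (b x.2.2)
          * (Ioc 0 (l x.1)).indicator 1 x.2.1 ∂p).toReal := by
  have hI' : Measurable fun x : MarkSpace => I.indicator (1 : ℝ → ℝ) x.1 :=
    (measurable_one.indicator hI).comp measurable_fst
  have hm : Measurable fun x : MarkSpace => x.2.1 := by fun_prop
  have hs : MeasurableSet {x : MarkSpace | 0 < x.2.1 ∧ x.2.1 ≤ l x.1} :=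
    (measurableSet_lt measurable_const hm).inter (measurableSet_le hm (hl.comp measurable_fst))
  have hth : Measurable fun x : MarkSpace => (Ioc 0 (l x.1)).indicator (1 : ℝ → ℝ) x.2.1 :=
    (measurable_const (a := (1 : ℝ))).indicator hs
  rw [integral_eq_lintegral_of_nonneg_ae]
  · congr 1
    refine lintegral_congr fun x => ?_
    by_cases h1 : x.1 ∈ I <;> by_cases h2 : x.2.1 ∈ Ioc 0 (l x.1) <;> simp [h1, h2]
  · refine Eventually.of_forall fun x => ?_
    refine mul_nonneg (mul_nonneg ?_ (hb0 _)) ?_ <;> exact indicator_nonneg (by simp) _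
  · exact ((hI'.mul (hb.comp (by fun_prop))).mul hth).aestronglyMeasurable

/-- By strong induction: `l k` only involves the earlier intensities and the points of the cells
before the `k`-th, hence the time `(k - 1) Δ`. The version is almost sure, as integrals against `P`
are adapted only up to null sets. -/
lemma exists_adapted_discreteIntensity (hP : IsPoissonRandomMeasure μ P (poissonIntensity ν))
    {h ψ b : ℝ → ℝ} (hb : Measurable b) (hb0 : ∀ y, 0 ≤ b y) (hψ : Measurable ψ) {c : ℝ}
    (hψc : ∀ x, ψ x ≤ c) {Δ : ℝ} (hΔ : 0 < Δ) (k : ℕ) :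
    1 ≤ k → ∃ g : Ω → ℝ, Measurable[randomMeasureFiltration P (((k : ℝ) - 1) * Δ).toNNReal] g ∧
      ∀ᵐ ω ∂μ, g ω = discreteIntensity (P ω) h ψ b Δ k := by
  induction k using Nat.strong_induction_on with
  | _ k ih =>
    intro hk
    set r : ℝ≥0 := (((k : ℝ) - 1) * Δ).toNNReal with hr
    have hk' : (1 : ℝ) ≤ k := by exact_mod_cast hk
    have hrr : (r : ℝ) = ((k : ℝ) - 1) * Δ := Real.coe_toNNReal _ (by nlinarith)
    have hY : ∀ j, ∃ Y : Ω → ℝ, Measurable[randomMeasureFiltration P r] Y ∧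
        (j ∈ Finset.Ico 1 k → ∀ᵐ ω ∂μ, Y ω = thinnedIntegral (P ω)
          (Ioc (((j : ℝ) - 1) * Δ) (j * Δ)) (fun _ => discreteIntensity (P ω) h ψ b Δ j)
            (fun x => b x.2.2)) := by
      intro j
      by_cases hj : j ∈ Finset.Ico 1 k
      swap
      · exact ⟨fun _ => 0, @measurable_const _ _ _ (randomMeasureFiltration P r) 0,
          fun h => absurd h hj⟩
      have hj' := Finset.mem_Ico.1 hj
      obtain ⟨g, hg, hgeq⟩ := ih j hj'.2 hj'.1
      have hjk : (j : ℝ) + 1 ≤ k := by exact_mod_cast hj'.2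
      have hg' : Measurable[randomMeasureFiltration P r] g := hg.mono
        ((randomMeasureFiltration P).mono (Real.toNNReal_le_toNNReal (by nlinarith))) le_rfl
      have hφ : Measurable fun x : MarkSpace => (Ioc (((j : ℝ) - 1) * Δ) (j * Δ)).indicator 1 x.1
          * ENNReal.ofReal (b x.2.2) :=
        ((measurable_const (a := (1 : ℝ≥0∞))).indicator (measurable_fst measurableSet_Ioc)).mul
          (hb.comp (measurable_snd.comp measurable_snd)).ennreal_ofReal
      obtain ⟨Y, hYm, hYeq⟩ := exists_adapted_lintegral hP r c hφ
        (l := fun p => g p.1) (hg'.comp (@measurable_fst _ _ (randomMeasureFiltration P r) _))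
      refine ⟨fun ω => (Y ω).toReal, hYm.ennreal_toReal, fun _ => ?_⟩
      filter_upwards [hgeq, hYeq, ae_ae_pos hP] with ω h1 h2 h3
      have h4 : discreteIntensity (P ω) h ψ b Δ j ≤ c := by
        rw [discreteIntensity_eq]; exact hψc _
      rw [h2, thinnedIntegral_eq h3 (T := (r : ℝ)) (c := c) measurableSet_Ioc ?_
        (l' := fun _ => g ω) (fun s _ _ => ⟨h1.symm, h1 ▸ h4⟩),
        integral_thinned_eq_toReal hb hb0 measurableSet_Ioc measurable_const]
      intro s hs
      rw [mem_Iic, hrr]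
      refine hs.2.trans ?_
      exact mul_le_mul_of_nonneg_right (by linarith) hΔ.le
    choose Y hYm hYeq using hY
    refine ⟨fun ω => ψ (∑ j ∈ Finset.Ico 1 k, h (((k : ℝ) - j) * Δ) * Y j ω), ?_, ?_⟩
    · refine hψ.comp ?_
      exact Finset.measurable_fun_sum _ fun j _ => (hYm j).const_mul _
    · have hall : ∀ᵐ ω ∂μ, ∀ j ∈ Finset.Ico 1 k, Y j ω = thinnedIntegral (P ω)
          (Ioc (((j : ℝ) - 1) * Δ) (j * Δ)) (fun _ => discreteIntensity (P ω) h ψ b Δ j)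
            (fun x => b x.2.2) :=
        (Finset.eventually_all _).2 fun j hj => hYeq j hj
      filter_upwards [hall] with ω hω
      rw [discreteIntensity_eq]
      congr 1
      exact Finset.sum_congr rfl fun j hj => by rw [hω j hj]

end Adapted

end Hawkes

namespace Hawkes

variable {Ω : Type*} [mΩ : MeasurableSpace Ω]

/-! ### Predictable versions of the two intensities -/

section Coupled

/-- The `k`-th cell of the grid of mesh `Δ`. -/
abbrev cell (Δ : ℝ) (k : ℕ) : Set ℝ := Ioc (((k : ℝ) - 1) * Δ) (k * Δ)

/-- `lc` and `lb` are predictable versions, with values in `[0, c]`, of the intensity of a Hawkes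
risk and of the step process given by the discrete-time intensities. -/
structure Coupled (μ : Measure Ω) (P : Kernel Ω MarkSpace) (c T Δ : ℝ) (M : ℕ) (h ψ b : ℝ → ℝ)
    (R : ℝ → Ω → ℝ) (lc lb : ℝ≥0 × Ω → ℝ) : Prop where
  measurable_lc : Measurable[(randomMeasureFiltration P).predictable] lc
  measurable_lb : Measurable[(randomMeasureFiltration P).predictable] lb
  lc_mem : ∀ p, lc p ∈ Icc 0 c
  lb_mem : ∀ p, lb p ∈ Icc 0 c
  lc_eq : ∀ᵐ ω ∂μ, ∀ t ∈ Icc 0 T, lc (t.toNNReal, ω) =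
    ψ (∫ x in box 0 T c, (Ico 0 t).indicator 1 x.1 * (h (t - x.1) * b x.2.2) *
      (Ioc 0 (lc (x.1.toNNReal, ω))).indicator 1 x.2.1 ∂P ω)
  lb_eq : ∀ᵐ ω ∂μ, ∀ k ∈ Finset.Icc 1 M, ∀ s ∈ cell Δ k, lb (s.toNNReal, ω) =
    ψ (∑ j ∈ Finset.Ico 1 k, h (((k : ℝ) - j) * Δ) *
      ∫ x in box 0 T c, (cell Δ j).indicator 1 x.1 * b x.2.2 *
        (Ioc 0 (lb (x.1.toNNReal, ω))).indicator 1 x.2.1 ∂P ω)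
  risk_eq : ∀ᵐ ω ∂μ, ∀ t ∈ Icc 0 T, R t ω =
    ∫ x in box 0 T c, (Ioc 0 t).indicator 1 x.1 * x.2.2 *
      (Ioc 0 (lc (x.1.toNNReal, ω))).indicator 1 x.2.1 ∂P ω
  discreteRisk_eq : ∀ᵐ ω ∂μ, ∀ n ≤ M, ∀ t ∈ Ico ((n : ℝ) * Δ) ((n + 1 : ℝ) * Δ),
    discreteRisk (P ω) h ψ b Δ t =
      ∑ k ∈ Finset.Icc 1 n, ∫ x in box 0 T c, (cell Δ k).indicator 1 x.1 * x.2.2 *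
        (Ioc 0 (lb (x.1.toNNReal, ω))).indicator 1 x.2.1 ∂P ω

lemma measurable_predictable_fst (𝓕 : Filtration ℝ≥0 mΩ) :
    Measurable[𝓕.predictable] (Prod.fst : ℝ≥0 × Ω → ℝ≥0) := by
  refine @measurable_of_Ioi _ _ _ _ _ 𝓕.predictable _ _ _ _ fun i => ?_
  have : (Prod.fst : ℝ≥0 × Ω → ℝ≥0) ⁻¹' Ioi i = Ioi i ×ˢ univ := by ext; simp
  rw [this]
  exact measurableSet_predictable_Ioi_prod MeasurableSet.univ

lemma measurable_predictable_step (𝓕 : Filtration ℝ≥0 mΩ) (r v : ℝ≥0) {g : Ω → ℝ}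
    (hg : Measurable[𝓕 r] g) :
    Measurable[𝓕.predictable] fun p : ℝ≥0 × Ω => (Ioc r v).indicator (fun _ => g p.2) p.1 := by
  intro B hB
  have h1 : MeasurableSet[𝓕.predictable] (Ioc r v ×ˢ (g ⁻¹' B)) :=
    measurableSet_predictable_Ioc_prod r v (hg hB)
  by_cases h0 : (0 : ℝ) ∈ B
  · have : (fun p : ℝ≥0 × Ω => (Ioc r v).indicator (fun _ => g p.2) p.1) ⁻¹' B
        = Ioc r v ×ˢ (g ⁻¹' B) ∪ (Ioc r v ×ˢ univ)ᶜ := by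
      ext p
      by_cases hp : p.1 ∈ Ioc r v <;> simp [hp, h0]
    rw [this]
    exact h1.union (measurableSet_predictable_Ioc_prod r v MeasurableSet.univ).compl
  · have : (fun p : ℝ≥0 × Ω => (Ioc r v).indicator (fun _ => g p.2) p.1) ⁻¹' B
        = Ioc r v ×ˢ (g ⁻¹' B) := by
      ext p
      by_cases hp : p.1 ∈ Ioc r v <;> simp [hp, h0]
    rw [this]
    exact h1

lemma disjoint_cell {Δ : ℝ} (hΔ : 0 < Δ) {j k : ℕ} (hjk : j ≠ k) :
    Disjoint (cell Δ j) (cell Δ k) := by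
  wlog hlt : j < k generalizing j k
  · exact (this hjk.symm (by omega)).symm
  refine Set.disjoint_left.2 fun s hs hs' => ?_
  have : (j : ℝ) + 1 ≤ k := by exact_mod_cast hlt
  have h1 := hs.2
  have h2 := hs'.1
  nlinarith

variable {ν : Measure ℝ} [IsProbabilityMeasure ν] {μ : Measure Ω} {P : Kernel Ω MarkSpace}

/-- Clamping to `[0, c]` is harmless since both intensities are values of `ψ`. The discrete step
process is predictable because its value on a cell is known at the left end of the cell. -/
theorem exists_coupled (hP : IsPoissonRandomMeasure μ P (poissonIntensity ν))
    {h ψ b : ℝ → ℝ} (hb : Measurable b) (hb0 : ∀ y, 0 ≤ b y) (hψ : Measurable ψ) {c : ℝ}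
    (hψ0 : ∀ x, 0 ≤ ψ x) (hψc : ∀ x, ψ x ≤ c) {T Δ : ℝ} (hΔ : 0 < Δ) {M : ℕ} (hT : T = M * Δ)
    {lam : ℝ≥0 → Ω → ℝ} {R : ℝ → Ω → ℝ} (hR : IsHawkesRisk μ P T h ψ b lam R) :
    ∃ lc lb : ℝ≥0 × Ω → ℝ, Coupled μ P c T Δ M h ψ b R lc lb := by
  have hc : 0 ≤ c := (hψ0 0).trans (hψc 0)
  have hclamp : ∀ x : ℝ, max 0 (min x c) ∈ Icc 0 c := fun x =>
    ⟨le_max_left _ _, max_le hc (min_le_right _ _)⟩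
  have hclamp_eq : ∀ x ∈ Icc 0 c, max 0 (min x c) = x := fun x hx => by
    rw [min_eq_left hx.2, max_eq_right hx.1]
  -- `g k` is a version of the intensity of cell `k + 1`, the cells being numbered from `1`.
  choose g hgm hgeq using fun k : ℕ =>
    exists_adapted_discreteIntensity (h := h) hP hb hb0 hψ hψc hΔ (k + 1) (by omega)
  let lc : ℝ≥0 × Ω → ℝ := fun p => max 0 (min (lam p.1 p.2) c)
  let lb0 : ℝ≥0 × Ω → ℝ := fun p => ∑ k ∈ Finset.range M,
    (Ioc ((((k + 1 : ℕ) : ℝ) - 1) * Δ).toNNReal (((k + 1 : ℕ) : ℝ) * Δ).toNNReal).indicator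
      (fun _ => g k p.2) p.1
  let lb : ℝ≥0 × Ω → ℝ := fun p => max 0 (min (lb0 p) c)
  have hclampm : Measurable fun x : ℝ => max 0 (min x c) := by fun_prop
  have hlc_mem : ∀ p, lc p ∈ Icc 0 c := fun p => hclamp _
  have hlb_mem : ∀ p, lb p ∈ Icc 0 c := fun p => hclamp _
  have hlcm : Measurable[(randomMeasureFiltration P).predictable] lc :=
    hclampm.comp hR.predictable.measurable
  have hlb0m : Measurable[(randomMeasureFiltration P).predictable] lb0 := by
    refine Finset.measurable_fun_sum _ fun k _ => ?_
    exact measurable_predictable_step _ _ _ (hgm k)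
  have hlbm : Measurable[(randomMeasureFiltration P).predictable] lb := hclampm.comp hlb0m
  have hlam : ∀ᵐ ω ∂μ, ∀ t ∈ Icc 0 T, lc (t.toNNReal, ω) = lam t.toNNReal ω := by
    filter_upwards [hR.intensity_eq] with ω hω t ht
    refine hclamp_eq _ ?_
    rw [hω _ (by rw [Real.coe_toNNReal _ ht.1]; exact ht.2)]
    exact ⟨hψ0 _, hψc _⟩
  have hlb : ∀ᵐ ω ∂μ, ∀ k, 1 ≤ k → k ≤ M → ∀ s ∈ cell Δ k,
      lb (s.toNNReal, ω) = discreteIntensity (P ω) h ψ b Δ k := by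
    filter_upwards [ae_all_iff.2 hgeq] with ω hω k hk hkM s hs
    obtain ⟨n, rfl⟩ : ∃ n, k = n + 1 := ⟨k - 1, by omega⟩
    have hmem : ∀ j : ℕ, s.toNNReal ∈ Ioc ((((j + 1 : ℕ) : ℝ) - 1) * Δ).toNNReal
        (((j + 1 : ℕ) : ℝ) * Δ).toNNReal ↔ s ∈ cell Δ (j + 1) := fun j => by
      have hj : 0 ≤ (((j + 1 : ℕ) : ℝ) - 1) * Δ := by
        push_cast
        have : (0 : ℝ) ≤ j := Nat.cast_nonneg j
        simp only [add_sub_cancel_right]; positivity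
      have h1 : (0 : ℝ) ≤ ((n + 1 : ℕ) - 1 : ℝ) * Δ := by
        push_cast
        simp only [add_sub_cancel_right]; positivity
      have hs0 : 0 < s := h1.trans_lt hs.1
      rw [mem_Ioc, mem_Ioc, Real.toNNReal_lt_toNNReal_iff hs0,
        Real.toNNReal_le_toNNReal_iff (by positivity)]
    have hval : lb0 (s.toNNReal, ω) = discreteIntensity (P ω) h ψ b Δ (n + 1) := by
      change ∑ j ∈ Finset.range M, _ = _
      rw [Finset.sum_eq_single n]
      · rw [indicator_of_mem ((hmem n).2 hs), hω n]
      · intro j _ hjn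
        refine indicator_of_notMem (fun hj => ?_) _
        exact Set.disjoint_left.1 (disjoint_cell hΔ (by omega : j + 1 ≠ n + 1)) ((hmem j).1 hj) hs
      · intro hn
        exact absurd (Finset.mem_range.2 (by omega)) hn
    change max 0 (min (lb0 (s.toNNReal, ω)) c) = _
    rw [hval]
    refine hclamp_eq _ ?_
    rw [discreteIntensity_eq]
    exact ⟨hψ0 _, hψc _⟩
  have hcellT : ∀ k ≤ M, cell Δ k ⊆ Iic T := fun k hk s hs => by
    refine hs.2.trans ?_
    rw [hT]
    exact mul_le_mul_of_nonneg_right (by exact_mod_cast hk) hΔ.le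
  refine ⟨lc, lb, hlcm, hlbm, hlc_mem, hlb_mem, ?_, ?_, ?_, ?_⟩
  · filter_upwards [hR.intensity_eq, hlam, ae_ae_pos hP] with ω h1 h2 h3 t ht
    rw [h2 t ht, h1 _ (by rw [Real.coe_toNNReal _ ht.1]; exact ht.2), Real.coe_toNNReal _ ht.1]
    congr 1
    refine thinnedIntegral_eq h3 measurableSet_Ico (fun s hs => hs.2.le.trans ht.2)
      (l' := fun s => lc (s.toNNReal, ω)) (fun s hs _ => ?_) _
    exact ⟨(h2 s ⟨hs.1, hs.2.le.trans ht.2⟩).symm, (hlc_mem _).2⟩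
  · filter_upwards [hlb, ae_ae_pos hP] with ω h1 h3 k hk s hs
    have hk' := Finset.mem_Icc.1 hk
    rw [h1 k hk'.1 hk'.2 s hs, discreteIntensity_eq]
    congr 1
    refine Finset.sum_congr rfl fun j hj => ?_
    have hj' := Finset.mem_Ico.1 hj
    congr 1
    refine thinnedIntegral_eq h3 measurableSet_Ioc (hcellT j (by omega))
      (l' := fun s => lb (s.toNNReal, ω)) (fun u hu _ => ?_) _
    exact ⟨(h1 j hj'.1 (by omega) u hu).symm, (hlb_mem _).2⟩
  · filter_upwards [hR.risk_eq, hlam, ae_ae_pos hP] with ω h1 h2 h3 t ht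
    rw [h1 t ht]
    refine thinnedIntegral_eq h3 measurableSet_Ioc (fun s hs => hs.2.trans ht.2)
      (l' := fun s => lc (s.toNNReal, ω)) (fun s hs _ => ?_) _
    exact ⟨(h2 s ⟨hs.1.le, hs.2.trans ht.2⟩).symm, (hlc_mem _).2⟩
  · filter_upwards [hlb, ae_ae_pos hP] with ω h1 h3 n hn t ht
    have hfl : ⌊t / Δ⌋₊ = n := by
      rw [Nat.floor_eq_iff (div_nonneg ((by positivity : 0 ≤ (n : ℝ) * Δ).trans ht.1) hΔ.le)]
      exact ⟨(le_div_iff₀ hΔ).2 ht.1, (div_lt_iff₀ hΔ).2 ht.2⟩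
    rw [discreteRisk, hfl]
    refine Finset.sum_congr rfl fun k hk => ?_
    have hk' := Finset.mem_Icc.1 hk
    refine thinnedIntegral_eq h3 measurableSet_Ioc (hcellT k (by omega))
      (l' := fun s => lb (s.toNNReal, ω)) (fun u hu _ => ?_) _
    exact ⟨(h1 k hk'.1 (by omega) u hu).symm, (hlb_mem _).2⟩

end Coupled

end Hawkes

namespace Hawkes

variable {Ω : Type*} [mΩ : MeasurableSpace Ω]

/-! ### Expected intensities -/

/-- Absorption requires `x` finite. In the applications finiteness comes from the bound `c` on the
intensities, which then leaves no trace in the estimate. -/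
lemma le_of_le_add_mul {x B : ℝ≥0∞} {ρ : ℝ} (hx : x ≠ ∞) (hρ0 : 0 ≤ ρ) (hρ : ρ < 1)
    (h : x ≤ B + ENNReal.ofReal ρ * x) : x ≤ ENNReal.ofReal (1 - ρ)⁻¹ * B := by
  have h1 : 0 < 1 - ρ := sub_pos.2 hρ
  have h2 : ENNReal.ofReal (1 - ρ) * x ≤ B := by
    have h3 : ENNReal.ofReal (1 - ρ) * x + ENNReal.ofReal ρ * x = x := by
      rw [← add_mul, ← ENNReal.ofReal_add h1.le hρ0]; simp
    refine ENNReal.le_of_add_le_add_right (a := ENNReal.ofReal ρ * x) (by finiteness) ?_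
    rw [h3]; exact h
  calc x = ENNReal.ofReal (1 - ρ)⁻¹ * (ENNReal.ofReal (1 - ρ) * x) := by
        rw [← mul_assoc, ← ENNReal.ofReal_mul (by positivity), inv_mul_cancel₀ h1.ne']; simp
    _ ≤ _ := by gcongr

section Estimates

variable {ν : Measure ℝ} [IsProbabilityMeasure ν] {μ : Measure Ω} {P : Kernel Ω MarkSpace}

lemma aemeasurable_lintegral_box (hP : IsPoissonRandomMeasure μ P (poissonIntensity ν)) (T c : ℝ)
    {F : Ω × MarkSpace → ℝ≥0∞} (hF : Measurable F) :
    AEMeasurable (fun ω => ∫⁻ x in box 0 T c, F (ω, x) ∂P ω) μ := by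
  obtain ⟨g, hg, hgeq⟩ := exists_measurable_ae_eq_lintegral (m := mΩ) (m0 := mΩ) (μ := μ)
    (κ := fun ω => (P ω).restrict (box 0 T c))
    (P.restrict (measurableSet_box 0 T c)).measurable (by
      filter_upwards [ae_count_box_lt_top hP le_rfl T c] with ω hω
      rwa [Measure.restrict_apply_univ]) hF
  exact ⟨g, hg, hgeq.symm⟩

variable [IsProbabilityMeasure μ]

theorem lintegral_thinning_le_of_time (hP : IsPoissonRandomMeasure μ P (poissonIntensity ν))
    (T c : ℝ) {φ : ℝ → ℝ≥0∞} (hφ : Measurable φ) {w : ℝ → ℝ≥0∞} (hw : Measurable w)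
    {α β : ℝ≥0 × Ω → ℝ}
    (hα : Measurable[(randomMeasureFiltration P).predictable] α)
    (hβ : Measurable[(randomMeasureFiltration P).predictable] β) :
    ∫⁻ ω, ∫⁻ x in box 0 T c, φ x.1 * w x.2.2 *
        (Ioc (α (x.1.toNNReal, ω)) (β (x.1.toNNReal, ω))).indicator 1 x.2.1 ∂P ω ∂μ ≤
      (∫⁻ y, w y ∂ν) * ∫⁻ s in Ioc 0 T, φ s *
        ∫⁻ ω, ENNReal.ofReal (β (s.toNNReal, ω) - α (s.toNNReal, ω)) ∂μ := by
  have hle := predictable_le (randomMeasureFiltration P)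
  have hG : Measurable[(randomMeasureFiltration P).predictable]
      fun p : ℝ≥0 × Ω => φ (p.1 : ℝ) :=
    (hφ.comp measurable_coe_nnreal_real).comp (measurable_predictable_fst _)
  have h := lintegral_thinning_le hP T c hG hw hα hβ
  have h1 : ∀ s ∈ Ioc 0 T, ∫⁻ ω, φ (s.toNNReal : ℝ) *
      ENNReal.ofReal (β (s.toNNReal, ω) - α (s.toNNReal, ω)) ∂μ =
        φ s * ∫⁻ ω, ENNReal.ofReal (β (s.toNNReal, ω) - α (s.toNNReal, ω)) ∂μ := by
    intro s hs
    rw [Real.coe_toNNReal _ hs.1.le, lintegral_const_mul]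
    exact (((hβ.mono hle le_rfl).comp measurable_prodMk_left).sub
      ((hα.mono hle le_rfl).comp measurable_prodMk_left)).ennreal_ofReal
  rw [setLIntegral_congr_fun measurableSet_Ioc h1] at h
  refine le_trans (le_of_eq ?_) h
  refine lintegral_congr fun ω => setLIntegral_congr_fun (measurableSet_box 0 T c) fun x hx => ?_
  rw [Real.coe_toNNReal _ hx.1.1.le]

variable {h ψ b : ℝ → ℝ} {c T Δ : ℝ} {M : ℕ} {R : ℝ → Ω → ℝ} {lc lb : ℝ≥0 × Ω → ℝ} {L : ℝ≥0}

/-- Mean of the continuous-time intensity. -/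
noncomputable def meanIntensity (μ : Measure Ω) (lc : ℝ≥0 × Ω → ℝ) (t : ℝ) : ℝ≥0∞ :=
  ∫⁻ ω, ENNReal.ofReal (lc (t.toNNReal, ω)) ∂μ

lemma lipschitz_ofReal_le (hψ : LipschitzWith L ψ) (x y : ℝ) :
    ENNReal.ofReal |ψ x - ψ y| ≤ L * ‖x - y‖ₑ := by
  have := hψ x y
  rwa [edist_eq_enorm_sub, edist_eq_enorm_sub, Real.enorm_eq_ofReal_abs (ψ x - ψ y)] at this

/-- The compensation formula between the levels `0` and `lc` replaces the sum over past accepted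
points by an integral of the mean intensity against `|h|`. -/
lemma meanIntensity_le_add (hP : IsPoissonRandomMeasure μ P (poissonIntensity ν))
    (hC : Coupled μ P c T Δ M h ψ b R lc lb) (hh : Measurable h) (hb : Measurable b)
    (hb0 : ∀ y, 0 ≤ b y) (hψ : LipschitzWith L ψ) {a : ℝ} (ha : ψ 0 ≤ a) {S : ℝ≥0∞}
    (hS : ∀ t ∈ Icc 0 T, meanIntensity μ lc t ≤ S) {t : ℝ} (ht : t ∈ Icc 0 T) :
    meanIntensity μ lc t ≤ ENNReal.ofReal a
      + L * (∫⁻ y, ENNReal.ofReal (b y) ∂ν) * (∫⁻ y in Ico 0 T, ‖h y‖ₑ) * S := by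
  set φ : ℝ → ℝ≥0∞ := fun u => (Ico 0 t).indicator 1 u * ‖h (t - u)‖ₑ with hφdef
  have hφ : Measurable φ := (measurable_one.indicator measurableSet_Ico).mul
    (hh.comp (measurable_const.sub measurable_id)).enorm
  have hpath : ∀ᵐ ω ∂μ, ENNReal.ofReal (lc (t.toNNReal, ω)) ≤ ENNReal.ofReal a +
      L * ∫⁻ x in box 0 T c, φ x.1 * ENNReal.ofReal (b x.2.2) *
        (Ioc 0 (lc (x.1.toNNReal, ω))).indicator 1 x.2.1 ∂P ω := by
    filter_upwards [hC.lc_eq] with ω hω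
    rw [hω t ht]
    set I := ∫ x in box 0 T c, (Ico 0 t).indicator 1 x.1 * (h (t - x.1) * b x.2.2) *
      (Ioc 0 (lc (x.1.toNNReal, ω))).indicator 1 x.2.1 ∂P ω with hI
    -- Comparing with `ψ 0` and not with the supremum of `ψ` keeps `‖ψ‖_∞` out of the bound on the
    -- mean intensity.
    have h1 : ψ I ≤ a + |ψ I - ψ 0| := by
      have := le_abs_self (ψ I - ψ 0); linarith
    refine (ENNReal.ofReal_le_ofReal h1).trans (ENNReal.ofReal_add_le.trans ?_)
    gcongr
    refine (lipschitz_ofReal_le hψ I 0).trans ?_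
    rw [sub_zero]
    gcongr
    refine (enorm_integral_le_lintegral_enorm _).trans (le_of_eq (lintegral_congr fun x => ?_))
    have hbx : ‖b x.2.2‖ₑ = ENNReal.ofReal (b x.2.2) := Real.enorm_of_nonneg (hb0 _)
    by_cases h1 : x.1 ∈ Ico 0 t <;>
      by_cases h2 : x.2.1 ∈ Ioc 0 (lc (x.1.toNNReal, ω)) <;> simp [h1, h2, hφdef, hbx, enorm_mul]
  have hint : ∫⁻ u in Ioc 0 T, φ u ≤ ∫⁻ y in Ico 0 T, ‖h y‖ₑ := by
    calc _ ≤ ∫⁻ u, φ u := setLIntegral_le_lintegral _ _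
      _ = ∫⁻ u in Ico 0 t, ‖h (t - u)‖ₑ := by
          rw [← lintegral_indicator measurableSet_Ico]
          refine lintegral_congr fun u => ?_
          by_cases hu : u ∈ Ico 0 t <;> simp [hφdef, hu]
      _ = ∫⁻ u in Ico 0 t, ‖h u‖ₑ := by
          rw [restrict_Ico_eq_restrict_Ioc, setLIntegral_reflect _ 0 t t,
            restrict_Ico_eq_restrict_Ioc]
          simp
      _ ≤ _ := lintegral_mono_set (Ico_subset_Ico_right ht.2)
  have hthin := lintegral_thinning_le_of_time hP T c hφ hb.ennreal_ofReal
    (α := fun _ => 0) (@measurable_const _ _ _ (randomMeasureFiltration P).predictable 0)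
    hC.measurable_lc
  have hm : AEMeasurable (fun ω => ∫⁻ x in box 0 T c, φ x.1 * ENNReal.ofReal (b x.2.2) *
        (Ioc 0 (lc (x.1.toNNReal, ω))).indicator 1 x.2.1 ∂P ω) μ := by
    refine aemeasurable_lintegral_box hP T c (measurable_thinned
      (φ := fun x : MarkSpace => φ x.1 * ENNReal.ofReal (b x.2.2))
      ((hφ.comp measurable_fst).mul (hb.comp (measurable_snd.comp measurable_snd)).ennreal_ofReal)
      (l := fun p : Ω × ℝ => lc (p.2.toNNReal, p.1)) ?_)
    exact (hC.measurable_lc.mono (predictable_le _) le_rfl).comp (by fun_prop)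
  calc _ ≤ ∫⁻ ω, (ENNReal.ofReal a + L * ∫⁻ x in box 0 T c, φ x.1 * ENNReal.ofReal (b x.2.2) *
        (Ioc 0 (lc (x.1.toNNReal, ω))).indicator 1 x.2.1 ∂P ω) ∂μ := lintegral_mono_ae hpath
    _ = ENNReal.ofReal a + L * ∫⁻ ω, ∫⁻ x in box 0 T c, φ x.1 * ENNReal.ofReal (b x.2.2) *
        (Ioc 0 (lc (x.1.toNNReal, ω))).indicator 1 x.2.1 ∂P ω ∂μ := by
        rw [lintegral_add_left measurable_const, lintegral_const_mul'' _ hm]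
        simp
    _ ≤ ENNReal.ofReal a + L * ((∫⁻ y, ENNReal.ofReal (b y) ∂ν) *
          ((∫⁻ y in Ico 0 T, ‖h y‖ₑ) * S)) := by
        gcongr
        refine hthin.trans ?_
        gcongr
        calc _ ≤ ∫⁻ s in Ioc 0 T, φ s * S := by
              refine setLIntegral_mono' measurableSet_Ioc fun s hs => ?_
              gcongr
              simpa [meanIntensity] using hS s ⟨hs.1.le, hs.2⟩
          _ = (∫⁻ s in Ioc 0 T, φ s) * S := lintegral_mul_const _ hφ
          _ ≤ _ := by gcongr
    _ = _ := by ring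

theorem meanIntensity_le (hP : IsPoissonRandomMeasure μ P (poissonIntensity ν))
    (hC : Coupled μ P c T Δ M h ψ b R lc lb) (hh : Measurable h) (hb : Measurable b)
    (hb0 : ∀ y, 0 ≤ b y) (hψ : LipschitzWith L ψ) {a : ℝ} (ha : ψ 0 ≤ a) {ρ : ℝ} (hρ0 : 0 ≤ ρ)
    (hρ : ρ < 1) (hstab : L * (∫⁻ y, ENNReal.ofReal (b y) ∂ν) * (∫⁻ y in Ico 0 T, ‖h y‖ₑ)
      ≤ ENNReal.ofReal ρ) {t : ℝ} (ht : t ∈ Icc 0 T) :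
    meanIntensity μ lc t ≤ ENNReal.ofReal (1 - ρ)⁻¹ * ENNReal.ofReal a := by
  set S := ⨆ t ∈ Icc 0 T, meanIntensity μ lc t with hSdef
  have hS : ∀ t ∈ Icc 0 T, meanIntensity μ lc t ≤ S := fun t ht => le_iSup₂_of_le t ht le_rfl
  have hSfin : S ≠ ∞ := by
    refine ne_top_of_le_ne_top (ENNReal.ofReal_ne_top (r := c)) (iSup₂_le fun t _ => ?_)
    calc _ ≤ ∫⁻ _, ENNReal.ofReal c ∂μ :=
          lintegral_mono fun ω => ENNReal.ofReal_le_ofReal (hC.lc_mem _).2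
      _ = _ := by simp
  refine (hS t ht).trans (le_of_le_add_mul hSfin hρ0 hρ (iSup₂_le fun t ht => ?_))
  refine (meanIntensity_le_add hP hC hh hb hb0 hψ ha hS ht).trans ?_
  gcongr

end Estimates

end Hawkes

namespace Hawkes

variable {Ω : Type*} [mΩ : MeasurableSpace Ω]

/-! ### Distance between the two intensities -/

section Difference

variable {ν : Measure ℝ} [IsProbabilityMeasure ν] {μ : Measure Ω}
  {P : Kernel Ω MarkSpace} {h ψ b : ℝ → ℝ} {c T Δ : ℝ} {M : ℕ} {R : ℝ → Ω → ℝ}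
  {lc lb : ℝ≥0 × Ω → ℝ} {L : ℝ≥0}

lemma sum_indicator_cell {Δ : ℝ} (hΔ : 0 < Δ) {A : Type*} [AddCommMonoid A] (f : ℝ → A) (u : ℝ)
    {k : ℕ} (hk : 1 ≤ k) :
    ∑ j ∈ Finset.Ico 1 k, (cell Δ j).indicator f u = (Ioc 0 (((k : ℝ) - 1) * Δ)).indicator f u := by
  induction k, hk using Nat.le_induction with
  | base => simp
  | succ k hk ih =>
    rw [Finset.sum_Ico_succ_top hk, ih]
    have hk' : (1 : ℝ) ≤ k := by exact_mod_cast hk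
    have h1 : Ioc 0 (((k + 1 : ℕ) - 1 : ℝ) * Δ) = Ioc 0 (((k : ℝ) - 1) * Δ) ∪ cell Δ k := by
      rw [cell, Ioc_union_Ioc_eq_Ioc (by nlinarith) (by nlinarith)]
      push_cast; simp
    have h2 : Disjoint (Ioc 0 (((k : ℝ) - 1) * Δ)) (cell Δ k) :=
      Ioc_disjoint_Ioc.2 (by simp)
    rw [h1, indicator_union_of_disjoint h2]

/-- Mean distance between the two intensities. -/
noncomputable def meanGap (μ : Measure Ω) (lc lb : ℝ≥0 × Ω → ℝ) (s : ℝ) : ℝ≥0∞ :=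
  ∫⁻ ω, ENNReal.ofReal |lc (s.toNNReal, ω) - lb (s.toNNReal, ω)| ∂μ

lemma measurable_meanGap [SFinite μ] (hlc : Measurable lc) (hlb : Measurable lb) :
    Measurable (meanGap μ lc lb) := by
  have hm1 : Measurable fun z : Ω × ℝ => (z.2.toNNReal, z.1) := by fun_prop
  have : Measurable fun z : Ω × ℝ =>
      ENNReal.ofReal |lc (z.2.toNNReal, z.1) - lb (z.2.toNNReal, z.1)| :=
    ((hlc.comp hm1).sub (hlb.comp hm1)).abs.ennreal_ofReal
  exact this.lintegral_prod_left'

/-- The kernel `u ↦ h (s - u)` compared with its discretization on the cells before the `k`-th. -/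
noncomputable def kernelGap (h : ℝ → ℝ) (Δ : ℝ) (k : ℕ) (s u : ℝ) : ℝ≥0∞ :=
  ∑ j ∈ Finset.Ico 1 k, (cell Δ j).indicator 1 u * ‖h (s - u) - h (((k : ℝ) - j) * Δ)‖ₑ
    + (Ioo (((k : ℝ) - 1) * Δ) s).indicator 1 u * ‖h (s - u)‖ₑ

/-- The discretized kernel on the cells before the `k`-th. -/
noncomputable def gridKernel (h : ℝ → ℝ) (Δ : ℝ) (k : ℕ) (u : ℝ) : ℝ≥0∞ :=
  ∑ j ∈ Finset.Ico 1 k, (cell Δ j).indicator 1 u * ‖h (((k : ℝ) - j) * Δ)‖ₑ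

lemma measurable_kernelGap (hh : Measurable h) (Δ : ℝ) (k : ℕ) (s : ℝ) :
    Measurable (kernelGap h Δ k s) := by
  have h1 : Measurable fun u => h (s - u) := hh.comp (measurable_const.sub measurable_id)
  refine (Finset.measurable_fun_sum _ fun j _ => ?_).add ?_
  · exact (measurable_one.indicator measurableSet_Ioc).mul (h1.sub_const _).enorm
  · exact (measurable_one.indicator measurableSet_Ioo).mul h1.enorm

lemma measurable_gridKernel (Δ : ℝ) (k : ℕ) : Measurable (gridKernel h Δ k) :=
  Finset.measurable_fun_sum _ fun _ _ =>
    (measurable_one.indicator measurableSet_Ioc).mul measurable_const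

/-- The bound must hold wherever `s` lies in its cell, which is the role of the supremum over `ε` in
`C_R`. -/
lemma lintegral_kernelGap_le (hh : Measurable h) (hi : IntegrableOn h (Icc 0 T)) (hΔ : 0 < Δ)
    (hT : T = M * Δ) {k : ℕ} (hk : 1 ≤ k) (hkM : k ≤ M) {s : ℝ} (hs : s ∈ cell Δ k) :
    ∫⁻ u, kernelGap h Δ k s u ≤ ENNReal.ofReal (kernelReg h T Δ) := by
  have h1 : Measurable fun u => h (s - u) := hh.comp (measurable_const.sub measurable_id)
  have hm1 : ∀ j, Measurable fun u => (cell Δ j).indicator (1 : ℝ → ℝ≥0∞) u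
      * ‖h (s - u) - h (((k : ℝ) - j) * Δ)‖ₑ := fun j =>
    (measurable_one.indicator measurableSet_Ioc).mul (h1.sub_const _).enorm
  have hm2 : Measurable fun u => (Ioo (((k : ℝ) - 1) * Δ) s).indicator (1 : ℝ → ℝ≥0∞) u
      * ‖h (s - u)‖ₑ := (measurable_one.indicator measurableSet_Ioo).mul h1.enorm
  have hind : ∀ (I : Set ℝ) (hI : MeasurableSet I) (f : ℝ → ℝ≥0∞),
      ∫⁻ u, I.indicator 1 u * f u = ∫⁻ u in I, f u := fun I hI f => by
    rw [← lintegral_indicator hI]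
    refine lintegral_congr fun u => ?_
    by_cases hu : u ∈ I <;> simp [hu]
  unfold kernelGap
  rw [lintegral_add_right _ hm2, lintegral_finsetSum _ fun j _ => hm1 j, hind _ measurableSet_Ioo]
  simp_rw [fun j : ℕ => hind (cell Δ j) measurableSet_Ioc]
  set ε := s - ((k : ℝ) - 1) * Δ with hε
  have hsε : s = ((k : ℝ) - 1) * Δ + ε := by rw [hε]; ring
  have hεmem : ε ∈ Icc 0 Δ := ⟨by linarith [hs.1], by have := hs.2; rw [hε]; linarith⟩
  refine le_trans ?_ (lintegral_kernelReg_le hh hi hΔ (hk.trans hkM) hT hεmem)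
  rw [add_comm]
  gcongr ?_ + ?_
  · rw [Measure.restrict_congr_set Ioo_ae_eq_Ioc, setLIntegral_reflect _ _ _ s, sub_self]
    simp only [sub_sub_cancel]
    exact lintegral_mono_set (Ico_subset_Ico_right hεmem.2)
  · have := sum_lintegral_cells_le (h := h) hΔ hT hk hkM ε
    rwa [← hsε] at this

lemma lintegral_gridKernel_mul (f : ℝ → ℝ≥0∞) (hf : Measurable f) (k : ℕ) :
    ∫⁻ u, gridKernel h Δ k u * f u
      = ∑ j ∈ Finset.Ico 1 k, ‖h (((k : ℝ) - j) * Δ)‖ₑ * ∫⁻ u in cell Δ j, f u := by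
  have hm : ∀ j : ℕ, Measurable fun u => (cell Δ j).indicator (1 : ℝ → ℝ≥0∞) u *
      ‖h (((k : ℝ) - j) * Δ)‖ₑ * f u := fun j =>
    ((measurable_one.indicator measurableSet_Ioc).mul measurable_const).mul hf
  simp_rw [gridKernel, Finset.sum_mul]
  rw [lintegral_finsetSum _ fun j _ => hm j]
  refine Finset.sum_congr rfl fun j _ => ?_
  rw [← lintegral_const_mul _ hf, ← lintegral_indicator measurableSet_Ioc]
  refine lintegral_congr fun u => ?_
  by_cases hu : u ∈ cell Δ j <;> simp [hu]

/-- The two differences are separated so that the error of the kernel meets the acceptance by `l`,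
whose mean is controlled, while the difference of acceptances meets the discretized kernel. This is
why discrete stability is what closes the estimate. -/
lemma enorm_thinned_sub_le (hΔ : 0 < Δ) {k : ℕ} (hk : 1 ≤ k) {s : ℝ} (hs : s ∈ cell Δ k) {u θ y : ℝ}
    (hu : 0 < u) (hθ : 0 < θ) (hb0 : 0 ≤ b y) (l l' : ℝ) :
    ‖(Ico 0 s).indicator 1 u * (h (s - u) * b y) * (Ioc 0 l).indicator 1 θ
      - ∑ j ∈ Finset.Ico 1 k, h (((k : ℝ) - j) * Δ) * ((cell Δ j).indicator 1 u * b y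
        * (Ioc 0 l').indicator 1 θ)‖ₑ
      ≤ kernelGap h Δ k s u * ENNReal.ofReal (b y) * (Ioc 0 l).indicator 1 θ
        + gridKernel h Δ k u * ENNReal.ofReal (b y) * (Ioc (min l l') (max l l')).indicator 1 θ := by
  set g : ℝ := ∑ j ∈ Finset.Ico 1 k, (cell Δ j).indicator 1 u * h (((k : ℝ) - j) * Δ) with hg
  have hbe : ‖b y‖ₑ = ENNReal.ofReal (b y) := Real.enorm_of_nonneg hb0
  have hie : ∀ I : Set ℝ, ∀ z : ℝ, ‖I.indicator (1 : ℝ → ℝ) z‖ₑ = I.indicator 1 z := fun I z => by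
    by_cases hz : z ∈ I <;> simp [hz]
  -- The positive times before `s` are the cells preceding the `k`-th and the elapsed part of the
  -- `k`-th.
  have hsplit : (Ico 0 s).indicator (1 : ℝ → ℝ) u = ∑ j ∈ Finset.Ico 1 k, (cell Δ j).indicator 1 u
      + (Ioo (((k : ℝ) - 1) * Δ) s).indicator 1 u := by
    rw [sum_indicator_cell hΔ _ _ hk]
    have h1 : ((k : ℝ) - 1) * Δ < s := hs.1
    by_cases h2 : u ≤ ((k : ℝ) - 1) * Δ
    · have a1 : u ∈ Ico 0 s := ⟨hu.le, by linarith⟩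
      have a2 : u ∈ Ioc 0 (((k : ℝ) - 1) * Δ) := ⟨hu, h2⟩
      have a3 : u ∉ Ioo (((k : ℝ) - 1) * Δ) s := fun h => absurd h.1 (not_lt.2 h2)
      rw [indicator_of_mem a1, indicator_of_mem a2, indicator_of_notMem a3, add_zero]
    · have a2 : u ∉ Ioc 0 (((k : ℝ) - 1) * Δ) := fun h => h2 h.2
      by_cases h3 : u < s
      · have a1 : u ∈ Ico 0 s := ⟨hu.le, h3⟩
        have a3 : u ∈ Ioo (((k : ℝ) - 1) * Δ) s := ⟨not_le.1 h2, h3⟩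
        rw [indicator_of_mem a1, indicator_of_notMem a2, indicator_of_mem a3, zero_add]
      · have a1 : u ∉ Ico 0 s := fun h => h3 h.2
        have a3 : u ∉ Ioo (((k : ℝ) - 1) * Δ) s := fun h => h3 h.2
        rw [indicator_of_notMem a1, indicator_of_notMem a2, indicator_of_notMem a3, zero_add]
  have hgap : ‖(Ico 0 s).indicator 1 u * h (s - u) - g‖ₑ ≤ kernelGap h Δ k s u := by
    have : (Ico 0 s).indicator 1 u * h (s - u) - g = ∑ j ∈ Finset.Ico 1 k,
        (cell Δ j).indicator 1 u * (h (s - u) - h (((k : ℝ) - j) * Δ))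
          + (Ioo (((k : ℝ) - 1) * Δ) s).indicator 1 u * h (s - u) := by
      simp only [hsplit, hg, mul_sub, Finset.sum_sub_distrib, add_mul, Finset.sum_mul]
      ring
    rw [this]
    refine (enorm_add_le _ _).trans ?_
    unfold kernelGap
    gcongr ?_ + ?_
    · refine (enorm_sum_le _ _).trans (Finset.sum_le_sum fun j _ => ?_)
      rw [enorm_mul, hie]
    · rw [enorm_mul, hie]
  have hgrid : ‖g‖ₑ ≤ gridKernel h Δ k u := by
    refine (enorm_sum_le _ _).trans (Finset.sum_le_sum fun j _ => ?_)
    rw [enorm_mul, hie]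
  have hth : ‖(Ioc 0 l).indicator (1 : ℝ → ℝ) θ - (Ioc 0 l').indicator 1 θ‖ₑ
      ≤ (Ioc (min l l') (max l l')).indicator 1 θ := by
    by_cases h1 : θ ≤ l <;> by_cases h2 : θ ≤ l'
    · simp [h1, h2, hθ]
    · have : θ ∈ Ioc (min l l') (max l l') :=
        ⟨min_lt_of_right_lt (not_le.1 h2), le_max_of_le_left h1⟩
      simp [h1, h2, hθ, indicator_of_mem this]
    · have : θ ∈ Ioc (min l l') (max l l') :=
        ⟨min_lt_of_left_lt (not_le.1 h1), le_max_of_le_right h2⟩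
      simp [h1, h2, hθ, indicator_of_mem this]
    · simp [h1, h2]
  have heq : (Ico 0 s).indicator 1 u * (h (s - u) * b y) * (Ioc 0 l).indicator 1 θ
      - ∑ j ∈ Finset.Ico 1 k, h (((k : ℝ) - j) * Δ) * ((cell Δ j).indicator 1 u * b y
        * (Ioc 0 l').indicator 1 θ)
      = ((Ico 0 s).indicator 1 u * h (s - u) - g) * b y * (Ioc 0 l).indicator 1 θ
        + g * b y * ((Ioc 0 l).indicator 1 θ - (Ioc 0 l').indicator 1 θ) := by
    have : ∑ j ∈ Finset.Ico 1 k, h (((k : ℝ) - j) * Δ) * ((cell Δ j).indicator 1 u * b y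
        * (Ioc 0 l').indicator 1 θ) = g * b y * (Ioc 0 l').indicator 1 θ := by
      rw [hg, Finset.sum_mul, Finset.sum_mul]
      exact Finset.sum_congr rfl fun j _ => by ring
    rw [this]; ring
  rw [heq]
  refine (enorm_add_le _ _).trans ?_
  rw [enorm_mul, enorm_mul, enorm_mul, enorm_mul, hbe, hie]
  gcongr

lemma ae_lintegral_box_lt_top (hP : IsPoissonRandomMeasure μ P (poissonIntensity ν))
    (T c : ℝ) {φ w : ℝ → ℝ≥0∞} (hφ : Measurable φ) (hw : Measurable w)
    (hφi : ∫⁻ s in Ioc 0 T, φ s ≠ ∞) (hwi : ∫⁻ y, w y ∂ν ≠ ∞) :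
    ∀ᵐ ω ∂μ, ∫⁻ x in box 0 T c, φ x.1 * w x.2.2 ∂P ω < ∞ := by
  have hm : Measurable fun x : MarkSpace => φ x.1 * w x.2.2 :=
    (hφ.comp measurable_fst).mul (hw.comp (measurable_snd.comp measurable_snd))
  have h1 := lintegral_lintegral_eq hP (hm.indicator (measurableSet_box 0 T c))
  simp_rw [lintegral_indicator (measurableSet_box 0 T c)] at h1
  refine ae_lt_top' (aemeasurable_lintegral_box hP T c (hm.comp measurable_snd)) ?_
  have h3 := lintegral_prod_mul (μ := volume.restrict (Ioc 0 T))
    (ν := (volume.restrict (Ioc 0 c)).prod ν) (f := φ) (g := fun z : ℝ × ℝ => w z.2)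
    hφ.aemeasurable (hw.comp measurable_snd).aemeasurable
  rw [h1, restrict_box le_rfl, h3]
  refine ENNReal.mul_ne_top hφi ?_
  have h2 := lintegral_prod_mul (μ := volume.restrict (Ioc 0 c)) (ν := ν) (f := fun _ => 1) (g := w)
    aemeasurable_const hw.aemeasurable
  simp only [one_mul] at h2 ⊢
  rw [h2]
  refine ENNReal.mul_ne_top ?_ hwi
  simp

lemma measurable_thinning_term {φ w : ℝ → ℝ≥0∞} (hφ : Measurable φ) (hw : Measurable w)
    {α β : ℝ≥0 × Ω → ℝ} (hα : Measurable α) (hβ : Measurable β) :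
    Measurable fun p : Ω × MarkSpace => φ p.2.1 * w p.2.2.2 *
      (Ioc (α (p.2.1.toNNReal, p.1)) (β (p.2.1.toNNReal, p.1))).indicator 1 p.2.2.1 := by
  have h1 : Measurable fun p : Ω × MarkSpace => p.2.2.1 := by fun_prop
  have h0 : Measurable fun p : Ω × MarkSpace => (p.2.1.toNNReal, p.1) := by fun_prop
  have hs : MeasurableSet {p : Ω × MarkSpace | α (p.2.1.toNNReal, p.1) < p.2.2.1 ∧
      p.2.2.1 ≤ β (p.2.1.toNNReal, p.1)} :=
    (measurableSet_lt (hα.comp h0) h1).inter (measurableSet_le h1 (hβ.comp h0))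
  exact ((hφ.comp (by fun_prop)).mul (hw.comp (by fun_prop))).mul
    ((measurable_const (a := (1 : ℝ≥0∞))).indicator hs)

lemma measurable_thinning_section {φ w : ℝ → ℝ≥0∞} (hφ : Measurable φ) (hw : Measurable w)
    {β : ℝ → ℝ} (hβ : Measurable β) :
    Measurable fun x : MarkSpace => φ x.1 * w x.2.2 * (Ioc 0 (β x.1)).indicator 1 x.2.1 := by
  have h1 : Measurable fun x : MarkSpace => x.2.1 := by fun_prop
  have hs : MeasurableSet {x : MarkSpace | 0 < x.2.1 ∧ x.2.1 ≤ β x.1} :=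
    (measurableSet_lt measurable_const h1).inter (measurableSet_le h1 (hβ.comp measurable_fst))
  exact ((hφ.comp (by fun_prop)).mul (hw.comp (by fun_prop))).mul
    ((measurable_const (a := (1 : ℝ≥0∞))).indicator hs)

lemma ofReal_gap_le (hP : IsPoissonRandomMeasure μ P (poissonIntensity ν))
    (hC : Coupled μ P c T Δ M h ψ b R lc lb) (hh : Measurable h) (hi : IntegrableOn h (Icc 0 T))
    (hb : Measurable b) (hb0 : ∀ y, 0 ≤ b y) (hbi : ∫⁻ y, ENNReal.ofReal (b y) ∂ν ≠ ∞)
    (hψ : LipschitzWith L ψ) (hΔ : 0 < Δ) {k : ℕ} (hk : 1 ≤ k) (hkM : k ≤ M) {s : ℝ}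
    (hs : s ∈ cell Δ k) (hsT : s ∈ Icc 0 T) :
    ∀ᵐ ω ∂μ, ENNReal.ofReal |lc (s.toNNReal, ω) - lb (s.toNNReal, ω)| ≤
      L * ((∫⁻ x in box 0 T c, kernelGap h Δ k s x.1 * ENNReal.ofReal (b x.2.2) *
        (Ioc 0 (lc (x.1.toNNReal, ω))).indicator 1 x.2.1 ∂P ω) +
        ∫⁻ x in box 0 T c, gridKernel h Δ k x.1 * ENNReal.ofReal (b x.2.2) *
          (Ioc (min (lc (x.1.toNNReal, ω)) (lb (x.1.toNNReal, ω)))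
            (max (lc (x.1.toNNReal, ω)) (lb (x.1.toNNReal, ω)))).indicator 1 x.2.1 ∂P ω) := by
  have hle := predictable_le (randomMeasureFiltration P)
  have hlc := hC.measurable_lc.mono hle le_rfl
  have hlb := hC.measurable_lb.mono hle le_rfl
  have hbo := hb.ennreal_ofReal
  have hshift : ∫⁻ u in Ioc 0 T, (Ico 0 s).indicator 1 u * ‖h (s - u)‖ₑ ≠ ∞ := by
    refine ne_top_of_le_ne_top (b := ∫⁻ y in Ico 0 T, ‖h y‖ₑ)
      (hi.mono_set Ico_subset_Icc_self).2.ne ?_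
    calc _ ≤ ∫⁻ u, (Ico 0 s).indicator 1 u * ‖h (s - u)‖ₑ := setLIntegral_le_lintegral _ _
      _ = ∫⁻ u in Ico 0 s, ‖h (s - u)‖ₑ := by
          rw [← lintegral_indicator measurableSet_Ico]
          refine lintegral_congr fun u => ?_
          by_cases hu : u ∈ Ico 0 s <;> simp [hu]
      _ = ∫⁻ u in Ico 0 s, ‖h u‖ₑ := by
          rw [restrict_Ico_eq_restrict_Ioc, setLIntegral_reflect _ 0 s s,
            restrict_Ico_eq_restrict_Ioc]
          simp
      _ ≤ _ := lintegral_mono_set (Ico_subset_Ico_right hsT.2)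
  have hshm : Measurable fun u => (Ico 0 s).indicator (1 : ℝ → ℝ≥0∞) u * ‖h (s - u)‖ₑ :=
    (measurable_one.indicator measurableSet_Ico).mul
      (hh.comp (measurable_const.sub measurable_id)).enorm
  filter_upwards [hC.lc_eq, hC.lb_eq, ae_lintegral_box_lt_top hP T c hshm hbo hshift hbi,
    ae_lintegral_box_lt_top hP T c (φ := fun _ => 1) measurable_const hbo (by simp) hbi]
    with ω h1 h2 h3 h4
  have hlcω : Measurable fun u : ℝ => lc (u.toNNReal, ω) := hlc.comp (by fun_prop)
  have hlbω : Measurable fun u : ℝ => lb (u.toNNReal, ω) := hlb.comp (by fun_prop)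
  have hmth : ∀ (l : ℝ → ℝ), Measurable l → Measurable fun x : MarkSpace =>
      (Ioc 0 (l x.1)).indicator (1 : ℝ → ℝ) x.2.1 := fun l hl => by
    have hm : Measurable fun x : MarkSpace => x.2.1 := by fun_prop
    exact (measurable_const (a := (1 : ℝ))).indicator
      ((measurableSet_lt measurable_const hm).inter (measurableSet_le hm (hl.comp measurable_fst)))
  have hmI : ∀ (I : Set ℝ), MeasurableSet I → Measurable fun x : MarkSpace =>
      I.indicator (1 : ℝ → ℝ) x.1 := fun I hI => (measurable_one.indicator hI).comp measurable_fst
  have hmb : Measurable fun x : MarkSpace => b x.2.2 :=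
    hb.comp (measurable_snd.comp measurable_snd)
  have hbe : ∀ y, ‖b y‖ₑ = ENNReal.ofReal (b y) := fun y => Real.enorm_of_nonneg (hb0 y)
  have hmh : Measurable fun x : MarkSpace => h (s - x.1) :=
    hh.comp (measurable_const.sub measurable_fst)
  -- A divergent Bochner integral is `0` by convention, so integrability is checked before the two
  -- integrals are subtracted.
  have int1 : Integrable (fun x : MarkSpace => (Ico 0 s).indicator 1 x.1 *
      (h (s - x.1) * b x.2.2) * (Ioc 0 (lc (x.1.toNNReal, ω))).indicator 1 x.2.1)
      ((P ω).restrict (box 0 T c)) := by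
    refine ⟨(((hmI _ measurableSet_Ico).mul (hmh.mul hmb)).mul
      (hmth _ hlcω)).aestronglyMeasurable, ?_⟩
    rw [hasFiniteIntegral_iff_enorm]
    refine lt_of_le_of_lt (lintegral_mono fun x => ?_) h3
    by_cases ha : x.1 ∈ Ico 0 s <;> by_cases hb' : x.2.1 ∈ Ioc 0 (lc (x.1.toNNReal, ω)) <;>
      simp [ha, hb', hbe]
  have int2 : ∀ j ∈ Finset.Ico 1 k, Integrable (fun x : MarkSpace => h (((k : ℝ) - j) * Δ) *
      ((cell Δ j).indicator 1 x.1 * b x.2.2 *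
        (Ioc 0 (lb (x.1.toNNReal, ω))).indicator 1 x.2.1)) ((P ω).restrict (box 0 T c)) := by
    intro j _
    refine Integrable.const_mul ⟨(((hmI _ measurableSet_Ioc).mul hmb).mul
      (hmth _ hlbω)).aestronglyMeasurable, ?_⟩ _
    rw [hasFiniteIntegral_iff_enorm]
    refine lt_of_le_of_lt (lintegral_mono fun x => ?_) h4
    by_cases ha : x.1 ∈ cell Δ j <;> by_cases hb' : x.2.1 ∈ Ioc 0 (lb (x.1.toNNReal, ω)) <;>
      simp [ha, hb', hbe]
  rw [h1 s hsT, h2 k (Finset.mem_Icc.2 ⟨hk, hkM⟩) s hs]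
  refine (lipschitz_ofReal_le hψ _ _).trans ?_
  gcongr
  simp_rw [← integral_const_mul]
  rw [← integral_finsetSum _ int2, ← integral_sub int1 (integrable_finsetSum _ int2)]
  refine (enorm_integral_le_lintegral_enorm _).trans ?_
  have hF1ω : Measurable fun x : MarkSpace => kernelGap h Δ k s x.1 * ENNReal.ofReal (b x.2.2) *
      (Ioc 0 (lc (x.1.toNNReal, ω))).indicator 1 x.2.1 :=
    measurable_thinning_section (measurable_kernelGap hh Δ k s) hbo hlcω
  rw [← lintegral_add_left hF1ω]
  refine setLIntegral_mono' (measurableSet_box 0 T c) fun x hx => ?_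
  have := enorm_thinned_sub_le (h := h) (b := b) hΔ hk hs hx.1.1 hx.2.1.1 (hb0 x.2.2)
    (lc (x.1.toNNReal, ω)) (lb (x.1.toNNReal, ω))
  exact this

variable [IsProbabilityMeasure μ]

/-- Expectation of the path estimate. The minimum and the maximum of the two intensities are
predictable levels and their distance is the gap itself, so the compensation formula yields an
inequality for the gap alone. -/
lemma meanGap_le (hP : IsPoissonRandomMeasure μ P (poissonIntensity ν))
    (hC : Coupled μ P c T Δ M h ψ b R lc lb) (hh : Measurable h) (hi : IntegrableOn h (Icc 0 T))
    (hb : Measurable b) (hb0 : ∀ y, 0 ≤ b y) (hbi : ∫⁻ y, ENNReal.ofReal (b y) ∂ν ≠ ∞)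
    (hψ : LipschitzWith L ψ) (hΔ : 0 < Δ) (hT : T = M * Δ) {A : ℝ≥0∞}
    (hA : ∀ t ∈ Icc 0 T, meanIntensity μ lc t ≤ A) {k : ℕ} (hk : 1 ≤ k) (hkM : k ≤ M) {s : ℝ}
    (hs : s ∈ cell Δ k) :
    meanGap μ lc lb s ≤ L * ((∫⁻ y, ENNReal.ofReal (b y) ∂ν) *
      (ENNReal.ofReal (kernelReg h T Δ) * A +
        ∑ j ∈ Finset.Ico 1 k, ‖h (((k : ℝ) - j) * Δ)‖ₑ * ∫⁻ u in cell Δ j, meanGap μ lc lb u)) := by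
  have hle := predictable_le (randomMeasureFiltration P)
  have hlc := hC.measurable_lc.mono hle le_rfl
  have hlb := hC.measurable_lb.mono hle le_rfl
  have hk1 : (1 : ℝ) ≤ k := by exact_mod_cast hk
  have hsT : s ∈ Icc 0 T := by
    refine ⟨(mul_nonneg (by linarith) hΔ.le).trans hs.1.le, hs.2.trans ?_⟩
    rw [hT]; gcongr
  have hmG := measurable_kernelGap hh Δ k s
  have hmK := measurable_gridKernel (h := h) Δ k
  have hbo := hb.ennreal_ofReal
  have hmin : Measurable[(randomMeasureFiltration P).predictable] fun p => min (lc p) (lb p) :=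
    hC.measurable_lc.min hC.measurable_lb
  have hmax : Measurable[(randomMeasureFiltration P).predictable] fun p => max (lc p) (lb p) :=
    hC.measurable_lc.max hC.measurable_lb
  have hzero : Measurable[(randomMeasureFiltration P).predictable] fun _ : ℝ≥0 × Ω => (0 : ℝ) :=
    @measurable_const _ _ _ (randomMeasureFiltration P).predictable 0
  have hF1 := measurable_thinning_term hmG hbo (α := fun _ => 0) measurable_const hlc
  have hF2 := measurable_thinning_term hmK hbo (hmin.mono hle le_rfl) (hmax.mono hle le_rfl)
  have hpath := ofReal_gap_le hP hC hh hi hb hb0 hbi hψ hΔ hk hkM hs hsT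
  have hgapm := measurable_meanGap (μ := μ) hlc hlb
  calc _ ≤ ∫⁻ ω, L * ((∫⁻ x in box 0 T c, kernelGap h Δ k s x.1 * ENNReal.ofReal (b x.2.2) *
        (Ioc 0 (lc (x.1.toNNReal, ω))).indicator 1 x.2.1 ∂P ω) +
        ∫⁻ x in box 0 T c, gridKernel h Δ k x.1 * ENNReal.ofReal (b x.2.2) *
          (Ioc (min (lc (x.1.toNNReal, ω)) (lb (x.1.toNNReal, ω)))
            (max (lc (x.1.toNNReal, ω)) (lb (x.1.toNNReal, ω)))).indicator 1 x.2.1 ∂P ω) ∂μ :=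
        lintegral_mono_ae hpath
    _ = L * ((∫⁻ ω, ∫⁻ x in box 0 T c, kernelGap h Δ k s x.1 * ENNReal.ofReal (b x.2.2) *
        (Ioc 0 (lc (x.1.toNNReal, ω))).indicator 1 x.2.1 ∂P ω ∂μ) +
        ∫⁻ ω, ∫⁻ x in box 0 T c, gridKernel h Δ k x.1 * ENNReal.ofReal (b x.2.2) *
          (Ioc (min (lc (x.1.toNNReal, ω)) (lb (x.1.toNNReal, ω)))
            (max (lc (x.1.toNNReal, ω)) (lb (x.1.toNNReal, ω)))).indicator 1 x.2.1 ∂P ω ∂μ) := by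
        have hm1 := aemeasurable_lintegral_box hP T c hF1
        have hm2 := aemeasurable_lintegral_box hP T c hF2
        exact (lintegral_const_mul'' _ (hm1.add hm2)).trans (congrArg _ (lintegral_add_left' hm1 _))
    _ ≤ L * ((∫⁻ y, ENNReal.ofReal (b y) ∂ν) * (∫⁻ u in Ioc 0 T, kernelGap h Δ k s u *
          ∫⁻ ω, ENNReal.ofReal (lc (u.toNNReal, ω) - 0) ∂μ) +
        (∫⁻ y, ENNReal.ofReal (b y) ∂ν) * (∫⁻ u in Ioc 0 T, gridKernel h Δ k u *
          ∫⁻ ω, ENNReal.ofReal (max (lc (u.toNNReal, ω)) (lb (u.toNNReal, ω)) -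
            min (lc (u.toNNReal, ω)) (lb (u.toNNReal, ω))) ∂μ)) := by
        gcongr _ * (?_ + ?_)
        · exact lintegral_thinning_le_of_time hP T c hmG hbo hzero hC.measurable_lc
        · exact lintegral_thinning_le_of_time hP T c hmK hbo hmin hmax
    _ ≤ L * ((∫⁻ y, ENNReal.ofReal (b y) ∂ν) * (ENNReal.ofReal (kernelReg h T Δ) * A) +
        (∫⁻ y, ENNReal.ofReal (b y) ∂ν) * ∑ j ∈ Finset.Ico 1 k, ‖h (((k : ℝ) - j) * Δ)‖ₑ *
          ∫⁻ u in cell Δ j, meanGap μ lc lb u) := by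
        gcongr _ * (_ * ?_ + _ * ?_)
        · calc _ ≤ ∫⁻ u in Ioc 0 T, kernelGap h Δ k s u * A := by
                refine setLIntegral_mono' measurableSet_Ioc fun u hu => ?_
                gcongr
                simpa [meanIntensity] using hA u ⟨hu.1.le, hu.2⟩
            _ = (∫⁻ u in Ioc 0 T, kernelGap h Δ k s u) * A := lintegral_mul_const _ hmG
            _ ≤ _ := by
                gcongr
                exact (setLIntegral_le_lintegral _ _).trans
                  (lintegral_kernelGap_le hh hi hΔ hT hk hkM hs)
        · rw [← lintegral_gridKernel_mul _ hgapm]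
          refine (setLIntegral_le_lintegral _ _).trans (lintegral_mono fun u => ?_)
          simp_rw [max_sub_min_eq_abs, abs_sub_comm]
          exact le_rfl
    _ = _ := by rw [← mul_add]

/-- A convolution inequality solved in `ℓ¹`: after exchanging the sums, each column is bounded by
the discrete stability ratio, so the convolution is absorbed and no factor exponential in `T`
appears. -/
theorem sum_meanGap_le (hP : IsPoissonRandomMeasure μ P (poissonIntensity ν))
    (hC : Coupled μ P c T Δ M h ψ b R lc lb) (hh : Measurable h) (hi : IntegrableOn h (Icc 0 T))
    (hb : Measurable b) (hb0 : ∀ y, 0 ≤ b y) (hbi : ∫⁻ y, ENNReal.ofReal (b y) ∂ν ≠ ∞)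
    (hψ : LipschitzWith L ψ) (hΔ : 0 < Δ) (hT : T = M * Δ) {A : ℝ≥0∞}
    (hA : ∀ t ∈ Icc 0 T, meanIntensity μ lc t ≤ A) {ρ : ℝ} (hρ0 : 0 ≤ ρ) (hρ : ρ < 1)
    (hstab : L * (∫⁻ y, ENNReal.ofReal (b y) ∂ν) * (∑ j ∈ Finset.range (M - 1),
      ‖h ((j + 1 : ℝ) * Δ)‖ₑ * ENNReal.ofReal Δ) ≤ ENNReal.ofReal ρ) :
    ∑ k ∈ Finset.Icc 1 M, ∫⁻ s in cell Δ k, meanGap μ lc lb s ≤ ENNReal.ofReal (1 - ρ)⁻¹ *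
      (L * (∫⁻ y, ENNReal.ofReal (b y) ∂ν) * A * ENNReal.ofReal (T * kernelReg h T Δ)) := by
  set EB := ∫⁻ y, ENNReal.ofReal (b y) ∂ν
  set e : ℕ → ℝ≥0∞ := fun k => ∫⁻ s in cell Δ k, meanGap μ lc lb s with he
  have hvol : ∀ k, volume (cell Δ k) = ENNReal.ofReal Δ := fun k => by
    rw [cell, Real.volume_Ioc]; congr 1; ring
  have hfin : ∑ k ∈ Finset.Icc 1 M, e k ≠ ∞ := by
    refine (ENNReal.sum_lt_top.2 fun k _ => ?_).ne
    have : ∀ s, meanGap μ lc lb s ≤ ENNReal.ofReal c := fun s => by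
      calc _ ≤ ∫⁻ _, ENNReal.ofReal c ∂μ := by
            refine lintegral_mono fun ω => ENNReal.ofReal_le_ofReal (abs_le.2 ⟨?_, ?_⟩)
            · linarith [(hC.lc_mem (s.toNNReal, ω)).1, (hC.lb_mem (s.toNNReal, ω)).2]
            · linarith [(hC.lb_mem (s.toNNReal, ω)).1, (hC.lc_mem (s.toNNReal, ω)).2]
        _ = _ := by simp
    calc e k ≤ ∫⁻ _ in cell Δ k, ENNReal.ofReal c := lintegral_mono fun s => this s
      _ < ∞ := by rw [setLIntegral_const, hvol]; finiteness
  refine le_of_le_add_mul hfin hρ0 hρ ?_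
  have hek : ∀ k ∈ Finset.Icc 1 M, e k ≤ L * EB * A * (ENNReal.ofReal (kernelReg h T Δ)
      * ENNReal.ofReal Δ) + L * EB * ∑ j ∈ Finset.Icc 1 M,
        (if j < k then ‖h (((k : ℝ) - j) * Δ)‖ₑ * ENNReal.ofReal Δ else 0) * e j := by
    intro k hk
    have hk' := Finset.mem_Icc.1 hk
    have hsum : ∑ j ∈ Finset.Icc 1 M,
        (if j < k then ‖h (((k : ℝ) - j) * Δ)‖ₑ * ENNReal.ofReal Δ else 0) * e j =
        (∑ j ∈ Finset.Ico 1 k, ‖h (((k : ℝ) - j) * Δ)‖ₑ * e j) * ENNReal.ofReal Δ := by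
      rw [Finset.sum_mul]
      simp_rw [ite_mul, zero_mul]
      rw [← Finset.sum_filter]
      refine Finset.sum_congr ?_ fun j _ => by ring
      ext j
      simp only [Finset.mem_filter, Finset.mem_Icc, Finset.mem_Ico]
      omega
    rw [hsum]
    calc e k ≤ ∫⁻ _ in cell Δ k, L * (EB * (ENNReal.ofReal (kernelReg h T Δ) * A +
        ∑ j ∈ Finset.Ico 1 k, ‖h (((k : ℝ) - j) * Δ)‖ₑ * e j)) :=
          setLIntegral_mono' measurableSet_Ioc fun s hs =>
            meanGap_le hP hC hh hi hb hb0 hbi hψ hΔ hT hA hk'.1 hk'.2 hs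
      _ = _ := by rw [setLIntegral_const, hvol]; ring
  have hcol : ∀ j ∈ Finset.Icc 1 M, ∑ k ∈ Finset.Icc 1 M,
      (if j < k then ‖h (((k : ℝ) - j) * Δ)‖ₑ * ENNReal.ofReal Δ else 0) ≤
        ∑ j ∈ Finset.range (M - 1), ‖h ((j + 1 : ℝ) * Δ)‖ₑ * ENNReal.ofReal Δ := by
    intro j hj
    have hj' := Finset.mem_Icc.1 hj
    rw [← Finset.sum_filter]
    calc _ = ∑ i ∈ Finset.range (M - j), ‖h ((i + 1 : ℝ) * Δ)‖ₑ * ENNReal.ofReal Δ := by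
          -- The lag `k - j = i + 1` runs from `1` to `M - j`.
          refine Finset.sum_nbij' (fun k => k - j - 1) (fun i => i + j + 1) ?_ ?_ ?_ ?_ ?_
          · intro k hk
            simp only [Finset.mem_filter, Finset.mem_Icc, Finset.mem_range] at *; omega
          · intro k hk
            simp only [Finset.mem_filter, Finset.mem_Icc, Finset.mem_range] at *; omega
          · intro k hk
            simp only [Finset.mem_filter, Finset.mem_Icc] at *; omega
          · intro k hk; omega
          · intro k hk
            simp only [Finset.mem_filter, Finset.mem_Icc] at hk
            rw [Nat.cast_sub (by omega), Nat.cast_sub hk.2.le]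
            simp
      _ ≤ _ := Finset.sum_le_sum_of_subset (Finset.range_mono (by omega))
  have hΔT : ENNReal.ofReal T = M * ENNReal.ofReal Δ := by
    rw [hT, ENNReal.ofReal_mul (by positivity), ENNReal.ofReal_natCast]
  have hT0 : 0 ≤ T := by rw [hT]; positivity
  calc ∑ k ∈ Finset.Icc 1 M, e k ≤ ∑ k ∈ Finset.Icc 1 M, (L * EB * A *
        (ENNReal.ofReal (kernelReg h T Δ) * ENNReal.ofReal Δ) + L * EB * ∑ j ∈ Finset.Icc 1 M,
        (if j < k then ‖h (((k : ℝ) - j) * Δ)‖ₑ * ENNReal.ofReal Δ else 0) * e j) :=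
        Finset.sum_le_sum hek
    _ = L * EB * A * ENNReal.ofReal (T * kernelReg h T Δ) + L * EB * ∑ j ∈ Finset.Icc 1 M,
        (∑ k ∈ Finset.Icc 1 M,
          (if j < k then ‖h (((k : ℝ) - j) * Δ)‖ₑ * ENNReal.ofReal Δ else 0)) * e j := by
        rw [Finset.sum_add_distrib, ← Finset.mul_sum (Finset.Icc 1 M) _ (L * EB), Finset.sum_comm,
          ENNReal.ofReal_mul hT0, hΔT, Finset.sum_const, Nat.card_Icc, nsmul_eq_mul]
        simp_rw [Finset.sum_mul]
        congr 1
        simp only [Nat.add_sub_cancel]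
        ring
    _ ≤ L * EB * A * ENNReal.ofReal (T * kernelReg h T Δ) + L * EB * ∑ j ∈ Finset.Icc 1 M,
        (∑ j ∈ Finset.range (M - 1), ‖h ((j + 1 : ℝ) * Δ)‖ₑ * ENNReal.ofReal Δ) * e j := by
        gcongr with j hj
        exact hcol j hj
    _ = L * EB * A * ENNReal.ofReal (T * kernelReg h T Δ) + L * EB *
        (∑ j ∈ Finset.range (M - 1), ‖h ((j + 1 : ℝ) * Δ)‖ₑ * ENNReal.ofReal Δ) *
          ∑ j ∈ Finset.Icc 1 M, e j := by
        rw [← Finset.mul_sum]; ring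
    _ ≤ _ := by gcongr

end Difference

end Hawkes

namespace Hawkes

/-! ### Comparison of the two risks along one configuration of points -/

section Path

/-- The first atom of an integer-valued finite measure in `(u, v]`, or `v` if there is none. -/
lemma exists_first_atom {m : Measure ℝ} [IsFiniteMeasure m]
    (hm : ∀ B, MeasurableSet B → ∃ n : ℕ, m B = n) {u v : ℝ} (huv : u < v) :
    ∃ s ∈ Ioc u v, m (Ioo u s) = 0 ∧
      ∀ t ∈ Ioc s v, ∃ q : ℚ, u < q ∧ (q : ℝ) < t ∧ m (Ioc u q) ≠ 0 := by
  set S : Set ℝ := {s | s ∈ Ioc u v ∧ m (Ioc u s) ≠ 0} with hS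
  rcases S.eq_empty_or_nonempty with hSe | hSne
  · refine ⟨v, right_mem_Ioc.2 huv, ?_, fun t ht => absurd ht.1 (not_lt.2 ht.2)⟩
    by_contra h0
    have : v ∈ S := ⟨right_mem_Ioc.2 huv, fun h => h0 (measure_mono_null Ioo_subset_Ioc_self h)⟩
    rw [hSe] at this
    exact this
  have hbdd : BddBelow S := ⟨u, fun s hs => hs.1.1.le⟩
  -- The mass of `(u, u + 1 / (n + 1)]` tends to zero and is an integer, so it vanishes for large
  -- `n`: accepted times cannot accumulate at `u`.
  have hlow : u < sInf S := by
    have hanti : Antitone fun n : ℕ => Ioc u (u + 1 / ((n : ℝ) + 1)) := fun i j hij =>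
      Ioc_subset_Ioc_right (by gcongr)
    have hint : ⋂ n : ℕ, Ioc u (u + 1 / ((n : ℝ) + 1)) = ∅ := by
      refine eq_empty_of_forall_notMem fun t ht => ?_
      have ht' := mem_iInter.1 ht
      obtain ⟨n, hn⟩ := exists_nat_one_div_lt (sub_pos.2 (ht' 0).1)
      linarith [(ht' n).2]
    have hlim := tendsto_measure_iInter_atTop (μ := m) (s := fun n : ℕ => Ioc u (u + 1 / ((n : ℝ) + 1)))
      (fun n => measurableSet_Ioc.nullMeasurableSet) hanti ⟨0, measure_ne_top _ _⟩
    rw [hint, measure_empty] at hlim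
    obtain ⟨n, hn⟩ := (hlim.eventually (gt_mem_nhds one_pos)).exists
    have hn0 : m (Ioc u (u + 1 / ((n : ℝ) + 1))) = 0 := by
      obtain ⟨j, hj⟩ := hm _ (measurableSet_Ioc (a := u) (b := u + 1 / ((n : ℝ) + 1)))
      change m (Ioc u (u + 1 / ((n : ℝ) + 1))) < 1 at hn
      rw [hj] at hn ⊢
      have : j < 1 := by exact_mod_cast hn
      simp [Nat.lt_one_iff.1 this]
    have hpos : (0 : ℝ) < 1 / ((n : ℝ) + 1) := by positivity
    refine lt_of_lt_of_le (lt_add_of_pos_right u hpos) (le_csInf hSne fun s hs => ?_)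
    by_contra hlt
    exact hs.2 (measure_mono_null (Ioc_subset_Ioc_right (not_le.1 hlt).le) hn0)
  obtain ⟨s₀, hs₀⟩ := hSne
  have hsv : sInf S ≤ v := (csInf_le hbdd hs₀).trans hs₀.1.2
  refine ⟨sInf S, ⟨hlow, hsv⟩, ?_, fun t ht => ?_⟩
  · have hsub : Ioo u (sInf S) ⊆ ⋃ q : {q : ℚ // u < q ∧ (q : ℝ) < sInf S}, Ioc u (q : ℝ) := by
      intro t ht
      obtain ⟨q, hq1, hq2⟩ := exists_rat_btwn ht.2
      exact mem_iUnion.2 ⟨⟨q, ht.1.trans hq1, hq2⟩, ht.1, hq1.le⟩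
    refine measure_mono_null hsub (measure_iUnion_null fun q => ?_)
    by_contra h0
    exact absurd (csInf_le hbdd ⟨⟨q.2.1, q.2.2.le.trans hsv⟩, h0⟩) (not_le.2 q.2.2)
  · obtain ⟨s', hs', hlt⟩ := exists_lt_of_csInf_lt ⟨s₀, hs₀⟩ ht.1
    obtain ⟨q, hq1, hq2⟩ := exists_rat_btwn hlt
    exact ⟨q, hs'.1.1.trans hq1, hq2, fun h =>
      hs'.2 (measure_mono_null (Ioc_subset_Ioc_right hq1.le) h)⟩

variable {Q : Measure MarkSpace} {l l' : ℝ → ℝ} {Δ T : ℝ} {M : ℕ} {U : ℕ → Set ℝ}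

/-- The mass of the marks of the points on which the two thinnings may differ, where `V` contains
the times of the points attributed to different cells. -/
noncomputable def markGap (Q : Measure MarkSpace) (l l' : ℝ → ℝ) (V : Set ℝ) : ℝ≥0∞ :=
  ∫⁻ x, ‖x.2.2‖ₑ * (Ioc (min (l x.1) (l' x.1)) (max (l x.1) (l' x.1))).indicator 1 x.2.1 ∂Q
    + ∫⁻ x, V.indicator 1 x.1 * ‖x.2.2‖ₑ * (Ioc 0 (l x.1)).indicator 1 x.2.1 ∂Q

lemma measurable_thinned_mark (hl : Measurable l) {I : Set ℝ} (hI : MeasurableSet I) :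
    Measurable fun x : MarkSpace =>
      I.indicator (1 : ℝ → ℝ) x.1 * x.2.2 * (Ioc 0 (l x.1)).indicator 1 x.2.1 := by
  have hm : Measurable fun x : MarkSpace => x.2.1 := by fun_prop
  have hs : MeasurableSet {x : MarkSpace | 0 < x.2.1 ∧ x.2.1 ≤ l x.1} :=
    (measurableSet_lt measurable_const hm).inter (measurableSet_le hm (hl.comp measurable_fst))
  exact (((measurable_one.indicator hI).comp measurable_fst).mul (by fun_prop)).mul
    ((measurable_const (a := (1 : ℝ))).indicator hs)

lemma integrable_thinned_mark (hQ : ∫⁻ x, ‖x.2.2‖ₑ ∂Q < ∞) (hl : Measurable l) {I : Set ℝ}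
    (hI : MeasurableSet I) : Integrable (fun x : MarkSpace =>
      I.indicator (1 : ℝ → ℝ) x.1 * x.2.2 * (Ioc 0 (l x.1)).indicator 1 x.2.1) Q := by
  refine ⟨(measurable_thinned_mark hl hI).aestronglyMeasurable, ?_⟩
  rw [hasFiniteIntegral_iff_enorm]
  refine lt_of_le_of_lt (lintegral_mono fun x => ?_) hQ
  by_cases h1 : x.1 ∈ I <;> by_cases h2 : x.2.1 ∈ Ioc 0 (l x.1) <;> simp [h1, h2]

/-- A point accepted by both levels cancels unless exactly one of the windows contains it, which
forces its time into `V`. A point accepted by one level only has its own level between the two. -/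
lemma edist_thinned_le (hQ : ∫⁻ x, ‖x.2.2‖ₑ ∂Q < ∞) (hpos : ∀ᵐ x ∂Q, 0 < x.2.1)
    (hl : Measurable l) (hl' : Measurable l') {I J V : Set ℝ} (hI : MeasurableSet I)
    (hJ : MeasurableSet J)
    (hV : ∀ᵐ x ∂Q, x.2.1 ∈ Ioc 0 (l x.1) → (x.1 ∈ I ↔ x.1 ∈ J) ∨ x.1 ∈ V) :
    edist (∫ x, I.indicator 1 x.1 * x.2.2 * (Ioc 0 (l x.1)).indicator 1 x.2.1 ∂Q)
      (∫ x, J.indicator 1 x.1 * x.2.2 * (Ioc 0 (l' x.1)).indicator 1 x.2.1 ∂Q)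
      ≤ markGap Q l l' V := by
  rw [edist_eq_enorm_sub, ← integral_sub (integrable_thinned_mark hQ hl hI)
    (integrable_thinned_mark hQ hl' hJ)]
  refine (enorm_integral_le_lintegral_enorm _).trans ?_
  have hm : Measurable fun x : MarkSpace => x.2.1 := by fun_prop
  have hs : MeasurableSet {x : MarkSpace | min (l x.1) (l' x.1) < x.2.1 ∧
      x.2.1 ≤ max (l x.1) (l' x.1)} :=
    (measurableSet_lt ((hl.min hl').comp measurable_fst) hm).inter
      (measurableSet_le hm ((hl.max hl').comp measurable_fst))
  have hm1 : Measurable fun x : MarkSpace => ‖x.2.2‖ₑ *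
      (Ioc (min (l x.1) (l' x.1)) (max (l x.1) (l' x.1))).indicator (1 : ℝ → ℝ≥0∞) x.2.1 :=
    Measurable.mul (by fun_prop) ((measurable_const (a := (1 : ℝ≥0∞))).indicator hs)
  rw [markGap, ← lintegral_add_left hm1]
  refine lintegral_mono_ae ?_
  filter_upwards [hV, hpos] with x hx hp
  by_cases h1 : x.2.1 ≤ l x.1 <;> by_cases h2 : x.2.1 ≤ l' x.1
  · rcases hx ⟨hp, h1⟩ with hiff | hxV
    · by_cases h3 : x.1 ∈ J
      · simp [h1, h2, hp, h3, hiff.2 h3]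
      · simp [h1, h2, hp, h3, mt hiff.1 h3]
    · by_cases h3 : x.1 ∈ J <;> by_cases h4 : x.1 ∈ I <;> simp [h1, h2, hp, h3, h4, hxV]
  · have h5 : x.2.1 ∈ Ioc (min (l x.1) (l' x.1)) (max (l x.1) (l' x.1)) :=
      ⟨min_lt_of_right_lt (not_le.1 h2), le_max_of_le_left h1⟩
    rw [indicator_of_mem h5]
    refine le_add_right ?_
    by_cases h4 : x.1 ∈ I <;> simp [h1, h2, hp, h4]
  · have h5 : x.2.1 ∈ Ioc (min (l x.1) (l' x.1)) (max (l x.1) (l' x.1)) :=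
      ⟨min_lt_of_left_lt (not_le.1 h1), le_max_of_le_right h2⟩
    rw [indicator_of_mem h5]
    refine le_add_right ?_
    by_cases h4 : x.1 ∈ J <;> simp [h1, h2, hp, h4]
  · simp [h1, h2]

/-- For `t ∈ [s k, s (k + 1))`, the points counted in `(0, t]` and in `(0, k Δ]` differ by those of
`(t, k Δ]`, which come after `s k` in its cell, and those of `(k Δ, t]`, which come before `s (k +
1)`. The latter are not accepted unless `k + 1 = M`. -/
theorem skorokhodDist_le_markGap (hM : 1 ≤ M) (hΔ : 0 < Δ) (hT : T = M * Δ)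
    (hQ : ∫⁻ x, ‖x.2.2‖ₑ ∂Q < ∞) (hpos : ∀ᵐ x ∂Q, 0 < x.2.1) (hpos' : ∀ᵐ x ∂Q, 0 < x.1)
    (hint : ∀ B, MeasurableSet B → ∃ n : ℕ, Q B = n)
    (hl : Measurable l) (hl' : Measurable l') {f g : ℝ → ℝ}
    (hf : ∀ t ∈ Icc 0 T,
      f t = ∫ x, (Ioc 0 t).indicator 1 x.1 * x.2.2 * (Ioc 0 (l x.1)).indicator 1 x.2.1 ∂Q)
    (hg : ∀ n ≤ M, ∀ t ∈ Ico ((n : ℝ) * Δ) ((n + 1 : ℝ) * Δ), g t = ∑ k ∈ Finset.Icc 1 n,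
      ∫ x, (cell Δ k).indicator 1 x.1 * x.2.2 * (Ioc 0 (l' x.1)).indicator 1 x.2.1 ∂Q)
    (hU : ∀ k ∈ Finset.Ico 1 M, ∀ u ∈ cell Δ k, ∀ q : ℚ, ((k : ℝ) - 1) * Δ < q → q < u →
      Q {x | x.1 ∈ Ioc (((k : ℝ) - 1) * Δ) q ∧ x.2.1 ∈ Ioc 0 (l x.1)} ≠ 0 → u ∈ U k) :
    skorokhodDist T f g ≤ ENNReal.ofReal (2 * Δ)
      + markGap Q l l' ((⋃ k ∈ Finset.Ico 1 M, U k) ∪ cell Δ M) := by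
  set V := (⋃ k ∈ Finset.Ico 1 M, U k) ∪ cell Δ M with hVdef
  have hm : Measurable fun x : MarkSpace => x.2.1 := by fun_prop
  set D : Set MarkSpace := {x | x.2.1 ∈ Ioc 0 (l x.1)} with hD
  have hDm : MeasurableSet D :=
    (measurableSet_lt measurable_const hm).inter (measurableSet_le hm (hl.comp measurable_fst))
  set m : Measure ℝ := (Q.restrict D).map Prod.fst with hmdef
  have hmB : ∀ B, MeasurableSet B → m B = Q {x | x.1 ∈ B ∧ x.2.1 ∈ Ioc 0 (l x.1)} := fun B hB => by
    rw [hmdef, Measure.map_apply measurable_fst hB, Measure.restrict_apply (measurable_fst hB)]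
    rfl
  have hmint : ∀ B, MeasurableSet B → ∃ n : ℕ, m B = n := fun B hB => by
    rw [hmB B hB]
    exact hint _ ((measurable_fst hB).inter hDm)
  have hmfin : IsFiniteMeasure m := ⟨by
    obtain ⟨n, hn⟩ := hmint univ MeasurableSet.univ
    rw [hn]; exact ENNReal.natCast_lt_top n⟩
  choose s₀ hs₀ hs₀' hs₀'' using fun k : ℕ => exists_first_atom hmint
    (show ((k : ℝ) - 1) * Δ < k * Δ by nlinarith)
  -- The last node has to be `T`, since time changes fix `T`; accordingly the whole last cell is
  -- exceptional.
  set s : ℕ → ℝ := fun k => if k = 0 then 0 else if k < M then s₀ k else T with hs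
  have hs_mid : ∀ k, 1 ≤ k → k < M → s k = s₀ k := fun k h1 h2 => by
    simp only [hs]; rw [if_neg (by omega), if_pos h2]
  have hsM : s M = T := by simp only [hs]; rw [if_neg (by omega), if_neg (by omega)]
  have hs0 : s 0 = 0 := by simp [hs]
  have hTmem : T ∈ cell Δ M := ⟨by rw [hT]; nlinarith, hT.le⟩
  have hscell : ∀ k, 1 ≤ k → k ≤ M → s k ∈ cell Δ k := fun k h1 h2 => by
    rcases h2.lt_or_eq with h3 | rfl
    · rw [hs_mid k h1 h3]; exact hs₀ k
    · rw [hsM]; exact hTmem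
  have hgood : ∀ᵐ x ∂Q, x.2.1 ∈ Ioc 0 (l x.1) → ∀ k, 1 ≤ k → k < M →
      x.1 ∉ Ioo (((k : ℝ) - 1) * Δ) (s k) := by
    have : ∀ᵐ x ∂Q, ∀ k : ℕ, ¬ (x.1 ∈ Ioo (((k : ℝ) - 1) * Δ) (s₀ k) ∧ x.2.1 ∈ Ioc 0 (l x.1)) := by
      refine ae_all_iff.2 fun k => ?_
      have := hs₀' k
      rw [hmB _ measurableSet_Ioo] at this
      rw [ae_iff]
      simpa [and_assoc] using this
    filter_upwards [this] with x hx hθ k h1 h2 hmem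
    rw [hs_mid k h1 h2] at hmem
    exact hx k ⟨hmem, hθ⟩
  have hafter : ∀ k, 1 ≤ k → k < M → Ioc (s k) (k * Δ) ⊆ U k := fun k h1 h2 u hu => by
    rw [hs_mid k h1 h2] at hu
    obtain ⟨q, hq1, hq2, hq3⟩ := hs₀'' k u hu
    rw [hmB _ measurableSet_Ioc] at hq3
    exact hU k (Finset.mem_Ico.2 ⟨h1, h2⟩) u ⟨(hs₀ k).1.trans hu.1, hu.2⟩ q hq1 hq2 hq3
  have hgsum : ∀ n ≤ M, ∀ t ∈ Ico ((n : ℝ) * Δ) ((n + 1 : ℝ) * Δ), g t =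
      ∫ x, (Ioc 0 (n * Δ)).indicator 1 x.1 * x.2.2 * (Ioc 0 (l' x.1)).indicator 1 x.2.1 ∂Q := by
    intro n hn t ht
    rw [hg n hn t ht, ← integral_finsetSum _ fun k _ =>
      integrable_thinned_mark hQ hl' measurableSet_Ioc]
    refine integral_congr_ae (Eventually.of_forall fun x => ?_)
    have := sum_indicator_cell hΔ (1 : ℝ → ℝ) x.1 (k := n + 1) (by omega)
    simp only
    rw [← Finset.sum_mul, ← Finset.sum_mul]
    push_cast at this
    rw [add_sub_cancel_right] at this
    rw [← this]
    congr
  refine skorokhodDist_le_of_grid hΔ hM hT hs0 hsM hscell ?_ ?_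
  · intro k hk t ht t' ht'
    have hkM : ((k : ℝ) + 1) * Δ ≤ T := by
      rw [hT]; gcongr; exact_mod_cast hk
    have hsk : 0 ≤ s k := by
      rcases Nat.eq_zero_or_pos k with rfl | h1
      · exact hs0.ge
      · have := (hscell k h1 hk.le).1
        have h2 : (1 : ℝ) ≤ k := by exact_mod_cast h1
        nlinarith
    have hsk1 := hscell (k + 1) (by omega) hk
    have htT : t ∈ Icc 0 T := by
      refine ⟨hsk.trans ht.1, ht.2.le.trans (hsk1.2.trans ?_)⟩
      push_cast; exact hkM
    rw [hf t htT, hgsum k hk.le t' ht']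
    refine edist_thinned_le hQ hpos hl hl' measurableSet_Ioc measurableSet_Ioc ?_
    filter_upwards [hgood, hpos'] with x hx hx0 hθ
    by_cases h1 : x.1 ≤ t <;> by_cases h2 : x.1 ≤ k * Δ
    · left; simp [h1, h2, hx0]
    · right
      rw [not_le] at h2
      rcases (Nat.succ_le_of_lt hk).lt_or_eq with h3 | h3
      · refine absurd ?_ (hx hθ (k + 1) (by omega) h3)
        push_cast
        exact ⟨by simpa using h2, h1.trans_lt ht.2⟩
      · refine Or.inr ?_
        rw [← h3]
        refine ⟨by push_cast; simpa using h2, ?_⟩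
        exact (h1.trans_lt ht.2).le.trans hsk1.2
    · right
      rw [not_le] at h1
      have hk1 : 1 ≤ k := by
        by_contra h0
        have : k = 0 := by omega
        subst this
        simp at h2
        linarith
      refine Or.inl (mem_iUnion₂.2 ⟨k, Finset.mem_Ico.2 ⟨hk1, hk⟩, ?_⟩)
      exact hafter k hk1 hk ⟨ht.1.trans_lt h1, h2⟩
    · left; simp [h1, h2]
  · have hT0 : 0 ≤ T := by rw [hT]; positivity
    rw [hf T ⟨hT0, le_rfl⟩, hgsum M le_rfl T ⟨hT.ge, by rw [hT]; nlinarith⟩]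
    refine edist_thinned_le hQ hpos hl hl' measurableSet_Ioc measurableSet_Ioc ?_
    exact Eventually.of_forall fun x _ => Or.inl (by rw [hT])

end Path

end Hawkes

namespace Hawkes

variable {Ω : Type*} [mΩ : MeasurableSpace Ω]

/-! ### The mean Skorokhod distance in terms of the intensities -/

section Mean

variable {ν : Measure ℝ} [IsProbabilityMeasure ν] {μ : Measure Ω}
  {P : Kernel Ω MarkSpace} {h ψ b : ℝ → ℝ} {c T Δ : ℝ} {M : ℕ} {R : ℝ → Ω → ℝ}
  {lc lb : ℝ≥0 × Ω → ℝ}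

lemma measurableSet_accepted {l : ℝ → ℝ} (hl : Measurable l) {I : Set ℝ} (hI : MeasurableSet I) :
    MeasurableSet {x : MarkSpace | x.1 ∈ I ∧ x.2.1 ∈ Ioc 0 (l x.1)} := by
  have hm : Measurable fun x : MarkSpace => x.2.1 := by fun_prop
  exact (measurable_fst hI).inter
    ((measurableSet_lt measurable_const hm).inter (measurableSet_le hm (hl.comp measurable_fst)))

/-- Accepted points up to `v` involve `lc` only up to `v`, so stopping it there makes the integrand
measurable for the past of `v` without changing the count. -/
lemma exists_adapted_count (hP : IsPoissonRandomMeasure μ P (poissonIntensity ν))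
    (hlc : Measurable[(randomMeasureFiltration P).predictable] lc) (c : ℝ) {u v : ℝ}
    (hv : 0 ≤ v) (hvT : v ≤ T) :
    ∃ N : Ω → ℝ≥0∞, Measurable[randomMeasureFiltration P v.toNNReal] N ∧ N =ᵐ[μ] fun ω =>
      (P ω).restrict (box 0 T c)
        {x | x.1 ∈ Ioc u v ∧ x.2.1 ∈ Ioc 0 (lc (x.1.toNNReal, ω))} := by
  have hφ : Measurable fun x : MarkSpace => (Ioc u v).indicator (1 : ℝ → ℝ≥0∞) x.1 :=
    (measurable_one.indicator measurableSet_Ioc).comp measurable_fst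
  obtain ⟨N, hN, hNeq⟩ := exists_adapted_lintegral hP v.toNNReal c hφ
    (measurable_stopped hlc v.toNNReal)
  refine ⟨N, hN, hNeq.trans (Eventually.of_forall fun ω => ?_)⟩
  have hlcω : Measurable fun s : ℝ => lc (s.toNNReal, ω) :=
    (hlc.mono (predictable_le _) le_rfl).comp (by fun_prop)
  have hS := measurableSet_accepted hlcω (measurableSet_Ioc (a := u) (b := v))
  set S : Set MarkSpace := {x | x.1 ∈ Ioc u v ∧ x.2.1 ∈ Ioc 0 (lc (x.1.toNNReal, ω))}
  have hSmem : ∀ x, x ∈ S ↔ x.1 ∈ Ioc u v ∧ x.2.1 ∈ Ioc 0 (lc (x.1.toNNReal, ω)) := fun x => Iff.rfl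
  simp only
  rw [Measure.restrict_apply hS, ← lintegral_indicator_one (hS.inter (measurableSet_box 0 T c)),
    ← lintegral_indicator (measurableSet_box _ _ _), Real.coe_toNNReal _ hv]
  refine lintegral_congr fun x => ?_
  by_cases h1 : x.1 ∈ Ioc u v
  · have h2 : min x.1.toNNReal v.toNNReal = x.1.toNNReal :=
      min_eq_left (Real.toNNReal_le_toNNReal h1.2)
    have h3 : x ∈ box 0 v c ↔ x ∈ box 0 T c :=
      ⟨fun hx => ⟨⟨hx.1.1, hx.1.2.trans hvT⟩, hx.2⟩, fun hx => ⟨⟨hx.1.1, h1.2⟩, hx.2⟩⟩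
    by_cases h4 : x ∈ box 0 T c
    · by_cases h5 : x.2.1 ∈ Ioc 0 (lc (x.1.toNNReal, ω))
      · rw [indicator_of_mem (h3.2 h4), indicator_of_mem (mem_inter ((hSmem x).2 ⟨h1, h5⟩) h4), h2,
          indicator_of_mem h1, indicator_of_mem h5]
        simp
      · have h6 : x ∉ S ∩ box 0 T c := fun hx => h5 ((hSmem x).1 hx.1).2
        rw [indicator_of_mem (h3.2 h4), indicator_of_notMem h6, h2,
          indicator_of_notMem h5, mul_zero]
    · rw [indicator_of_notMem (mt h3.1 h4), indicator_of_notMem (fun hx => h4 hx.2)]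
  · have h2 : x ∉ S ∩ box 0 T c := fun hx => h1 ((hSmem x).1 hx.1).1
    rw [indicator_of_notMem h2]
    by_cases h4 : x ∈ box 0 v c
    · rw [indicator_of_mem h4, indicator_of_notMem h1, zero_mul]
    · rw [indicator_of_notMem h4]

lemma lintegral_thinned_one {Q : Measure MarkSpace} {l : ℝ → ℝ} (hl : Measurable l) {I : Set ℝ}
    (hI : MeasurableSet I) :
    ∫⁻ x, I.indicator 1 x.1 * 1 * (Ioc 0 (l x.1)).indicator 1 x.2.1 ∂Q =
      Q {x | x.1 ∈ I ∧ x.2.1 ∈ Ioc 0 (l x.1)} := by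
  rw [← lintegral_indicator_one (measurableSet_accepted hl hI)]
  refine lintegral_congr fun x => ?_
  by_cases h1 : x.1 ∈ I
  · by_cases h2 : x.2.1 ∈ Ioc 0 (l x.1)
    · rw [indicator_of_mem h1, indicator_of_mem h2, indicator_of_mem (mem_ofPred_eq ▸ ⟨h1, h2⟩)]
      simp
    · rw [indicator_of_notMem h2, mul_zero, indicator_of_notMem fun hx => h2 hx.2]
  · rw [indicator_of_notMem h1, zero_mul, zero_mul, indicator_of_notMem fun hx => h1 hx.1]

variable [IsProbabilityMeasure μ]

/-- A predictable set of times of a cell containing all times that follow an accepted point of this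
cell. -/
lemma exists_predictable_after (hP : IsPoissonRandomMeasure μ P (poissonIntensity ν))
    (hlc : Measurable[(randomMeasureFiltration P).predictable] lc) (c : ℝ) (hΔ : 0 < Δ)
    (hT : T = M * Δ) {k : ℕ} (hk : 1 ≤ k) (hkM : k ≤ M) :
    ∃ V : Set (ℝ≥0 × Ω), MeasurableSet[(randomMeasureFiltration P).predictable] V ∧
      (∀ p ∈ V, (p.1 : ℝ) ∈ cell Δ k) ∧
      (∀ᵐ ω ∂μ, ∀ s ∈ cell Δ k, ∀ q : ℚ, ((k : ℝ) - 1) * Δ < q → q < s →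
        (P ω).restrict (box 0 T c) {x | x.1 ∈ Ioc (((k : ℝ) - 1) * Δ) q ∧
          x.2.1 ∈ Ioc 0 (lc (x.1.toNNReal, ω))} ≠ 0 → (s.toNNReal, ω) ∈ V) ∧
      ∀ s, μ {ω | (s, ω) ∈ V} ≤ ∫⁻ u in cell Δ k, meanIntensity μ lc u := by
  set 𝓕 := randomMeasureFiltration P
  have hle := predictable_le 𝓕
  have hk1 : (1 : ℝ) ≤ k := by exact_mod_cast hk
  have hkT : k * Δ ≤ T := by rw [hT]; gcongr
  have hu : 0 ≤ ((k : ℝ) - 1) * Δ := mul_nonneg (by linarith) hΔ.le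
  set u := ((k : ℝ) - 1) * Δ with hudef
  have hN : ∀ q : ℚ, ∃ N : Ω → ℝ≥0∞, Measurable[𝓕 (q : ℝ).toNNReal] N ∧ (u < q → (q : ℝ) < k * Δ →
      N =ᵐ[μ] fun ω => (P ω).restrict (box 0 T c)
        {x | x.1 ∈ Ioc u q ∧ x.2.1 ∈ Ioc 0 (lc (x.1.toNNReal, ω))}) := fun q => by
    by_cases hq : u < q ∧ (q : ℝ) < k * Δ
    · obtain ⟨N, h1, h2⟩ := exists_adapted_count hP hlc c (hu.trans hq.1.le)
        (hq.2.le.trans hkT)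
      exact ⟨N, h1, fun _ _ => h2⟩
    · exact ⟨fun _ => 0, @measurable_const _ _ _ (𝓕 (q : ℝ).toNNReal) 0,
        fun h1 h2 => absurd ⟨h1, h2⟩ hq⟩
  choose N hNm hNeq using hN
  have hNall : ∀ᵐ ω ∂μ, ∀ q : ℚ, u < q → (q : ℝ) < k * Δ → N q ω = (P ω).restrict (box 0 T c)
      {x | x.1 ∈ Ioc u q ∧ x.2.1 ∈ Ioc 0 (lc (x.1.toNNReal, ω))} := by
    refine ae_all_iff.2 fun q => ?_
    by_cases hq : u < q ∧ (q : ℝ) < k * Δ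
    · filter_upwards [hNeq q hq.1 hq.2] with ω hω _ _ using hω
    · exact Eventually.of_forall fun ω h1 h2 => absurd ⟨h1, h2⟩ hq
  -- Rational times make `V` a countable union of predictable rectangles `(q, ∞) × {N q ≠ 0}`, cut
  -- by a deterministic set of times.
  set V : Set (ℝ≥0 × Ω) := (Prod.fst ⁻¹' {s : ℝ≥0 | (s : ℝ) ∈ cell Δ k}) ∩
    ⋃ q : {q : ℚ // u < q}, Ioi (q : ℝ).toNNReal ×ˢ {ω | N q ω ≠ 0} with hV
  have hVmem : ∀ s ω, (s, ω) ∈ V ↔ (s : ℝ) ∈ cell Δ k ∧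
      ∃ q : ℚ, u < q ∧ (q : ℝ) < s ∧ N q ω ≠ 0 := fun s ω => by
    simp only [hV, mem_inter_iff, mem_preimage, mem_ofPred_eq, mem_iUnion, mem_prod, mem_Ioi,
      Subtype.exists, exists_prop]
    refine and_congr_right fun _ => exists_congr fun q => and_congr_right fun hq => ?_
    rw [Real.toNNReal_lt_iff_lt_coe (hu.trans hq.le)]
  have hVm : MeasurableSet[𝓕.predictable] V := by
    refine MeasurableSet.inter (measurable_predictable_fst 𝓕
      (measurable_coe_nnreal_real measurableSet_Ioc)) (MeasurableSet.iUnion fun q => ?_)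
    exact measurableSet_predictable_Ioi_prod
      (hNm q (measurableSet_singleton (0 : ℝ≥0∞)).compl)
  refine ⟨V, hVm, fun p hp => hp.1, ?_, fun s => ?_⟩
  · filter_upwards [hNall] with ω hω s hs q hq hqs hne
    have hs0 : 0 ≤ s := hu.trans hs.1.le
    rw [hVmem, Real.coe_toNNReal _ hs0]
    exact ⟨hs, q, hq, hqs, by rwa [hω q hq (hqs.trans_le hs.2)]⟩
  · have hlc0 := hlc.mono hle le_rfl
    have hsec : MeasurableSet {ω | (s, ω) ∈ V} := measurable_prodMk_left (hle _ hVm)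
    have hfull := ae_forall_exists_nat hP (measurableSet_box 0 T c) (intensity_box_ne_top le_rfl T c)
    -- A non-zero integer is at least `1`, so the indicator is below the number of accepted points
    -- of the cell, whose mean the compensation formula gives.
    have hone : ∀ᵐ ω ∂μ, {ω | (s, ω) ∈ V}.indicator (1 : Ω → ℝ≥0∞) ω ≤
        ∫⁻ x in box 0 T c, (cell Δ k).indicator 1 x.1 * 1 *
          (Ioc 0 (lc (x.1.toNNReal, ω))).indicator 1 x.2.1 ∂P ω := by
      filter_upwards [hNall, hfull] with ω h1 h2
      by_cases hs : (s, ω) ∈ V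
      swap
      · rw [indicator_of_notMem (by simpa using hs)]; exact zero_le
      have hlcω : Measurable fun s : ℝ => lc (s.toNNReal, ω) := hlc0.comp (by fun_prop)
      rw [indicator_of_mem (by simpa using hs), lintegral_thinned_one hlcω measurableSet_Ioc]
      obtain ⟨hsc, q, hq, hqs, hne⟩ := (hVmem s ω).1 hs
      rw [h1 q hq (hqs.trans_le hsc.2)] at hne
      have hS := measurableSet_accepted hlcω (measurableSet_Ioc (a := u) (b := k * Δ))
      obtain ⟨n, hn⟩ := h2 _ hS
      rw [Measure.restrict_apply hS, hn]
      have hn0 : n ≠ 0 := by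
        rintro rfl
        refine hne (measure_mono_null (t := {x : MarkSpace | x.1 ∈ Ioc u (k * Δ) ∧
          x.2.1 ∈ Ioc 0 (lc (x.1.toNNReal, ω))}) (fun x hx => ?_) ?_)
        · exact ⟨⟨hx.1.1, hx.1.2.trans (hqs.le.trans hsc.2)⟩, hx.2⟩
        · rw [Measure.restrict_apply hS, hn]; simp
      simpa using Nat.one_le_iff_ne_zero.2 hn0
    calc μ {ω | (s, ω) ∈ V} = ∫⁻ ω, {ω | (s, ω) ∈ V}.indicator 1 ω ∂μ :=
          (lintegral_indicator_one hsec).symm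
      _ ≤ _ := lintegral_mono_ae hone
      _ ≤ _ := lintegral_thinning_le_of_time hP T c
          (measurable_one.indicator measurableSet_Ioc) (w := fun _ => 1) measurable_const
          (α := fun _ => 0) (@measurable_const _ _ _ 𝓕.predictable 0) hlc
      _ ≤ ∫⁻ v, (cell Δ k).indicator 1 v * meanIntensity μ lc v := by
          simp only [lintegral_const, measure_univ, mul_one, one_mul, sub_zero]
          exact setLIntegral_le_lintegral _ _
      _ = ∫⁻ v in cell Δ k, meanIntensity μ lc v := by
          rw [← lintegral_indicator measurableSet_Ioc]
          refine lintegral_congr fun v => ?_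
          by_cases hv : v ∈ cell Δ k <;> simp [hv]

/-- The exceptional times form a predictable set `W`. At a given time, outside the last cell, the
thinning by `W` is bounded by `c` times the probability of an earlier accepted point in the cell; in
the last cell the mean intensity is simply added. -/
theorem lintegral_skorokhodDist_le (hP : IsPoissonRandomMeasure μ P (poissonIntensity ν))
    (hC : Coupled μ P c T Δ M h ψ b R lc lb) (hν : ∫⁻ y, ‖y‖ₑ ∂ν ≠ ∞) (hM : 1 ≤ M) (hΔ : 0 < Δ)
    (hT : T = M * Δ) {A : ℝ≥0∞} (hA : ∀ t ∈ Icc 0 T, meanIntensity μ lc t ≤ A) :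
    ∫⁻ ω, skorokhodDist T (fun t => R t ω) (fun t => discreteRisk (P ω) h ψ b Δ t) ∂μ ≤
      ENNReal.ofReal (2 * Δ) + ((∫⁻ y, ‖y‖ₑ ∂ν) * (∑ k ∈ Finset.Icc 1 M, ∫⁻ s in cell Δ k,
        meanGap μ lc lb s) + (∫⁻ y, ‖y‖ₑ ∂ν) * (ENNReal.ofReal c * (ENNReal.ofReal Δ * A) *
          ENNReal.ofReal T + A * ENNReal.ofReal Δ)) := by
  set 𝓕 := randomMeasureFiltration P
  have hle := predictable_le 𝓕
  have hlc := hC.measurable_lc.mono hle le_rfl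
  have hlb := hC.measurable_lb.mono hle le_rfl
  have hvol : ∀ k, volume (cell Δ k) = ENNReal.ofReal Δ := fun k => by
    rw [cell, Real.volume_Ioc]; congr 1; ring
  have hcellT : ∀ k : ℕ, 1 ≤ k → k ≤ M → cell Δ k ⊆ Icc 0 T := fun k h1 h2 s hs => by
    have hk1 : (1 : ℝ) ≤ k := by exact_mod_cast h1
    refine ⟨(mul_nonneg (by linarith) hΔ.le).trans hs.1.le, hs.2.trans ?_⟩
    rw [hT]; gcongr
  have hV : ∀ k : ℕ, ∃ V : Set (ℝ≥0 × Ω), MeasurableSet[𝓕.predictable] V ∧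
      (k ∈ Finset.Ico 1 M → (∀ p ∈ V, (p.1 : ℝ) ∈ cell Δ k) ∧
      (∀ᵐ ω ∂μ, ∀ s ∈ cell Δ k, ∀ q : ℚ, ((k : ℝ) - 1) * Δ < q → q < s →
        (P ω).restrict (box 0 T c) {x | x.1 ∈ Ioc (((k : ℝ) - 1) * Δ) q ∧
          x.2.1 ∈ Ioc 0 (lc (x.1.toNNReal, ω))} ≠ 0 → (s.toNNReal, ω) ∈ V) ∧
      ∀ s, μ {ω | (s, ω) ∈ V} ≤ ENNReal.ofReal Δ * A) := fun k => by
    by_cases hk : k ∈ Finset.Ico 1 M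
    · have hk' := Finset.mem_Ico.1 hk
      obtain ⟨V, h1, h2, h3, h4⟩ := exists_predictable_after hP hC.measurable_lc c hΔ hT hk'.1
        hk'.2.le
      refine ⟨V, h1, fun _ => ⟨h2, h3, fun s => (h4 s).trans ?_⟩⟩
      calc _ ≤ ∫⁻ _ in cell Δ k, A := setLIntegral_mono' measurableSet_Ioc fun s hs =>
            hA s (hcellT k hk'.1 hk'.2.le hs)
        _ = _ := by rw [setLIntegral_const, hvol, mul_comm]
    · exact ⟨∅, @MeasurableSet.empty _ 𝓕.predictable, fun h => absurd h hk⟩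
  choose V hVm hVp using hV
  set W : Set (ℝ≥0 × Ω) := (⋃ k ∈ Finset.Ico 1 M, V k) ∪
    Prod.fst ⁻¹' {s : ℝ≥0 | (s : ℝ) ∈ cell Δ M} with hW
  have hWm : MeasurableSet[𝓕.predictable] W := by
    refine @MeasurableSet.union _ 𝓕.predictable _ _
      (@MeasurableSet.biUnion _ _ 𝓕.predictable _ _ (Finset.countable_toSet _) fun k _ => hVm k) ?_
    exact measurable_predictable_fst 𝓕 (measurable_coe_nnreal_real measurableSet_Ioc)
  have hone : Measurable[𝓕.predictable] (1 : ℝ≥0 × Ω → ℝ≥0∞) :=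
    @measurable_const _ _ _ 𝓕.predictable (1 : ℝ≥0∞)
  have hGm : Measurable[𝓕.predictable] (W.indicator (1 : ℝ≥0 × Ω → ℝ≥0∞)) :=
    @Measurable.indicator _ _ _ _ 𝓕.predictable _ _ hone hWm
  have hne : Measurable fun y : ℝ => ‖y‖ₑ := measurable_enorm
  have hmin : Measurable[𝓕.predictable] fun p => min (lc p) (lb p) :=
    hC.measurable_lc.min hC.measurable_lb
  have hmax : Measurable[𝓕.predictable] fun p => max (lc p) (lb p) :=
    hC.measurable_lc.max hC.measurable_lb
  have hpath : ∀ᵐ ω ∂μ, skorokhodDist T (fun t => R t ω)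
      (fun t => discreteRisk (P ω) h ψ b Δ t) ≤ ENNReal.ofReal (2 * Δ) +
        ((∫⁻ x in box 0 T c, 1 * ‖x.2.2‖ₑ *
          (Ioc (min (lc (x.1.toNNReal, ω)) (lb (x.1.toNNReal, ω)))
            (max (lc (x.1.toNNReal, ω)) (lb (x.1.toNNReal, ω)))).indicator 1 x.2.1 ∂P ω) +
        ∫⁻ x in box 0 T c, W.indicator 1 (x.1.toNNReal, ω) * ‖x.2.2‖ₑ *
          (Ioc 0 (lc (x.1.toNNReal, ω))).indicator 1 x.2.1 ∂P ω) := by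
    have hVall : ∀ᵐ ω ∂μ, ∀ k ∈ Finset.Ico 1 M, ∀ s ∈ cell Δ k, ∀ q : ℚ,
        ((k : ℝ) - 1) * Δ < q → q < s → (P ω).restrict (box 0 T c)
          {x | x.1 ∈ Ioc (((k : ℝ) - 1) * Δ) q ∧
            x.2.1 ∈ Ioc 0 (lc (x.1.toNNReal, ω))} ≠ 0 → (s.toNNReal, ω) ∈ V k :=
      (Finset.eventually_all _).2 fun k hk => (hVp k hk).2.1
    filter_upwards [hC.risk_eq, hC.discreteRisk_eq, hVall,
      ae_forall_exists_nat hP (measurableSet_box 0 T c) (intensity_box_ne_top le_rfl T c),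
      ae_lintegral_box_lt_top hP T c (φ := fun _ => 1) measurable_const hne (by simp) hν]
      with ω h1 h2 h3 h4 h5
    have hlcω : Measurable fun u : ℝ => lc (u.toNNReal, ω) := hlc.comp (by fun_prop)
    have hlbω : Measurable fun u : ℝ => lb (u.toNNReal, ω) := hlb.comp (by fun_prop)
    simp only [one_mul] at h5
    have hbox := ae_restrict_mem (μ := P ω) (measurableSet_box 0 T c)
    refine (skorokhodDist_le_markGap (U := fun k => {s | (s.toNNReal, ω) ∈ V k}) hM hΔ hT h5
      (hbox.mono fun x hx => hx.2.1.1) (hbox.mono fun x hx => hx.1.1)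
      (fun B hB => ?_) hlcω hlbω h1 h2 h3).trans ?_
    · rw [Measure.restrict_apply hB]; exact h4 B hB
    · refine add_le_add le_rfl (add_le_add (le_of_eq (by simp only [one_mul])) ?_)
      refine setLIntegral_mono' (measurableSet_box 0 T c) fun x hx => ?_
      gcongr ?_ * _ * _
      by_cases hxW : (x.1.toNNReal, ω) ∈ W
      · rw [indicator_of_mem hxW]
        exact indicator_le_self' (fun _ _ => zero_le) _
      · rw [indicator_of_notMem]
        · exact zero_le
        rintro (hx' | hx')
        · obtain ⟨k, hk, hxk⟩ := mem_iUnion₂.1 hx'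
          exact hxW (Or.inl (mem_iUnion₂.2 ⟨k, hk, hxk⟩))
        · refine hxW (Or.inr ?_)
          change ((x.1.toNNReal : ℝ≥0) : ℝ) ∈ cell Δ M
          rwa [Real.coe_toNNReal _ hx.1.1.le]
  have hsec : ∀ s : ℝ≥0, s ≤ T.toNNReal → ∫⁻ ω, W.indicator 1 (s, ω) *
      ENNReal.ofReal (lc (s, ω) - 0) ∂μ ≤ ENNReal.ofReal c * (ENNReal.ofReal Δ * A) +
        (cell Δ M).indicator 1 (s : ℝ) * A := by
    intro s hs
    have hsT : (s : ℝ) ∈ Icc 0 T := ⟨s.2, by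
      have hT0 : 0 ≤ T := by rw [hT]; positivity
      have := NNReal.coe_le_coe.2 hs
      rwa [Real.coe_toNNReal _ hT0] at this⟩
    have hlcs : Measurable fun ω => ENNReal.ofReal (lc (s, ω)) :=
      (hlc.comp measurable_prodMk_left).ennreal_ofReal
    set Z : Set Ω := ⋃ k ∈ Finset.Ico 1 M, {ω | (s, ω) ∈ V k} with hZ
    have hZm : MeasurableSet Z := MeasurableSet.iUnion fun k => MeasurableSet.iUnion fun _ =>
      measurable_prodMk_left (hle _ (hVm k))
    -- The cells are disjoint, so at most one of the `V k` has a section at time `s`, and no union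
    -- bound over `k` is paid.
    have hμZ : μ Z ≤ ENNReal.ofReal Δ * A := by
      by_cases hk : ∃ k ∈ Finset.Ico 1 M, (s : ℝ) ∈ cell Δ k
      · obtain ⟨k, hk, hsk⟩ := hk
        refine (measure_mono fun ω hω => ?_).trans ((hVp k hk).2.2 s)
        obtain ⟨j, hj, hωj⟩ := mem_iUnion₂.1 hω
        have hsj := (hVp j hj).1 _ hωj
        have : j = k := by
          by_contra hjk
          exact Set.disjoint_left.1 (disjoint_cell hΔ hjk) hsj hsk
        exact this ▸ hωj
      · have : Z = ∅ := eq_empty_of_forall_notMem fun ω hω => by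
          obtain ⟨j, hj, hωj⟩ := mem_iUnion₂.1 hω
          exact hk ⟨j, hj, (hVp j hj).1 _ hωj⟩
        rw [this, measure_empty]
        exact zero_le
    calc _ ≤ ∫⁻ ω, (ENNReal.ofReal c * Z.indicator 1 ω + (cell Δ M).indicator 1 (s : ℝ) *
          ENNReal.ofReal (lc (s, ω))) ∂μ := by
          refine lintegral_mono fun ω => ?_
          rw [sub_zero]
          by_cases h1 : ω ∈ Z
          · rw [indicator_of_mem h1]
            refine le_add_right ?_
            rw [mul_comm]
            refine mul_le_mul' (ENNReal.ofReal_le_ofReal (hC.lc_mem _).2) ?_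
            exact indicator_le_self' (fun _ _ => zero_le) _
          · refine le_add_left ?_
            gcongr ?_ * _
            by_cases h2 : (s : ℝ) ∈ cell Δ M
            · rw [indicator_of_mem h2]
              exact indicator_le_self' (fun _ _ => zero_le) _
            · rw [indicator_of_notMem]
              · exact zero_le
              rintro (h3 | h3)
              · obtain ⟨k, hk, hωk⟩ := mem_iUnion₂.1 h3
                exact h1 (mem_iUnion₂.2 ⟨k, hk, hωk⟩)
              · exact h2 h3
      _ = ENNReal.ofReal c * μ Z + (cell Δ M).indicator 1 (s : ℝ) * meanIntensity μ lc s := by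
          rw [lintegral_add_left ((measurable_one.indicator hZm).const_mul _),
            lintegral_const_mul _ (measurable_one.indicator hZm), lintegral_indicator_one hZm,
            lintegral_const_mul _ hlcs, meanIntensity]
          simp
      _ ≤ _ := by
          gcongr
          exact hA s hsT
  have hF1 := measurable_thinning_term (φ := fun _ => 1) measurable_const hne
    (hmin.mono hle le_rfl) (hmax.mono hle le_rfl)
  have hgapm := measurable_meanGap (μ := μ) hlc hlb
  have hcells : ∫⁻ s in Ioc 0 T, meanGap μ lc lb s =
      ∑ k ∈ Finset.Icc 1 M, ∫⁻ s in cell Δ k, meanGap μ lc lb s := by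
    simp_rw [← lintegral_indicator measurableSet_Ioc]
    rw [← lintegral_finsetSum _ fun k _ => hgapm.indicator measurableSet_Ioc]
    refine lintegral_congr fun s => ?_
    have := sum_indicator_cell hΔ (meanGap μ lc lb) s (k := M + 1) (by omega)
    push_cast at this
    rw [add_sub_cancel_right, ← hT] at this
    exact this.symm
  calc _ ≤ _ := lintegral_mono_ae hpath
    _ = ENNReal.ofReal (2 * Δ) + ((∫⁻ ω, ∫⁻ x in box 0 T c, 1 * ‖x.2.2‖ₑ *
          (Ioc (min (lc (x.1.toNNReal, ω)) (lb (x.1.toNNReal, ω)))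
            (max (lc (x.1.toNNReal, ω)) (lb (x.1.toNNReal, ω)))).indicator 1 x.2.1 ∂P ω ∂μ) +
        ∫⁻ ω, ∫⁻ x in box 0 T c, W.indicator 1 (x.1.toNNReal, ω) * ‖x.2.2‖ₑ *
          (Ioc 0 (lc (x.1.toNNReal, ω))).indicator 1 x.2.1 ∂P ω ∂μ) := by
        have hm1 := aemeasurable_lintegral_box hP T c hF1
        refine (lintegral_add_left measurable_const _).trans ?_
        rw [lintegral_const, measure_univ, mul_one]
        exact congrArg _ (lintegral_add_left' hm1 _)
    _ ≤ ENNReal.ofReal (2 * Δ) + ((∫⁻ y, ‖y‖ₑ ∂ν) * (∫⁻ s in Ioc 0 T, 1 *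
          ∫⁻ ω, ENNReal.ofReal (max (lc (s.toNNReal, ω)) (lb (s.toNNReal, ω)) -
            min (lc (s.toNNReal, ω)) (lb (s.toNNReal, ω))) ∂μ) +
        (∫⁻ y, ‖y‖ₑ ∂ν) * (∫⁻ s in Ioc 0 T, ∫⁻ ω, W.indicator 1 (s.toNNReal, ω) *
          ENNReal.ofReal (lc (s.toNNReal, ω) - 0) ∂μ)) := by
        refine add_le_add le_rfl (add_le_add ?_ ?_)
        · exact lintegral_thinning_le_of_time hP T c (φ := fun _ => 1) measurable_const hne hmin hmax
        · exact lintegral_thinning_le hP T c hGm hne (α := fun _ => 0)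
            (@measurable_const _ _ _ 𝓕.predictable 0) hC.measurable_lc
    _ ≤ _ := by
        refine add_le_add le_rfl (add_le_add (mul_le_mul_right (le_of_eq ?_) _)
          (mul_le_mul_right ?_ _))
        · rw [← hcells]
          simp_rw [one_mul, max_sub_min_eq_abs, abs_sub_comm]
          rfl
        · calc _ ≤ ∫⁻ s in Ioc 0 T, (ENNReal.ofReal c * (ENNReal.ofReal Δ * A) +
              (cell Δ M).indicator 1 s * A) := by
                refine setLIntegral_mono' measurableSet_Ioc fun s hs => ?_
                have := hsec s.toNNReal (Real.toNNReal_le_toNNReal hs.2)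
                rwa [Real.coe_toNNReal _ hs.1.le] at this
            _ ≤ ENNReal.ofReal c * (ENNReal.ofReal Δ * A) * ENNReal.ofReal T +
                (∫⁻ s, (cell Δ M).indicator 1 s) * A := by
                rw [lintegral_add_left measurable_const, setLIntegral_const, Real.volume_Ioc,
                  sub_zero]
                gcongr
                rw [← lintegral_mul_const _ (measurable_one.indicator measurableSet_Ioc)]
                exact setLIntegral_le_lintegral _ _
            _ = _ := by
                rw [lintegral_indicator_one measurableSet_Ioc, hvol, mul_comm _ A]

end Mean

end Hawkes

namespace Hawkes

/-! ### The two error bounds -/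

section Bounds

variable {ν : Measure ℝ} {h ψ b : ℝ → ℝ} {T Δ : ℝ} {M : ℕ} {L : ℝ≥0}

lemma ExpectedSkorokhodLE_mono {r r' : ℝ} (hr : r ≤ r') (H : ExpectedSkorokhodLE.{u} ν b T M h ψ r) :
    ExpectedSkorokhodLE.{u} ν b T M h ψ r' := fun Ω _ μ _ P lam R hP hR =>
  (H Ω μ P lam R hP hR).trans (ENNReal.ofReal_le_ofReal hr)

lemma lintegral_ofReal_eq (hb : ∀ y, 0 ≤ b y) (hbi : Integrable b ν) :
    ∫⁻ y, ENNReal.ofReal (b y) ∂ν = ENNReal.ofReal (∫ y, b y ∂ν) :=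
  (ofReal_integral_eq_lintegral_ofReal hbi (Eventually.of_forall hb)).symm

lemma le_iSup_abs (hψ : IsBoundedJumpRate L ψ) (x : ℝ) : ψ x ≤ ⨆ x, |ψ x| := by
  have : BddAbove (range fun x => |ψ x|) := by
    simp_rw [fun x => abs_of_nonneg (hψ.nonneg x)]
    exact hψ.bddAbove
  exact (le_abs_self _).trans (le_ciSup this x)

/-- The mean Skorokhod distance, in terms of bounds on the mean intensity and on the mean distance
between the two intensities. -/
theorem lintegral_skorokhodDist_le_ofReal [IsProbabilityMeasure ν] {Ω : Type*} [MeasurableSpace Ω] {μ : Measure Ω}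
    [IsProbabilityMeasure μ] {P : Kernel Ω MarkSpace} {R : ℝ → Ω → ℝ} {lc lb : ℝ≥0 × Ω → ℝ} {c : ℝ}
    (hP : IsPoissonRandomMeasure μ P (poissonIntensity ν))
    (hC : Coupled μ P c T Δ M h ψ b R lc lb) (hν : Integrable (fun y : ℝ => y) ν) (hM : 1 ≤ M)
    (hΔ : 0 < Δ) (hT : T = M * Δ) {A G : ℝ} (hc0 : 0 ≤ c) (hA0 : 0 ≤ A) (hG0 : 0 ≤ G)
    (hA : ∀ t ∈ Icc 0 T, meanIntensity μ lc t ≤ ENNReal.ofReal A)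
    (hG : ∑ k ∈ Finset.Icc 1 M, ∫⁻ s in cell Δ k, meanGap μ lc lb s ≤ ENNReal.ofReal G) :
    ∫⁻ ω, skorokhodDist T (fun t => R t ω) (fun t => discreteRisk (P ω) h ψ b Δ t) ∂μ ≤
      ENNReal.ofReal (2 * Δ + (∫ y, |y| ∂ν) * (G + (c * (Δ * A) * T + A * Δ))) := by
  have hT0 : 0 ≤ T := by rw [hT]; positivity
  have hE0 : 0 ≤ ∫ y, |y| ∂ν := integral_nonneg fun _ => abs_nonneg _
  have hE : ∫⁻ y, ‖y‖ₑ ∂ν = ENNReal.ofReal (∫ y, |y| ∂ν) := by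
    rw [ofReal_integral_eq_lintegral_ofReal hν.abs (Eventually.of_forall fun _ => abs_nonneg _)]
    simp_rw [Real.enorm_eq_ofReal_abs]
  refine (lintegral_skorokhodDist_le hP hC (by rw [hE]; exact ENNReal.ofReal_ne_top) hM hΔ hT
    hA).trans ?_
  rw [hE, ENNReal.ofReal_add (by positivity) (by positivity), ENNReal.ofReal_mul hE0,
    ENNReal.ofReal_add hG0 (by positivity), ENNReal.ofReal_add (by positivity) (by positivity),
    ENNReal.ofReal_mul (p := c * (Δ * A)) (by positivity), ENNReal.ofReal_mul hc0, ENNReal.ofReal_mul hΔ.le,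
    ENNReal.ofReal_mul hA0, ← mul_add]
  gcongr

lemma eq_natCast_mul_div (hM : 1 ≤ M) : T = M * (T / M) := by
  have : (M : ℝ) ≠ 0 := by positivity
  field_simp

/-- A bound that holds without any stability assumption. -/
theorem expectedSkorokhodLE_crude [IsProbabilityMeasure ν] (hν : Integrable (fun y : ℝ => y) ν) (hb : Measurable b)
    (hb0 : ∀ y, 0 ≤ b y) (hT : 0 < T) (hM : 1 ≤ M) (hψ : IsBoundedJumpRate L ψ) {c : ℝ}
    (hc : ∀ x, ψ x ≤ c) :
    ExpectedSkorokhodLE.{u} ν b T M h ψ (2 * (T / M) +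
      (∫ y, |y| ∂ν) * (c * T + (c * (T / M * c) * T + c * (T / M)))) := by
  intro Ω _ μ _ P lam R hP hR
  have hc0 : 0 ≤ c := (hψ.nonneg 0).trans (hc 0)
  have hM' : (0 : ℝ) < M := by exact_mod_cast hM
  have hΔ : 0 < T / M := by positivity
  have hTM := eq_natCast_mul_div (T := T) hM
  obtain ⟨lc, lb, hC⟩ := exists_coupled hP hb hb0 hψ.lipschitz.continuous.measurable hψ.nonneg hc
    hΔ hTM hR
  have hgap : ∀ s, meanGap μ lc lb s ≤ ENNReal.ofReal c := fun s => by
    calc _ ≤ ∫⁻ _, ENNReal.ofReal c ∂μ := by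
          refine lintegral_mono fun ω => ENNReal.ofReal_le_ofReal (abs_le.2 ⟨?_, ?_⟩)
          · linarith [(hC.lc_mem (s.toNNReal, ω)).1, (hC.lb_mem (s.toNNReal, ω)).2]
          · linarith [(hC.lb_mem (s.toNNReal, ω)).1, (hC.lc_mem (s.toNNReal, ω)).2]
      _ = _ := by simp
  -- Used with `A = c` and `G = c T`, since both intensities lie in `[0, c]`.
  refine lintegral_skorokhodDist_le_ofReal hP hC hν hM hΔ hTM hc0 hc0 (by positivity) ?_ ?_
  · intro t _
    calc _ ≤ ∫⁻ _, ENNReal.ofReal c ∂μ :=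
          lintegral_mono fun ω => ENNReal.ofReal_le_ofReal (hC.lc_mem _).2
      _ = _ := by simp
  · calc _ ≤ ∑ k ∈ Finset.Icc 1 M, ∫⁻ _ in cell (T / M) k, ENNReal.ofReal c :=
          Finset.sum_le_sum fun k _ => lintegral_mono fun s => hgap s
      _ = ∑ k ∈ Finset.Icc 1 M, ENNReal.ofReal (c * (T / M)) := by
          refine Finset.sum_congr rfl fun k _ => ?_
          rw [setLIntegral_const, cell, Real.volume_Ioc, ENNReal.ofReal_mul hc0]
          congr 2; ring
      _ = ENNReal.ofReal (c * T) := by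
          rw [Finset.sum_const, Nat.card_Icc, nsmul_eq_mul, Nat.add_sub_cancel,
            ← ENNReal.ofReal_natCast, ← ENNReal.ofReal_mul (by positivity)]
          congr 1; field_simp

/-- The bound given by the stability of the continuous-time and of the discrete-time system. -/
theorem expectedSkorokhodLE_stable [IsProbabilityMeasure ν] (hν : Integrable (fun y : ℝ => y) ν) (hb : Measurable b)
    (hb0 : ∀ y, 0 ≤ b y) (hbi : Integrable b ν) {ρ : ℝ} (hρ0 : 0 ≤ ρ) (hρ : ρ < 1) (hT : 0 < T)
    (hh : IsStableKernel ν b L ρ h T) (hM : 1 ≤ M)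
    (hsum : L * (∑ j ∈ Finset.range (M - 1), |h ((j + 1 : ℝ) * (T / M))| * (T / M)) * ∫ y, b y ∂ν
      ≤ ρ) (hψ : IsBoundedJumpRate L ψ) {a c : ℝ} (ha : ψ 0 ≤ a) (hc : ∀ x, ψ x ≤ c) :
    ExpectedSkorokhodLE.{u} ν b T M h ψ (2 * (T / M) +
      (∫ y, |y| ∂ν) * ((1 - ρ)⁻¹ * (L * (∫ y, b y ∂ν) * ((1 - ρ)⁻¹ * a) *
        (T * kernelReg h T (T / M))) +
        (c * (T / M * ((1 - ρ)⁻¹ * a)) * T + (1 - ρ)⁻¹ * a * (T / M)))) := by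
  intro Ω _ μ _ P lam R hP hR
  have hc0 : 0 ≤ c := (hψ.nonneg 0).trans (hc 0)
  have ha0 : 0 ≤ a := (hψ.nonneg 0).trans ha
  have hM' : (0 : ℝ) < M := by exact_mod_cast hM
  have hM1 : (1 : ℝ) ≤ M := by exact_mod_cast hM
  have hΔ : 0 < T / M := by positivity
  have hΔT : T / M ≤ T := div_le_self hT.le hM1
  have hTM := eq_natCast_mul_div (T := T) hM
  have hα : 0 ≤ (1 - ρ)⁻¹ := inv_nonneg.2 (by linarith)
  have hEb : 0 ≤ ∫ y, b y ∂ν := integral_nonneg hb0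
  have hreg : 0 ≤ kernelReg h T (T / M) := kernelReg_nonneg hΔ.le hΔT
  have hbE := lintegral_ofReal_eq hb0 hbi
  have hLr : (L : ℝ≥0∞) = ENNReal.ofReal L := (ENNReal.ofReal_coe_nnreal).symm
  obtain ⟨lc, lb, hC⟩ := exists_coupled hP hb hb0 hψ.lipschitz.continuous.measurable hψ.nonneg hc
    hΔ hTM hR
  have hstab : L * (∫⁻ y, ENNReal.ofReal (b y) ∂ν) * (∫⁻ y in Ico 0 T, ‖h y‖ₑ)
      ≤ ENNReal.ofReal ρ := by
    rw [hbE, ← ofReal_intervalIntegral_abs hT.le (hh.integrableOn.mono_set Ico_subset_Icc_self),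
      hLr, ← ENNReal.ofReal_mul L.coe_nonneg, ← ENNReal.ofReal_mul (by positivity)]
    refine ENNReal.ofReal_le_ofReal (le_trans (le_of_eq ?_) hh.ratio_le)
    rw [stabilityRatio]; ring
  have hstab' : L * (∫⁻ y, ENNReal.ofReal (b y) ∂ν) * (∑ j ∈ Finset.range (M - 1),
      ‖h ((j + 1 : ℝ) * (T / M))‖ₑ * ENNReal.ofReal (T / M)) ≤ ENNReal.ofReal ρ := by
    simp_rw [Real.enorm_eq_ofReal_abs, ← ENNReal.ofReal_mul (abs_nonneg _)]
    rw [← ENNReal.ofReal_sum_of_nonneg fun j _ => by positivity, hbE, hLr,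
      ← ENNReal.ofReal_mul L.coe_nonneg, ← ENNReal.ofReal_mul (by positivity)]
    refine ENNReal.ofReal_le_ofReal (le_trans (le_of_eq ?_) hsum)
    ring
  have hA : ∀ t ∈ Icc 0 T, meanIntensity μ lc t ≤ ENNReal.ofReal ((1 - ρ)⁻¹ * a) := fun t ht => by
    rw [ENNReal.ofReal_mul hα]
    exact meanIntensity_le hP hC hh.measurable hb hb0 hψ.lipschitz ha hρ0 hρ hstab ht
  refine lintegral_skorokhodDist_le_ofReal hP hC hν hM hΔ hTM hc0 (by positivity) (by positivity)
    hA ?_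
  refine (sum_meanGap_le hP hC hh.measurable hh.integrableOn hb hb0
    (by rw [hbE]; exact ENNReal.ofReal_ne_top) hψ.lipschitz hΔ hTM hA hρ0 hρ hstab').trans ?_
  rw [hbE, hLr, ← ENNReal.ofReal_mul L.coe_nonneg, ← ENNReal.ofReal_mul (by positivity),
    ← ENNReal.ofReal_mul (by positivity), ← ENNReal.ofReal_mul hα]

/-- A lower bound for both error bounds, up to a factor `2`. -/
noncomputable def errorScale (h ψ : ℝ → ℝ) (T Δ : ℝ) : ℝ :=
  Δ * (1 + T) * (1 + ⨆ x, |ψ x|) + T * kernelReg h T Δ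

lemma ExpectedSkorokhodLE_regBound {K : ℝ} (hK : 0 ≤ K) (hT : 0 < T)
    (hM : 1 ≤ M) (H : ExpectedSkorokhodLE.{u} ν b T M h ψ (K * errorScale h ψ T (T / M))) :
    ExpectedSkorokhodLE.{u} ν b T M h ψ (2 * K * regBound h ψ T (T / M)) := by
  have hM1 : (1 : ℝ) ≤ M := by exact_mod_cast hM
  have hreg : 0 ≤ kernelReg h T (T / M) :=
    kernelReg_nonneg (by positivity) (div_le_self hT.le hM1)
  have hS : 0 ≤ ⨆ x, |ψ x| := Real.iSup_nonneg fun _ => abs_nonneg _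
  refine ExpectedSkorokhodLE_mono ?_ H
  have h1 : errorScale h ψ T (T / M) ≤ 2 * regBound h ψ T (T / M) := by
    rw [errorScale, regBound]
    have h2 : 0 ≤ T / M * (1 + T) * (1 + ⨆ x, |ψ x|) := by positivity
    have h3 : 0 ≤ T * kernelReg h T (T / M) := by positivity
    have h4 := Real.sqrt_nonneg (T * kernelReg h T (T / M))
    linarith
  calc _ ≤ K * (2 * regBound h ψ T (T / M)) := by gcongr
    _ = _ := by ring

/-- The term `Δ T ‖h‖_∞` of the bound on `T C_R` fits into the first term of `pVarBound`; the factor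
`2` pays for the two increment terms of `C_R`. -/
lemma ExpectedSkorokhodLE_pVarBound {K : ℝ} (hK : 0 ≤ K) (hT : 0 < T) (hM : 1 ≤ M)
    (hh : Measurable h) {p : ℝ} (hp : 1 ≤ p) (hV : pVariation p h T ≠ ∞)
    (H : ExpectedSkorokhodLE.{u} ν b T M h ψ (K * errorScale h ψ T (T / M))) :
    ExpectedSkorokhodLE.{u} ν b T M h ψ (2 * K * pVarBound p h ψ T (T / M)) := by
  have hM1 : (1 : ℝ) ≤ M := by exact_mod_cast hM
  have hM' : (0 : ℝ) < M := by linarith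
  have hS : 0 ≤ ⨆ x, |ψ x| := Real.iSup_nonneg fun _ => abs_nonneg _
  have hH : 0 ≤ ⨆ t : Icc 0 T, |h t| := Real.iSup_nonneg fun _ => abs_nonneg _
  refine ExpectedSkorokhodLE_mono ?_ H
  have h1 : errorScale h ψ T (T / M) ≤ 2 * pVarBound p h ψ T (T / M) := by
    have h2 := mul_kernelReg_le_pVariation hh hp hV (by positivity : 0 < T / M)
      (div_le_self hT.le hM1)
    rw [errorScale, pVarBound]
    set W := (pVariation p h T).toReal * T ^ ((2 * p - 1) / p) * (T / M) ^ (1 / p)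
    have h4 := Real.sqrt_nonneg (W + T * (T / M) * ⨆ t : Icc 0 T, |h t|)
    have h5 : 0 ≤ T / M * (1 + T) * (1 + ⨆ x, |ψ x|) := by positivity
    have h6 : 0 ≤ T / M * ⨆ t : Icc 0 T, |h t| := by positivity
    have h7 : 0 ≤ T / M * T * ⨆ t : Icc 0 T, |h t| := by positivity
    have h8 : T / M * (1 + T) * (1 + (⨆ x, |ψ x|) + ⨆ t : Icc 0 T, |h t|) =
        T / M * (1 + T) * (1 + ⨆ x, |ψ x|) + T / M * (⨆ t : Icc 0 T, |h t|) +
          T / M * T * ⨆ t : Icc 0 T, |h t| := by ring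
    linarith
  calc _ ≤ K * (2 * pVarBound p h ψ T (T / M)) := by gcongr
    _ = _ := by ring

/-- The constant of the stable case. -/
noncomputable def stableConst (ν : Measure ℝ) (b : ℝ → ℝ) (L : ℝ≥0) (ρ a : ℝ) : ℝ :=
  2 + (∫ y, |y| ∂ν) * ((1 - ρ)⁻¹ * a) +
    (∫ y, |y| ∂ν) * ((1 - ρ)⁻¹ * (L * (∫ y, b y ∂ν) * ((1 - ρ)⁻¹ * a)))

lemma stableConst_pos (hb0 : ∀ y, 0 ≤ b y) {ρ a : ℝ} (hρ : ρ < 1) (ha : 0 ≤ a) :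
    0 < stableConst ν b L ρ a := by
  have hα : 0 ≤ (1 - ρ)⁻¹ := inv_nonneg.2 (by linarith)
  have hEb : 0 ≤ ∫ y, b y ∂ν := integral_nonneg hb0
  have hE : 0 ≤ ∫ y, |y| ∂ν := integral_nonneg fun _ => abs_nonneg _
  rw [stableConst]
  positivity

theorem expectedSkorokhodLE_errorScale [IsProbabilityMeasure ν] (hν : Integrable (fun y : ℝ => y) ν) (hb : Measurable b)
    (hb0 : ∀ y, 0 ≤ b y) (hbi : Integrable b ν) {ρ : ℝ} (hρ0 : 0 ≤ ρ) (hρ : ρ < 1) (hT : 0 < T)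
    (hh : IsStableKernel ν b L ρ h T) (hM : 1 ≤ M)
    (hsum : L * (∑ j ∈ Finset.range (M - 1), |h ((j + 1 : ℝ) * (T / M))| * (T / M)) * ∫ y, b y ∂ν
      ≤ ρ) (hψ : IsBoundedJumpRate L ψ) {a : ℝ} (ha : ψ 0 ≤ a) :
    ExpectedSkorokhodLE.{u} ν b T M h ψ
      (stableConst ν b L ρ a * errorScale h ψ T (T / M)) := by
  have ha0 : 0 ≤ a := (hψ.nonneg 0).trans ha
  have hM1 : (1 : ℝ) ≤ M := by exact_mod_cast hM
  have hreg : 0 ≤ kernelReg h T (T / M) :=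
    kernelReg_nonneg (by positivity) (div_le_self hT.le hM1)
  refine ExpectedSkorokhodLE_mono ?_ (expectedSkorokhodLE_stable hν hb hb0 hbi hρ0 hρ hT hh hM hsum
    hψ ha (le_iSup_abs hψ))
  have hα : 0 ≤ (1 - ρ)⁻¹ := inv_nonneg.2 (by linarith)
  have hEb : 0 ≤ ∫ y, b y ∂ν := integral_nonneg hb0
  have hE : 0 ≤ ∫ y, |y| ∂ν := integral_nonneg fun _ => abs_nonneg _
  have hS : 0 ≤ ⨆ x, |ψ x| := Real.iSup_nonneg fun _ => abs_nonneg _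
  have hΔ : 0 ≤ T / M := by positivity
  rw [stableConst, errorScale]
  set S := ⨆ x, |ψ x|
  set D := T / (M : ℝ)
  set g := T * kernelReg h T D with hg
  have hg0 : 0 ≤ g := by positivity
  set A := (1 - ρ)⁻¹ * a
  have hA : 0 ≤ A := by positivity
  set E := ∫ y, |y| ∂ν
  set B := (1 - ρ)⁻¹ * (L * (∫ y, b y ∂ν) * A) with hB
  have hB0 : 0 ≤ B := by positivity
  have h1 : (1 - ρ)⁻¹ * (L * (∫ y, b y ∂ν) * A * g) = B * g := by rw [hB]; ring
  rw [h1]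
  -- The difference of the two bounds is a polynomial with nonnegative coefficients in nonnegative
  -- quantities.
  have h2 : (2 + E * A + E * B) * (D * (1 + T) * (1 + S) + g)
      - (2 * D + E * (B * g + (S * (D * A) * T + A * D)))
      = 2 * (D * T + D * S + D * T * S) + 2 * g + E * A * (D * T + D * S + g)
        + E * B * (D * (1 + T) * (1 + S)) := by ring
  have h3 : 0 ≤ 2 * (D * T + D * S + D * T * S) + 2 * g + E * A * (D * T + D * S + g)
        + E * B * (D * (1 + T) * (1 + S)) := by positivity
  linarith

/-- A grid defect small enough to transfer the stability of the kernel to its discretization. -/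
noncomputable def defectThreshold (ν : Measure ℝ) (b : ℝ → ℝ) (L : ℝ≥0) (ρ : ℝ) : ℝ :=
  (1 - ρ) / (2 * (L * (∫ y, b y ∂ν) + 1))

lemma defectThreshold_pos (hb0 : ∀ y, 0 ≤ b y) {ρ : ℝ} (hρ : ρ < 1) :
    0 < defectThreshold ν b L ρ := by
  have hEb : 0 ≤ ∫ y, b y ∂ν := integral_nonneg hb0
  rw [defectThreshold]
  exact div_pos (by linarith) (by positivity)

lemma sum_le_of_gridDefect_le (hb0 : ∀ y, 0 ≤ b y) {ρ : ℝ} (hρ : ρ < 1) (hT : 0 < T)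
    (hh : IsStableKernel ν b L ρ h T) (hM : 1 ≤ M)
    (hd : gridDefect h T (T / M) ≤ defectThreshold ν b L ρ) :
    L * (∑ j ∈ Finset.range (M - 1), |h ((j + 1 : ℝ) * (T / M))| * (T / M)) * ∫ y, b y ∂ν
      ≤ (1 + ρ) / 2 := by
  have hM' : (0 : ℝ) < M := by exact_mod_cast hM
  have hEb : 0 ≤ ∫ y, b y ∂ν := integral_nonneg hb0
  have h1 := sum_abs_grid_le hh.measurable hh.integrableOn (by positivity : 0 < T / M) hM
    (eq_natCast_mul_div hM)
  have h2 := hh.ratio_le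
  rw [stabilityRatio] at h2
  set X := L * ∫ y, b y ∂ν with hX
  have hX0 : 0 ≤ X := by positivity
  -- The `+ 1` in the threshold keeps its denominator positive even when `X = 0`.
  have h3 : X * defectThreshold ν b L ρ ≤ (1 - ρ) / 2 := by
    rw [defectThreshold, ← hX, mul_div_assoc', div_le_div_iff₀ (by positivity) (by norm_num)]
    nlinarith
  calc _ = X * ∑ j ∈ Finset.range (M - 1), |h ((j + 1 : ℝ) * (T / M))| * (T / M) := by
        rw [hX]; ring
    _ ≤ X * ((∫ y in (0 : ℝ)..T, |h y|) + defectThreshold ν b L ρ) := by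
        gcongr
        linarith
    _ = L * (∫ t in (0 : ℝ)..T, |h t|) * (∫ y, b y ∂ν) + X * defectThreshold ν b L ρ := by
        rw [hX]; ring
    _ ≤ _ := by linarith

end Bounds

end Hawkes

namespace Hawkes

/-! ### All step sizes at once, by a dichotomy on the grid defect. -/

section Main

variable {ν : Measure ℝ} {h ψ b : ℝ → ℝ} {T : ℝ} {M : ℕ} {L : ℝ≥0}

lemma IsStableKernel_mono {ρ ρ' : ℝ} (hρ : ρ ≤ ρ') (hh : IsStableKernel ν b L ρ h T) :
    IsStableKernel ν b L ρ' h T := ⟨hh.measurable, hh.integrableOn, hh.ratio_le.trans hρ⟩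

lemma sum_le_discreteStabilityRatio (hb0 : ∀ y, 0 ≤ b y) (hT : 0 < T) (hM : 1 ≤ M) :
    L * (∑ j ∈ Finset.range (M - 1), |h ((j + 1 : ℝ) * (T / M))| * (T / M)) * ∫ y, b y ∂ν
      ≤ discreteStabilityRatio ν b L h T M := by
  have hEb : 0 ≤ ∫ y, b y ∂ν := integral_nonneg hb0
  rw [discreteStabilityRatio]
  gcongr
  have h1 : ∑ k ∈ Finset.Icc 1 M, |h (k * (T / M))| * (T / M) =
      ∑ j ∈ Finset.range M, |h ((j + 1 : ℝ) * (T / M))| * (T / M) := by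
    rw [← Finset.Ico_succ_right_eq_Icc, Finset.sum_Ico_eq_sum_range]
    refine Finset.sum_congr (by simp) fun j _ => ?_
    push_cast
    rw [add_comm]
  rw [h1]
  exact Finset.sum_le_sum_of_subset_of_nonneg (Finset.range_mono (by omega))
    fun j _ _ => by positivity

/-- The bound for an arbitrary step size, when the constant may depend on a bound on `ψ`. -/
theorem expectedSkorokhodLE_errorScale_of_le [IsProbabilityMeasure ν]
    (hν : Integrable (fun y : ℝ => y) ν) (hb : Measurable b) (hb0 : ∀ y, 0 ≤ b y)
    (hbi : Integrable b ν) {ρ : ℝ} (hρ0 : 0 ≤ ρ) (hρ : ρ < 1) (hT : 0 < T)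
    (hh : IsStableKernel ν b L ρ h T) (hM : 1 ≤ M) (hψ : IsBoundedJumpRate L ψ) {B : ℝ}
    (hB : ∀ x, ψ x ≤ B) :
    ExpectedSkorokhodLE.{u} ν b T M h ψ ((stableConst ν b L ((1 + ρ) / 2) B + (∫ y, |y| ∂ν) * B +
      (∫ y, |y| ∂ν) * B / defectThreshold ν b L ρ) * errorScale h ψ T (T / M)) := by
  have hM1 : (1 : ℝ) ≤ M := by exact_mod_cast hM
  have hB0 : 0 ≤ B := (hψ.nonneg 0).trans (hB 0)
  have hE : 0 ≤ ∫ y, |y| ∂ν := integral_nonneg fun _ => abs_nonneg _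
  have hη := defectThreshold_pos (ν := ν) (L := L) hb0 hρ
  have hS : 0 ≤ ⨆ x, |ψ x| := Real.iSup_nonneg fun _ => abs_nonneg _
  have hΔ : 0 ≤ T / M := by positivity
  have hΔT : T / M ≤ T := div_le_self hT.le hM1
  have hreg : 0 ≤ kernelReg h T (T / M) := kernelReg_nonneg hΔ hΔT
  have hpos := stableConst_pos (ν := ν) (L := L) hb0 (by linarith : (1 + ρ) / 2 < 1) hB0
  have hscale : 0 ≤ errorScale h ψ T (T / M) := by rw [errorScale]; positivity
  -- A small defect gives discrete stability at level `(1 + ρ) / 2`. A large one makes `C_R` exceed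
  -- the threshold, and the crude bound is then already of order `T C_R`.
  by_cases hd : gridDefect h T (T / M) ≤ defectThreshold ν b L ρ
  · refine ExpectedSkorokhodLE_mono ?_ (expectedSkorokhodLE_errorScale hν hb hb0 hbi
      (by linarith : 0 ≤ (1 + ρ) / 2) (by linarith) hT (IsStableKernel_mono (by linarith) hh) hM
      (sum_le_of_gridDefect_le hb0 hρ hT hh hM hd) hψ (hB 0))
    gcongr
    rw [add_assoc]
    exact le_add_of_nonneg_right (by positivity)
  · rw [not_le] at hd
    refine ExpectedSkorokhodLE_mono ?_ (expectedSkorokhodLE_crude hν hb hb0 hT hM hψ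
      (le_iSup_abs hψ))
    have hSB : ⨆ x, |ψ x| ≤ B := ciSup_le fun x => by rw [abs_of_nonneg (hψ.nonneg x)]; exact hB x
    have hC2 : 2 ≤ stableConst ν b L ((1 + ρ) / 2) B := by
      have hα : 0 ≤ (1 - (1 + ρ) / 2)⁻¹ := inv_nonneg.2 (by linarith)
      have hEb : 0 ≤ ∫ y, b y ∂ν := integral_nonneg hb0
      rw [stableConst, add_assoc]
      exact le_add_of_nonneg_right (by positivity)
    have hT' : T ≤ T * kernelReg h T (T / M) / defectThreshold ν b L ρ := by
      rw [le_div_iff₀ hη]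
      have := hd.le.trans (gridDefect_le_kernelReg (h := h) hΔ hΔT)
      gcongr
    set E := ∫ y, |y| ∂ν
    set S := ⨆ x, |ψ x|
    set D := T / (M : ℝ)
    set η := defectThreshold ν b L ρ
    have hs : errorScale h ψ T D = D * (1 + T) * (1 + S) + T * kernelReg h T D := rfl
    set g := T * kernelReg h T D
    have hg0 : 0 ≤ g := by positivity
    have h1 : 2 * D ≤ stableConst ν b L ((1 + ρ) / 2) B * errorScale h ψ T D := by
      refine mul_le_mul hC2 ?_ hΔ hpos.le
      rw [hs]
      have : 0 ≤ D * T + D * S + D * T * S + g := by positivity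
      nlinarith
    have h2 : E * (S * (D * S) * T + S * D) ≤ E * B * errorScale h ψ T D := by
      have h4 : D * (S * T + 1) ≤ errorScale h ψ T D := by
        rw [hs]
        have : 0 ≤ D * T + D * S + g := by positivity
        nlinarith
      calc E * (S * (D * S) * T + S * D) = E * S * (D * (S * T + 1)) := by ring
        _ ≤ _ := by gcongr
    have h3 : E * (S * T) ≤ E * B / η * errorScale h ψ T D := by
      calc E * (S * T) ≤ E * (B * (g / η)) := by gcongr
        _ = E * B / η * g := by ring
        _ ≤ _ := by
          gcongr
          rw [hs]
          exact le_add_of_nonneg_left (by positivity)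
    calc _ = 2 * D + E * (S * (D * S) * T + S * D) + E * (S * T) := by ring
      _ ≤ _ := by rw [add_mul, add_mul]; gcongr

end Main

end Hawkes

/-! ### The main theorem. -/

open Hawkes

theorem mainTheorem3 (ν : Measure ℝ) [IsProbabilityMeasure ν]
    (hν : MemLp (fun y : ℝ => y) 2 ν)
    (b : ℝ → ℝ) (hb : Measurable b) (hb_nonneg : ∀ y, 0 ≤ b y) (hb_int : Integrable b ν)
    (L : ℝ≥0) (ρ : ℝ) (hρ : ρ < 1) :
    -- a constant depending only on `ν`, `b`, `L`, the stability level `ρ` and a bound on `ψ 0`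
    (∀ a : ℝ, ∃ K : ℝ, 0 < K ∧ ∀ (T : ℝ) (h : ℝ → ℝ), 0 < T → IsStableKernel ν b L ρ h T →
      -- under the discrete stability assumption: every step size
      (∀ M : ℕ, 1 ≤ M → discreteStabilityRatio ν b L h T M ≤ ρ →
        ∀ ψ : ℝ → ℝ, IsBoundedJumpRate L ψ → ψ 0 ≤ a →
          ExpectedSkorokhodLE.{u} ν b T M h ψ (K * regBound h ψ T (T / M)) ∧
          ∀ p : ℝ, 1 ≤ p → pVariation p h T ≠ ∞ →
            ExpectedSkorokhodLE.{u} ν b T M h ψ (K * pVarBound p h ψ T (T / M))) ∧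
      -- under the limit assumption: every small enough step size
      (Tendsto (fun M : ℕ => gridDefect h T (T / M)) atTop (𝓝 0) →
        ∃ Δ₀ : ℝ, 0 < Δ₀ ∧ ∀ M : ℕ, 1 ≤ M → T / M ≤ Δ₀ →
          ∀ ψ : ℝ → ℝ, IsBoundedJumpRate L ψ → ψ 0 ≤ a →
            ExpectedSkorokhodLE.{u} ν b T M h ψ (K * regBound h ψ T (T / M))) ∧
      -- finite `p`-variation implies the limit assumption
      (∀ p : ℝ, 1 ≤ p → pVariation p h T ≠ ∞ →
        Tendsto (fun Δ : ℝ => gridDefect h T Δ) (𝓝[>] 0) (𝓝 0) ∧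
        ∃ Δ₀ : ℝ, 0 < Δ₀ ∧ ∀ M : ℕ, 1 ≤ M → T / M ≤ Δ₀ →
          ∀ ψ : ℝ → ℝ, IsBoundedJumpRate L ψ → ψ 0 ≤ a →
            ExpectedSkorokhodLE.{u} ν b T M h ψ (K * pVarBound p h ψ T (T / M)))) ∧
    -- under the limit assumption, every step size, the constant also depending on a bound on `ψ`
    (∀ B : ℝ, ∃ K : ℝ, 0 < K ∧ ∀ (T : ℝ) (h : ℝ → ℝ), 0 < T → IsStableKernel ν b L ρ h T →
      ∀ M : ℕ, 1 ≤ M → ∀ ψ : ℝ → ℝ, IsBoundedJumpRate L ψ → (∀ x, ψ x ≤ B) →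
        (Tendsto (fun N : ℕ => gridDefect h T (T / N)) atTop (𝓝 0) →
          ExpectedSkorokhodLE.{u} ν b T M h ψ (K * regBound h ψ T (T / M))) ∧
        ∀ p : ℝ, 1 ≤ p → pVariation p h T ≠ ∞ →
          ExpectedSkorokhodLE.{u} ν b T M h ψ (K * pVarBound p h ψ T (T / M))) := by
  have hν1 : Integrable (fun y : ℝ => y) ν := hν.integrable (by norm_num)
  -- A negative `ρ` is allowed, while the absorption argument needs a nonnegative level.
  set ρ₀ : ℝ := max ρ 0 with hρ₀
  have hρ₀0 : 0 ≤ ρ₀ := le_max_right _ _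
  have hρ₀1 : ρ₀ < 1 := max_lt hρ zero_lt_one
  have hρρ₀ : ρ ≤ ρ₀ := le_max_left _ _
  have hη := defectThreshold_pos (ν := ν) (L := L) hb_nonneg hρ₀1
  have hmid0 : 0 ≤ (1 + ρ₀) / 2 := by linarith
  have hmid1 : (1 + ρ₀) / 2 < 1 := by linarith
  refine ⟨fun a => ?_, fun B => ?_⟩
  · set K := stableConst ν b L ((1 + ρ₀) / 2) (max a 0)
    have hK : 0 < K := stableConst_pos hb_nonneg hmid1 (le_max_right _ _)
    refine ⟨2 * K, by positivity, fun T h hT hh => ?_⟩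
    have hh₀ := IsStableKernel_mono hρρ₀ hh
    have hh₁ := IsStableKernel_mono (by linarith : ρ₀ ≤ (1 + ρ₀) / 2) hh₀
    have hdefect : ∀ M : ℕ, 1 ≤ M → gridDefect h T (T / M) ≤ defectThreshold ν b L ρ₀ →
        ∀ ψ : ℝ → ℝ, IsBoundedJumpRate L ψ → ψ 0 ≤ a →
          ExpectedSkorokhodLE.{u} ν b T M h ψ (K * errorScale h ψ T (T / M)) :=
      fun M hM hd ψ hψ ha => expectedSkorokhodLE_errorScale hν1 hb hb_nonneg hb_int hmid0 hmid1 hT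
        hh₁ hM (sum_le_of_gridDefect_le hb_nonneg hρ₀1 hT hh₀ hM hd) hψ
        (ha.trans (le_max_left _ _))
    refine ⟨fun M hM hd ψ hψ ha => ?_, fun hlim => ?_, fun p hp hV => ?_⟩
    · have H := expectedSkorokhodLE_errorScale.{u} hν1 hb hb_nonneg hb_int hmid0 hmid1 hT hh₁ hM
        ((sum_le_discreteStabilityRatio hb_nonneg hT hM).trans (by linarith)) hψ
        (ha.trans (le_max_left a 0))
      exact ⟨ExpectedSkorokhodLE_regBound hK.le hT hM H, fun p hp hV =>
        ExpectedSkorokhodLE_pVarBound hK.le hT hM hh.measurable hp hV H⟩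
    · obtain ⟨N, hN⟩ := eventually_atTop.1 (hlim.eventually (ge_mem_nhds hη))
      -- A mesh at most `T / (N + 1)` forces `M ≥ N + 1`, and the `+ 1` avoids dividing by zero. The
      -- rank `N` depends on the kernel alone, not on `ψ`.
      refine ⟨T / (N + 1 : ℕ), by positivity, fun M hM hMN ψ hψ ha => ?_⟩
      have hMN' : N + 1 ≤ M := by
        have := (div_le_div_iff_of_pos_left hT (by positivity) (by positivity)).1 hMN
        exact_mod_cast this
      exact ExpectedSkorokhodLE_regBound hK.le hT hM (hdefect M hM (hN M (by omega)) ψ hψ ha)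
    · have hlim := tendsto_gridDefect hh.measurable hT hp hV
      refine ⟨hlim, ?_⟩
      obtain ⟨Δ₀, hΔ₀, hsub⟩ := mem_nhdsGT_iff_exists_Ioc_subset.1
        (hlim.eventually (ge_mem_nhds hη))
      refine ⟨Δ₀, hΔ₀, fun M hM hMΔ ψ hψ ha => ?_⟩
      exact ExpectedSkorokhodLE_pVarBound hK.le hT hM hh.measurable hp hV
        (hdefect M hM (hsub ⟨by positivity, hMΔ⟩) ψ hψ ha)
  · set K := stableConst ν b L ((1 + ρ₀) / 2) (max B 0) + (∫ y, |y| ∂ν) * max B 0 +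
      (∫ y, |y| ∂ν) * max B 0 / defectThreshold ν b L ρ₀ with hKdef
    have hE : 0 ≤ ∫ y, |y| ∂ν := integral_nonneg fun _ => abs_nonneg _
    have hK : 0 < K := by
      have h1 := stableConst_pos (ν := ν) (L := L) hb_nonneg hmid1 (le_max_right B 0)
      positivity
    refine ⟨2 * K, by positivity, fun T h hT hh M hM ψ hψ hB => ?_⟩
    have H := expectedSkorokhodLE_errorScale_of_le.{u} hν1 hb hb_nonneg hb_int hρ₀0 hρ₀1 hT
      (IsStableKernel_mono hρρ₀ hh) hM hψ (fun x => (hB x).trans (le_max_left B 0))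
    exact ⟨fun _ => ExpectedSkorokhodLE_regBound hK.le hT hM H, fun p hp hV =>
      ExpectedSkorokhodLE_pVarBound hK.le hT hM hh.measurable hp hV H⟩
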